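/- Let $\mu$ be a probability measure on $\mathbb Z$ with finite first moment and mean $0$. Put $\bar x=\sup\{n:\mu(\{n\})>0\}$, $\underline x=\inf\{n:\mu(\{n\})>0\}$, $\bar\mu(x)=\mu([x,\infty))$, $\psi_\mu(x)=\frac1{\bar\mu(x)}\int_{[x,\infty)}y\,d\mu(y)$ (and $\psi_\mu(x)=x$ if $\bar\mu(x)=0$), and $b_\mu(y)=\sup\{x\in\mathbb R:\psi_\mu(x)\le y\}$ for $y\ge0$. For an integer $0\le n<\bar x$ list the integers in $\{b_\mu(y):y\in[n,n+1]\}\cap(-\infty,n]$ as $x^n_1>x^n_2>\dots>x^n_{m_n+1}$; for $n=0$ and $\underline x=-\infty$ the list is infinite and $m_0+1:=\infty$. If $n\ge1$ or $\underline x>-\infty$, write $z=x^n_{m_n+1}$ and let $$\Gamma^n=\bar\mu(z)\frac{\psi_\mu(z)-z}{n-z},\qquad g^n_k=\frac{n+1-x^n_k}{\Gamma^n}\mu(\{x^n_k\})\ (2\le k\le m_n),\qquad g^n_{m_n+1}=\frac{n+1-z}{\Gamma^n}\Big[\mu(\{z\})-\bar\mu(z)\frac{n-\psi_\mu(z)}{n-z}\Big],$$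 $f^n_0=1$, $f^n_{m_n+1}=0$, $f^n_k=f^n_{k+1}+g^n_{k+1}$ for $1\le k\le m_n$, and $\rho^n_k=1-f^n_k/f^n_{k-1}$ for $1\le k\le m_n$, $\rho^n_{m_n+1}=1$. If $n=0$ and $\underline x=-\infty$, let $g^0_k=(1-x^0_k)\mu(\{x^0_k\})$ for $k\ge2$, $f^0_0=1$, $f^0_k=\sum_{i>k}g^0_i$ and $\rho^0_k=1-f^0_k/f^0_{k-1}$ for $k\ge1$. Then all $\rho^n_k$ lie in $[0,1]$. Let $S$ be a simple symmetric random walk started at $0$ on a filtered probability space $(\Omega,\mathcal F,\mathbb F,\mathbb P)$ (discrete time $t=0,1,2,\dots$), $S^*_t=\max_{r\le t}S_r$, $H_{\bar x}=\inf\{t:S_t=\bar x\}$. Let $\eta=(\eta^n_k:0\le n<\bar x,\ 1\le k\le m_n+1,\ k<\infty)$ be mutually independent $\{0,1\}$-valued random variables, independent of $S$, with $\mathbb P(\eta^n_k=0)=\rho^n_k$. Let $\mathbb F^{S,\eta}$ be the filtration $\mathcal F^{S,\eta}_t=\sigma(S_u,\ \eta^{S^*_u}_k: u\le t,\ k)$.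 For a filtration $\mathbb G$, let $\mathrm{SEP}(\mathbb G,\mu)$ be the set of a.s. finite $\mathbb G$-stopping times $\tau$ such that $S_\tau\sim\mu$ and $(S_{t\wedge\tau})_{t\ge0}$ is uniformly integrable. Define $$\tau^{AY}_\mu=\inf\{t\ge0:\ S_t\le x^{S^*_t}_k\text{ and }\eta^{S^*_t}_k=0\text{ for some }k\}\wedge H_{\bar x}.$$ Then $S$ is a simple symmetric random walk relative to $\mathbb F^{S,\eta}$, $\tau^{AY}_\mu\in\mathrm{SEP}(\mathbb F^{S,\eta},\mu)$, and for every $\sigma\in\mathrm{SEP}(\mathbb F,\mu)$ and every integer $n\ge1$ $$\mathbb P(S^*_\sigma\ge n)\le\mathbb P(S^*_{\tau^{AY}_\mu}\ge n)=\bar\mu(b_\mu(n))\,\frac{\psi_\mu(b_\mu(n))-b_\mu(n)}{n-b_\mu(n)}$$ with the convention $0/0=1$. The right-hand side equals $\bar\mu^{HL}(n)$, the tail at $n$ of the Hardy–Littlewood transform of $\mu$, that is, $\bar\mu^{HL}(x)=\mathrm{Leb}\{v\in(0,1):\frac1v\int_0^v q(w)\,dw\ge x\}$, where $q(w)=\inf\{x\in\mathbb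 R:\mu((x,\infty))\le w\}$. -/

import Mathlib

open MeasureTheory ProbabilityTheory

namespace AzemaYor

noncomputable section

/-! ### The measure: support bounds, tail, barycentre and its inverse -/

/-- The upper end of the support of `μ`, in `[-∞, ∞]`. -/
def upper (μ : Measure ℤ) : EReal := sSup {x | ∃ j : ℤ, μ {j} ≠ 0 ∧ x = ((j : ℝ) : EReal)}

/-- The lower end of the support of `μ`, in `[-∞, ∞]`. -/
def lower (μ : Measure ℤ) : EReal := sInf {x | ∃ j : ℤ, μ {j} ≠ 0 ∧ x = ((j : ℝ) : EReal)}

/-- The tail `μ([x, ∞))`. -/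
def tail (μ : Measure ℤ) (x : ℝ) : ℝ := μ.real {j : ℤ | x ≤ (j : ℝ)}

open Classical in
/-- The barycentre function: the mean of `μ` conditioned on `[x, ∞)`, and `x` if this half-line
has no mass. -/
def barycentre (μ : Measure ℤ) (x : ℝ) : ℝ :=
  if tail μ x = 0 then x else (∫ j in {j : ℤ | x ≤ (j : ℝ)}, (j : ℝ) ∂μ) / tail μ x

/-- The right-continuous inverse `sup {x ∈ ℝ : ψ(x) ≤ y}` of the barycentre function; it can take
the value `-∞` (the supremum of the empty set), which happens at `y = 0` if the support of `μ` is
unbounded below. -/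
def bInv (μ : Measure ℤ) (y : ℝ) : EReal :=
  sSup {z | ∃ x : ℝ, barycentre μ x ≤ y ∧ z = (x : EReal)}

/-! ### Stopping levels and coin biases -/

/-- The integers `≤ n` of the form `b(y)` with `y ∈ [n, n + 1]`. -/
def levelSet (μ : Measure ℤ) (n : ℕ) : Set ℤ :=
  {j | j ≤ n ∧ ∃ y : ℝ, (n : ℝ) ≤ y ∧ y ≤ (n : ℝ) + 1 ∧ bInv μ y = ((j : ℝ) : EReal)}

/-- The `k`-th largest element of the level set, for `1 ≤ k ≤ #(levelSet μ n)`: the elements are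
listed by their distance `i` to `n`, in increasing order. -/
def level (μ : Measure ℤ) (n k : ℕ) : ℤ :=
  (n : ℤ) - (Nat.nth (fun i : ℕ => (n : ℤ) - (i : ℤ) ∈ levelSet μ n) (k - 1) : ℤ)

/-- The number `m_n + 1` of levels when the level set is finite. -/
def numLevels (μ : Measure ℤ) (n : ℕ) : ℕ := (levelSet μ n).ncard

/-- The lowest level, when the level set is finite. -/
def lowest (μ : Measure ℤ) (n : ℕ) : ℤ := level μ n (numLevels μ n)

/-- `Γ^n`. -/
def bigGamma (μ : Measure ℤ) (n : ℕ) : ℝ :=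
  tail μ (lowest μ n) * ((barycentre μ (lowest μ n) - lowest μ n) / ((n : ℝ) - lowest μ n))

open Classical in
/-- `g^n_k` for a finite level set, `2 ≤ k ≤ m_n + 1`. -/
def gFin (μ : Measure ℤ) (n k : ℕ) : ℝ :=
  if k = numLevels μ n then
    ((n : ℝ) + 1 - lowest μ n) / bigGamma μ n *
      (μ.real {lowest μ n} -
        tail μ (lowest μ n) * (((n : ℝ) - barycentre μ (lowest μ n)) / ((n : ℝ) - lowest μ n)))
  else ((n : ℝ) + 1 - level μ n k) / bigGamma μ n * μ.real {level μ n k}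

/-- `f^n_k` for a finite level set: `f^n_0 = 1`, and for `1 ≤ k ≤ m_n + 1` the solution
`∑_{k < i ≤ m_n + 1} g^n_i` of `f^n_{m_n + 1} = 0`, `f^n_k = f^n_{k + 1} + g^n_{k + 1}`. -/
def fFin (μ : Measure ℤ) (n k : ℕ) : ℝ :=
  if k = 0 then 1 else ∑ i ∈ Finset.Ioc k (numLevels μ n), gFin μ n i

/-- `g^0_k`, `k ≥ 2`, when the support of `μ` is unbounded below. -/
def gInf (μ : Measure ℤ) (k : ℕ) : ℝ := (1 - (level μ 0 k : ℝ)) * μ.real {level μ 0 k}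

/-- `f^0_k` when the support of `μ` is unbounded below: `f^0_0 = 1` and
`f^0_k = ∑_{i > k} g^0_i` for `k ≥ 1`. -/
def fInf (μ : Measure ℤ) (k : ℕ) : ℝ :=
  if k = 0 then 1 else ∑' i : ℕ, gInf μ (k + 1 + i)

open Classical in
/-- The bias `ρ^n_k`: the probability that the coin tossed at the `k`-th level below the running
maximum `n` shows `0`, which means that one stops. -/
def rho (μ : Measure ℤ) (n k : ℕ) : ℝ :=
  if n = 0 ∧ lower μ = ⊥ then 1 - fInf μ k / fInf μ (k - 1)
  else if k = numLevels μ n then 1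
  else 1 - fFin μ n k / fFin μ n (k - 1)

/-- `(n, k)` indexes a coin if `0 ≤ n < upper μ` and `1 ≤ k ≤ m_n + 1`, where `m_n + 1` is the
number of levels, possibly infinite. -/
def IsCoin (μ : Measure ℤ) (p : ℕ × ℕ) : Prop :=
  ((p.1 : ℝ) : EReal) < upper μ ∧ 1 ≤ p.2 ∧ (p.2 : ℕ∞) ≤ (levelSet μ p.1).encard

/-- The index set of the coins. -/
def CoinIndex (μ : Measure ℤ) : Type := {p : ℕ × ℕ // IsCoin μ p}

/-! ### Random walk, coins, stopping times -/

section

variable {Ω : Type*} {mΩ : MeasurableSpace Ω}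

/-- `S` is a simple symmetric random walk started at `0` on the filtered probability space
`(Ω, 𝔽, P)`. -/
structure IsSimpleRandomWalk (S : ℕ → Ω → ℤ) (𝔽 : Filtration ℕ mΩ) (P : Measure Ω) : Prop where
  adapted : ∀ t, Measurable[𝔽 t] (S t)
  zero : ∀ ω, S 0 ω = 0
  up : ∀ t, P {ω | S (t + 1) ω - S t ω = 1} = 1 / 2
  down : ∀ t, P {ω | S (t + 1) ω - S t ω = -1} = 1 / 2
  indep : ∀ t, Indep (MeasurableSpace.comap (fun ω => S (t + 1) ω - S t ω) ⊤) (𝔽 t) P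

theorem IsSimpleRandomWalk.measurable {S : ℕ → Ω → ℤ} {𝔽 : Filtration ℕ mΩ} {P : Measure Ω}
    (h : IsSimpleRandomWalk S 𝔽 P) (t : ℕ) : Measurable (S t) :=
  (h.adapted t).mono (𝔽.le t) le_rfl

/-- The coins: mutually independent `{0, 1}`-valued variables, independent of the walk, the coin
`(n, k)` showing `0` with probability `ρ^n_k`. -/
structure IsCoinFamily (μ : Measure ℤ) (η : CoinIndex μ → Ω → Fin 2) (S : ℕ → Ω → ℤ)
    (P : Measure Ω) : Prop where
  measurable : ∀ i, Measurable (η i)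
  prob_zero : ∀ i, P.real {ω | η i ω = 0} = rho μ i.1.1 i.1.2
  iIndep : iIndepFun η P
  indep : IndepFun (fun ω i => η i ω) (fun ω t => S t ω) P

/-- The running maximum `S*_t = max_{r ≤ t} S_r`. -/
def runMax (S : ℕ → Ω → ℤ) (t : ℕ) (ω : Ω) : ℤ :=
  (Finset.range (t + 1)).sup' Finset.nonempty_range_add_one (fun r => S r ω)

open Classical in
/-- The coin `η^n_k`, with the constant value `1` where there is no such coin, so that nothing is
revealed there. -/
def coinAt {μ : Measure ℤ} (η : CoinIndex μ → Ω → Fin 2) (k n : ℕ) (ω : Ω) : Fin 2 :=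
  if h : IsCoin μ (n, k) then η ⟨(n, k), h⟩ ω else 1

/-- The coin `η^{S*_u}_k` in force at time `u`. -/
def shownCoin {μ : Measure ℤ} (S : ℕ → Ω → ℤ) (η : CoinIndex μ → Ω → Fin 2) (u k : ℕ) (ω : Ω) :
    Fin 2 :=
  coinAt η k (runMax S u ω).toNat ω

theorem measurable_runMax {S : ℕ → Ω → ℤ} (hS : ∀ t, Measurable (S t)) (t : ℕ) :
    Measurable (runMax S t) := by
  have h := Finset.measurable_range_sup' (f := S) (n := t) (fun k _ => hS k)
  convert h using 1
  ext ω
  simp [runMax, Finset.sup'_apply]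

theorem measurable_coinAt {μ : Measure ℤ} {η : CoinIndex μ → Ω → Fin 2}
    (hη : ∀ i, Measurable (η i)) (k n : ℕ) : Measurable (coinAt η k n) := by
  by_cases h : IsCoin μ (n, k)
  · have e : coinAt η k n = η ⟨(n, k), h⟩ := funext fun ω => dif_pos h
    exact e ▸ hη _
  · have e : coinAt η k n = fun _ => 1 := funext fun ω => dif_neg h
    exact e ▸ measurable_const

theorem measurable_runMax_toNat {S : ℕ → Ω → ℤ} (hS : ∀ t, Measurable (S t)) (u : ℕ) :
    Measurable (fun ω => (runMax S u ω).toNat) :=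
  (measurable_of_countable Int.toNat).comp (measurable_runMax hS u)

theorem measurable_coinAt_prod {μ : Measure ℤ} {η : CoinIndex μ → Ω → Fin 2}
    (hη : ∀ i, Measurable (η i)) (k : ℕ) :
    Measurable (fun q : ℕ × Ω => coinAt η k q.1 q.2) :=
  measurable_from_prod_countable_right (measurable_coinAt hη k)

theorem measurable_shownCoin {μ : Measure ℤ} {S : ℕ → Ω → ℤ} {η : CoinIndex μ → Ω → Fin 2}
    (hS : ∀ t, Measurable (S t)) (hη : ∀ i, Measurable (η i)) (u k : ℕ) :
    Measurable (shownCoin S η u k) := by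
  have h := (measurable_coinAt_prod hη k).comp ((measurable_runMax_toNat hS u).prodMk measurable_id)
  exact h

/-- The filtration `F_t = σ(S_u, η^{S*_u}_k : k, u ≤ t)`. -/
def coinFiltration {μ : Measure ℤ} (S : ℕ → Ω → ℤ) (η : CoinIndex μ → Ω → Fin 2)
    (hS : ∀ t, Measurable (S t)) (hη : ∀ i, Measurable (η i)) : Filtration ℕ mΩ where
  seq t := ⨆ u : ℕ, ⨆ _ : u ≤ t,
    MeasurableSpace.comap (S u) ⊤ ⊔ ⨆ k : ℕ, MeasurableSpace.comap (shownCoin S η u k) ⊤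
  mono' := fun _ _ hst => iSup₂_le fun u hu => le_iSup₂_of_le u (hu.trans hst) le_rfl
  le' := fun _ => iSup₂_le fun u _ => sup_le (hS u).comap_le
    (iSup_le fun k => (measurable_shownCoin hS hη u k).comap_le)

/-- The first element of a set of times, `⊤` if there is none. -/
def firstTime (A : Set ℕ) : WithTop ℕ := sInf ((fun t : ℕ => (t : ℕ∞)) '' A)

/-- The randomized stopping time: the first time `t` at which `S_t ≤ x^n_k` and `η^n_k = 0` for
`n = S*_t` and some `k`, or the first visit to the top of the support, whichever is earlier. -/
def tauAY {μ : Measure ℤ} (S : ℕ → Ω → ℤ) (η : CoinIndex μ → Ω → Fin 2) (ω : Ω) : WithTop ℕ :=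
  min
    (firstTime {t | ∃ i : CoinIndex μ, (i.1.1 : ℤ) = runMax S t ω ∧
      S t ω ≤ level μ i.1.1 i.1.2 ∧ η i ω = 0})
    (firstTime {t | ((S t ω : ℝ) : EReal) = upper μ})

/-- The solutions of the Skorokhod embedding problem for `μ`: `𝔽`-stopping times `τ`, almost
surely finite, with `S_τ ∼ μ` and `(S_{t ∧ τ})_t` uniformly integrable. -/
def SEP (S : ℕ → Ω → ℤ) (𝔽 : Filtration ℕ mΩ) (P : Measure Ω) (μ : Measure ℤ) :
    Set (Ω → WithTop ℕ) :=
  {τ | IsStoppingTime 𝔽 τ ∧ (∀ᵐ ω ∂P, τ ω ≠ ⊤) ∧ HasLaw (stoppedValue S τ) μ P ∧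
    UniformIntegrable (fun (t : ℕ) ω => ((stoppedProcess S τ t ω : ℤ) : ℝ)) 1 P}

end

/-! ### The bound -/

open Classical in
/-- Division of real numbers with the convention `0 / 0 = 1`. -/
def ratio (a c : ℝ) : ℝ := if a = 0 ∧ c = 0 then 1 else a / c

/-- `μ̄(b(n)) (ψ(b(n)) - b(n)) / (n - b(n))`. For `n ≥ 1` the value `b(n)` is a real number. -/
def maxBound (μ : Measure ℤ) (n : ℕ) : ℝ :=
  tail μ (bInv μ n).toReal *
    ratio (barycentre μ (bInv μ n).toReal - (bInv μ n).toReal) ((n : ℝ) - (bInv μ n).toReal)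

/-- The upper-tail quantile function of `μ`, for `v ∈ (0, 1)`. -/
def tailQuantile (μ : Measure ℤ) (v : ℝ) : ℝ := sInf {x : ℝ | μ.real {j : ℤ | x < (j : ℝ)} ≤ v}

/-- The tail `x ↦ P(X ≥ x)` of the Hardy–Littlewood transform of `μ`: the law, for `v` uniform on
`(0, 1)`, of the average over `(0, v)` of the upper-tail quantile function. -/
def hardyLittlewoodTail (μ : Measure ℤ) (x : ℝ) : ℝ :=
  volume.real {v : ℝ | v ∈ Set.Ioo 0 1 ∧ x ≤ (1 / v) * ∫ w in (0 : ℝ)..v, tailQuantile μ w}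

end

end AzemaYor

/-!
The law of the stopped walk is computed from a family of sub-measures of `μ`. For `1 ≤ n`
not above the support there is exactly one way of cutting off the lower part of `μ`, splitting at
most one atom `z < n`, such that what remains has barycentre `n`; for `n = 0` nothing is cut off,
and for `n` above the support nothing is left. The remaining masses `residual μ n j` decrease in
`n`, and their total is called `reach μ n`. The argument rests on three facts.

* The bound and the Hardy–Littlewood tail are both equal to `reach μ n`: the former because,
  for `n` below the top of the support, `b(n)` is the transition point `z` (`maxBound_eq_reach`),
  the latter because the average of the quantile function over `(0, v)` is at least `n` exactly if
  `v ≤ reach μ n` (`hardyLittlewoodTail_eq_reach`).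
* The coins implement the residual masses. With
  `weight μ n j = (n + 1 - j) (residual μ n j - residual μ (n + 1) j)`, the barycentre property
  gives `∑ j, weight μ n j = reach μ n`, the weights are supported by the level set, and `ρ^n_k` is the
  conditional probability, given that no higher level has been chosen, of the `k`-th level in the
  law `weight μ n / reach μ n` (`rho_eq`). From `n` the walk hits the level `j` before `n + 1` with
  probability `1 / (n + 1 - j)`. By induction on `n`, it reaches `n` with probability `reach μ n`,
  and it is stopped at `j` while its maximum equals `n` with probability
  `residual μ n j - residual μ (n + 1) j` (`measureReal_reached`, `stoppedAt_inter`). Summation over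
  `n` gives the law `μ` (`measureReal_stoppedAt`) and the mass `residual μ n j` for the event that
  `n` is reached and the walk stopped at `j`.
* If `σ` is any solution, the martingale `(S - n) 1 {S* ≥ n}` yields
  `(n - z) P (S*_σ ≥ n) ≤ E (S_σ - z)⁺ = (n - z) reach μ n` (`measureReal_runMax_le_reach`).

The exit probabilities are obtained from a bounded stochastic integral of the walk in the filtration
that knows all the coins from the start. Such an integral stops betting almost surely, since its
variance is the expected number of bets, so no recurrence result is needed. Uniform integrability
is obtained from `E S⁺_{t ∧ τ} ≤ E S⁺_τ`: freezing `S⁺` at `n = t + 1` once `S*` reaches `n` gives a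
bounded submartingale that agrees with `S⁺` up to time `t`, and its terminal mean is at most `E
S⁺_τ` because `S_τ` has mean `n` on the event that `n` is reached (`setIntegral_reached`).
-/

namespace AzemaYor

set_option linter.unusedSectionVars false

/-! ### The excess, the residual mass and the reach -/

section Residual

open Set Filter Topology

variable {μ : Measure ℤ}

theorem hasSum_integral {f : ℤ → ℝ} (hf : Integrable f μ) :
    HasSum (fun i => f i * μ.real {i}) (∫ i, f i ∂μ) := by
  have h : Measure.sum (fun i => μ {i} • Measure.dirac i) = μ := Measure.sum_smul_dirac μ
  have hf' : Integrable f (Measure.sum fun i => μ {i} • Measure.dirac i) := by rwa [h]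
  have h2 := hasSum_integral_measure hf'
  rw [h] at h2
  refine h2.congr_fun fun i => ?_
  rw [integral_smul_measure, integral_dirac, measureReal_def, smul_eq_mul, mul_comm]

theorem hasSum_setIntegral {f : ℤ → ℝ} (hf : Integrable f μ) (s : Set ℤ) :
    HasSum (s.indicator fun i => f i * μ.real {i}) (∫ i in s, f i ∂μ) := by
  rw [← integral_indicator (Set.to_countable s).measurableSet]
  convert hasSum_integral (hf.indicator (Set.to_countable s).measurableSet) using 2 with i
  by_cases h : i ∈ s <;> simp [h]

/-- The mass `μ([j, ∞))` weighted by the distance to `y`: it is nonpositive exactly when the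
barycentre of `[j, ∞)` is at most `y`. -/
noncomputable def excess (μ : Measure ℤ) (y : ℝ) (j : ℤ) : ℝ := ∫ i in Ici j, ((i : ℝ) - y) ∂μ

variable [IsProbabilityMeasure μ]

theorem tail_intCast (j : ℤ) : tail μ j = μ.real (Ici j) := by
  simp only [tail, Int.cast_le]; rfl

theorem setOf_le_intCast (x : ℝ) : {j : ℤ | x ≤ (j : ℝ)} = Ici ⌈x⌉ := by
  ext j; simp [Int.ceil_le]

theorem tail_eq (x : ℝ) : tail μ x = μ.real (Ici ⌈x⌉) := by
  rw [tail, setOf_le_intCast]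

theorem integrable_sub_const (hint : Integrable (fun j : ℤ => (j : ℝ)) μ) (y : ℝ) :
    Integrable (fun j : ℤ => (j : ℝ) - y) μ := hint.sub (integrable_const y)

theorem Ici_eq_insert_add_one (j : ℤ) : Ici j = insert j (Ici (j + 1)) := by
  ext i; simp only [mem_Ici, mem_insert_iff]; omega

theorem setIntegral_Ici_eq {f : ℤ → ℝ} (hf : Integrable f μ) (j : ℤ) :
    ∫ i in Ici j, f i ∂μ = f j * μ.real {j} + ∫ i in Ici (j + 1), f i ∂μ := by
  rw [Ici_eq_insert_add_one, insert_eq, setIntegral_union (by simp) measurableSet_Ici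
    hf.integrableOn hf.integrableOn]
  congr 1
  rw [integral_singleton, smul_eq_mul, mul_comm]

theorem measureReal_Ici_eq (j : ℤ) : μ.real (Ici j) = μ.real {j} + μ.real (Ici (j + 1)) := by
  rw [Ici_eq_insert_add_one, insert_eq, measureReal_union (by simp) measurableSet_Ici]

theorem excess_eq_add (hint : Integrable (fun j : ℤ => (j : ℝ)) μ) (y : ℝ) (j : ℤ) :
    excess μ y j = (j - y) * μ.real {j} + excess μ y (j + 1) :=
  setIntegral_Ici_eq (integrable_sub_const hint y) j

theorem excess_eq (hint : Integrable (fun j : ℤ => (j : ℝ)) μ) (y : ℝ) (j : ℤ) :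
    excess μ y j = (∫ i in Ici j, (i : ℝ) ∂μ) - y * μ.real (Ici j) := by
  rw [excess, integral_sub hint.integrableOn (integrable_const y).integrableOn]
  simp [mul_comm]

theorem excess_anti (hint : Integrable (fun j : ℤ => (j : ℝ)) μ) {y y' : ℝ} (h : y ≤ y') (j : ℤ) :
    excess μ y' j ≤ excess μ y j := by
  rw [excess_eq hint, excess_eq hint]
  have := mul_le_mul_of_nonneg_right h (measureReal_nonneg (μ := μ) (s := Ici j))
  linarith

theorem excess_le_add_one (hint : Integrable (fun j : ℤ => (j : ℝ)) μ) {y : ℝ} {j : ℤ}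
    (h : (j : ℝ) ≤ y) : excess μ y j ≤ excess μ y (j + 1) := by
  rw [excess_eq_add hint]
  have := mul_nonneg (sub_nonneg.2 h) (measureReal_nonneg (μ := μ) (s := {j}))
  linarith

theorem excess_mono (hint : Integrable (fun j : ℤ => (j : ℝ)) μ) {y : ℝ} {i j : ℤ} (hij : i ≤ j)
    (h : (j : ℝ) ≤ y + 1) : excess μ y i ≤ excess μ y j := by
  induction j, hij using Int.leInduction with
  | base => rfl
  | succ j hij ih =>
    push_cast at h
    exact (ih (by linarith)).trans (excess_le_add_one hint (by linarith))

theorem excess_nonneg_of_le {y : ℝ} {j : ℤ} (h : y ≤ (j : ℝ)) : 0 ≤ excess μ y j := by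
  refine setIntegral_nonneg measurableSet_Ici fun i hi => ?_
  have : (j : ℝ) ≤ i := by exact_mod_cast hi
  linarith

theorem tendsto_excess_atBot (hint : Integrable (fun j : ℤ => (j : ℝ)) μ)
    (hcent : ∫ j : ℤ, (j : ℝ) ∂μ = 0) (y : ℝ) : Tendsto (excess μ y) atBot (𝓝 (-y)) := by
  have h : Tendsto (fun j : ℤ => ∫ i, (Ici j).indicator (fun i : ℤ => (i : ℝ) - y) i ∂μ) atBot
      (𝓝 (∫ i : ℤ, ((i : ℝ) - y) ∂μ)) := by
    refine tendsto_integral_filter_of_dominated_convergence (fun i : ℤ => ‖(i : ℝ) - y‖)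
      (Eventually.of_forall fun j => (measurable_of_countable _).aestronglyMeasurable)
      (Eventually.of_forall fun j => Eventually.of_forall fun i => norm_indicator_le_norm_self _ _)
      (integrable_sub_const hint y).norm (Eventually.of_forall fun i => ?_)
    refine tendsto_const_nhds.congr' ?_
    filter_upwards [eventually_le_atBot i] with j hj
    rw [indicator_of_mem (by simpa using hj)]
  rw [integral_sub hint (integrable_const y), hcent] at h
  simp only [integral_indicator measurableSet_Ici, integral_const, probReal_univ, one_smul,
    zero_sub] at h
  exact h

theorem excess_zero_nonneg (hint : Integrable (fun j : ℤ => (j : ℝ)) μ)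
    (hcent : ∫ j : ℤ, (j : ℝ) ∂μ = 0) (j : ℤ) : 0 ≤ excess μ 0 j := by
  rcases le_total 0 j with h | h
  · exact excess_nonneg_of_le (by exact_mod_cast h)
  · have := tendsto_excess_atBot hint hcent 0
    rw [neg_zero] at this
    refine le_of_tendsto this ?_
    filter_upwards [eventually_le_atBot j] with i hi
    have h' : (j : ℝ) ≤ 0 := by exact_mod_cast h
    exact excess_mono hint hi (by linarith)

/-- The residual masses: `residual μ n j` turns out to be the probability that the embedded walk
reaches `n` and is stopped at `j`. Below `n` it is the increment over `j` of the positive part of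
the excess over `n`, divided by `n - j`; this is `0` below `b(n)` and `μ {j}` above `b(n)`. -/
noncomputable def residual (μ : Measure ℤ) (n : ℕ) (j : ℤ) : ℝ :=
  if j < n then (max 0 (excess μ n (j + 1)) - max 0 (excess μ n j)) / (n - j) else μ.real {j}

theorem residual_of_le {n : ℕ} {j : ℤ} (h : (n : ℤ) ≤ j) : residual μ n j = μ.real {j} :=
  if_neg (not_lt.2 h)

theorem intCast_sub_pos {n : ℕ} {j : ℤ} (h : j < n) : 0 < (n : ℝ) - j := by
  have : (j : ℝ) < n := by exact_mod_cast h
  linarith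

theorem residual_of_excess_nonpos (hint : Integrable (fun j : ℤ => (j : ℝ)) μ) {n : ℕ} {j : ℤ}
    (h : j < n) (h0 : excess μ n (j + 1) ≤ 0) : residual μ n j = 0 := by
  have h1 : excess μ n j ≤ 0 := (excess_le_add_one hint (by exact_mod_cast h.le)).trans h0
  rw [residual, if_pos h, max_eq_left h0, max_eq_left h1]; simp

theorem residual_of_excess_nonneg (hint : Integrable (fun j : ℤ => (j : ℝ)) μ) {n : ℕ} {j : ℤ}
    (h : j < n) (h0 : 0 ≤ excess μ n j) : residual μ n j = μ.real {j} := by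
  have h1 := h0.trans (excess_le_add_one hint (j := j) (by exact_mod_cast h.le))
  rw [residual, if_pos h, max_eq_right h0, max_eq_right h1,
    div_eq_iff (intCast_sub_pos h).ne', excess_eq_add hint (n : ℝ) j]
  ring

theorem residual_of_crossing {n : ℕ} {j : ℤ} (h : j < n) (h0 : excess μ n j ≤ 0)
    (h1 : 0 ≤ excess μ n (j + 1)) : residual μ n j = excess μ n (j + 1) / (n - j) := by
  rw [residual, if_pos h, max_eq_left h0, max_eq_right h1, sub_zero]

theorem residual_nonneg (hint : Integrable (fun j : ℤ => (j : ℝ)) μ) (n : ℕ) (j : ℤ) :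
    0 ≤ residual μ n j := by
  rw [residual]
  split_ifs with h
  · exact div_nonneg (sub_nonneg.2 (max_le_max le_rfl
      (excess_le_add_one hint (by exact_mod_cast h.le)))) (intCast_sub_pos h).le
  · exact measureReal_nonneg

theorem residual_le (hint : Integrable (fun j : ℤ => (j : ℝ)) μ) (n : ℕ) (j : ℤ) :
    residual μ n j ≤ μ.real {j} := by
  by_cases h : j < n
  · rcases le_total 0 (excess μ n j) with h0 | h0
    · exact (residual_of_excess_nonneg hint h h0).le
    · rw [residual, if_pos h, max_eq_left h0, sub_zero, div_le_iff₀ (intCast_sub_pos h)]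
      refine max_le (mul_nonneg measureReal_nonneg (intCast_sub_pos h).le) ?_
      have := excess_eq_add hint (n : ℝ) j
      linarith
  · exact (residual_of_le (not_lt.1 h)).le

theorem residual_zero (hint : Integrable (fun j : ℤ => (j : ℝ)) μ)
    (hcent : ∫ j : ℤ, (j : ℝ) ∂μ = 0) (j : ℤ) : residual μ 0 j = μ.real {j} := by
  by_cases h : j < (0 : ℕ)
  · exact residual_of_excess_nonneg hint h (by simpa using excess_zero_nonneg hint hcent j)
  · exact residual_of_le (not_lt.1 h)

theorem residual_succ_le (hint : Integrable (fun j : ℤ => (j : ℝ)) μ) (n : ℕ) (j : ℤ) :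
    residual μ (n + 1) j ≤ residual μ n j := by
  by_cases h : j < n
  · have h' : j < (n + 1 : ℕ) := by push_cast; omega
    have hanti := fun i => excess_anti (μ := μ) hint
      (show (n : ℝ) ≤ ((n + 1 : ℕ) : ℝ) by push_cast; linarith) i
    rcases le_total (excess μ n (j + 1)) 0 with h0 | h0
    · rw [residual_of_excess_nonpos hint h h0,
        residual_of_excess_nonpos hint h' ((hanti _).trans h0)]
    · rcases le_total 0 (excess μ n j) with h1 | h1
      · rw [residual_of_excess_nonneg hint h h1]
        exact residual_le hint _ _
      · rw [residual_of_crossing h h1 h0, residual, if_pos h', max_eq_left ((hanti _).trans h1),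
          sub_zero]
        have := intCast_sub_pos h
        gcongr
        · exact max_le h0 (hanti _)
        · linarith
  · rw [residual_of_le (not_lt.1 h)]
    exact residual_le hint _ _

theorem residual_eq_residual_succ_of_lt {n : ℕ} {j : ℤ} (h : (n : ℤ) < j) :
    residual μ (n + 1) j = residual μ n j := by
  rw [residual_of_le h.le, residual_of_le (by push_cast; omega)]

/-- The residual mass has a single transition point `z`, at which the excess changes sign. -/
theorem exists_crossing (hint : Integrable (fun j : ℤ => (j : ℝ)) μ)
    (hcent : ∫ j : ℤ, (j : ℝ) ∂μ = 0) {n : ℕ} (hn : 1 ≤ n) :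
    ∃ z : ℤ, z < n ∧ excess μ n z ≤ 0 ∧ 0 ≤ excess μ n (z + 1) ∧
      ∀ j, z < j → j < n → 0 < excess μ n j := by
  have hne : ∃ j : ℤ, j < n ∧ excess μ n j ≤ 0 := by
    have h := (tendsto_excess_atBot hint hcent (n : ℝ)).eventually
      (gt_mem_nhds (show -(n : ℝ) < 0 by
        have : (1 : ℝ) ≤ n := by exact_mod_cast hn
        linarith))
    obtain ⟨j, hj⟩ := (h.and (eventually_lt_atBot (n : ℤ))).exists
    exact ⟨j, hj.2, hj.1.le⟩
  obtain ⟨z, ⟨hz1, hz2⟩, hmax⟩ := Int.exists_greatest_of_bdd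
    (P := fun j : ℤ => j < n ∧ excess μ n j ≤ 0) ⟨n, fun j hj => hj.1.le⟩ hne
  have key : ∀ j, z < j → j < n → 0 < excess μ n j := fun j hj hjn => by
    by_contra! hc
    exact absurd (hmax j ⟨hjn, hc⟩) (not_le.2 hj)
  refine ⟨z, hz1, hz2, ?_, key⟩
  rcases (show z + 1 ≤ n by omega).lt_or_eq with h | h
  · exact (key _ (by omega) h).le
  · rw [h]; exact excess_nonneg_of_le (by simp)

theorem residual_eq_of_crossing (hint : Integrable (fun j : ℤ => (j : ℝ)) μ) {n : ℕ} {z : ℤ}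
    (hz : z < n) (h0 : excess μ n z ≤ 0) (h1 : 0 ≤ excess μ n (z + 1)) :
    (∀ j < z, residual μ n j = 0) ∧ residual μ n z = excess μ n (z + 1) / (n - z) ∧
      ∀ j > z, residual μ n j = μ.real {j} := by
  refine ⟨fun j hj => ?_, residual_of_crossing hz h0 h1, fun j hj => ?_⟩
  · refine residual_of_excess_nonpos hint (hj.trans hz) ((excess_mono hint hj ?_).trans h0)
    have : (z : ℝ) < n := by exact_mod_cast hz
    linarith
  · rcases lt_or_ge j (n : ℤ) with h | h
    · refine residual_of_excess_nonneg hint h (h1.trans (excess_mono hint hj ?_))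
      have : (j : ℝ) < n := by exact_mod_cast h
      linarith
    · exact residual_of_le h

theorem summable_measureReal_singleton : Summable fun j : ℤ => μ.real {j} := by
  simpa using (hasSum_integral (integrable_const (μ := μ) (1 : ℝ))).summable

theorem hasSum_measureReal_singleton : HasSum (fun j : ℤ => μ.real {j}) 1 := by
  simpa using hasSum_integral (integrable_const (μ := μ) (1 : ℝ))

theorem summable_residual (hint : Integrable (fun j : ℤ => (j : ℝ)) μ) (n : ℕ) :
    Summable (residual μ n) :=
  Summable.of_nonneg_of_le (residual_nonneg hint n) (residual_le hint n)
    summable_measureReal_singleton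

/-- The total residual mass: it turns out to be the probability that the embedded walk reaches
`n`. -/
noncomputable def reach (μ : Measure ℤ) (n : ℕ) : ℝ := ∑' j, residual μ n j

theorem hasSum_residual (hint : Integrable (fun j : ℤ => (j : ℝ)) μ) (n : ℕ) :
    HasSum (residual μ n) (reach μ n) := (summable_residual hint n).hasSum

theorem reach_nonneg (hint : Integrable (fun j : ℤ => (j : ℝ)) μ) (n : ℕ) : 0 ≤ reach μ n :=
  tsum_nonneg (residual_nonneg hint n)

theorem reach_le_one (hint : Integrable (fun j : ℤ => (j : ℝ)) μ) (n : ℕ) : reach μ n ≤ 1 :=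
  hasSum_le (residual_le hint n) (hasSum_residual hint n) hasSum_measureReal_singleton

theorem hasSum_of_crossing {r : ℤ → ℝ} {f : ℤ → ℝ} (hf : Integrable f μ) {z : ℤ}
    (h0 : ∀ j < z, r j = 0) (h1 : ∀ j > z, r j = μ.real {j}) :
    HasSum (fun j => f j * r j) (f z * r z + ∫ i in Ici (z + 1), f i ∂μ) := by
  have := (hasSum_single (f := fun j => if j = z then f j * r j else 0) z
    (fun j hj => if_neg hj)).add (hasSum_setIntegral hf (Ici (z + 1)))
  simp only [if_true] at this
  convert this using 2 with j
  rcases lt_trichotomy j z with h | h | h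
  · rw [h0 j h, if_neg h.ne, indicator_of_notMem (by simp; omega)]; simp
  · subst h; rw [if_pos rfl, indicator_of_notMem (by simp)]; simp
  · rw [h1 j h, if_neg h.ne', indicator_of_mem (by simp; omega)]; simp

/-- The residual measure has barycentre `n`. -/
theorem hasSum_sub_mul_residual (hint : Integrable (fun j : ℤ => (j : ℝ)) μ)
    (hcent : ∫ j : ℤ, (j : ℝ) ∂μ = 0) (n : ℕ) :
    HasSum (fun j : ℤ => ((j : ℝ) - n) * residual μ n j) 0 := by
  rcases Nat.eq_zero_or_pos n with rfl | hn
  · simp only [residual_zero hint hcent]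
    have := hasSum_integral hint
    rw [hcent] at this
    simpa using this
  · obtain ⟨z, hz, h0, h1, -⟩ := exists_crossing hint hcent hn
    obtain ⟨ha, hb, hc⟩ := residual_eq_of_crossing hint hz h0 h1
    have := hasSum_of_crossing (integrable_sub_const hint n) ha hc
    convert this using 1
    rw [hb]
    have := intCast_sub_pos hz
    change 0 = _ + excess μ n (z + 1)
    field_simp
    ring

theorem reach_zero (hint : Integrable (fun j : ℤ => (j : ℝ)) μ)
    (hcent : ∫ j : ℤ, (j : ℝ) ∂μ = 0) : reach μ 0 = 1 := by
  rw [reach]; simp only [residual_zero hint hcent]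
  exact hasSum_measureReal_singleton.tsum_eq

/-- At the transition point `z`, `(n - z) Γ = E (X - z)⁺`. -/
theorem mul_reach_eq (hint : Integrable (fun j : ℤ => (j : ℝ)) μ)
    (hcent : ∫ j : ℤ, (j : ℝ) ∂μ = 0) {n : ℕ} {z : ℤ}
    (h0 : ∀ j < z, residual μ n j = 0) (h1 : ∀ j > z, residual μ n j = μ.real {j}) :
    (n - z) * reach μ n = excess μ z (z + 1) := by
  have h2 := hasSum_of_crossing (integrable_sub_const hint z) h0 h1
  simp only [sub_self, zero_mul, zero_add] at h2
  refine HasSum.unique ?_ h2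
  have h3 := (hasSum_sub_mul_residual hint hcent n).add
    ((hasSum_residual hint n).mul_left (n - z : ℝ))
  rw [zero_add] at h3
  convert h3 using 2 with j
  ring

/-- The unnormalized law of the stopping level in force when the running maximum is `n`: the mass
stopped at `j` while the maximum is `n`, divided by the probability that the walk, started at `n`,
hits `j` before `n + 1`. -/
noncomputable def weight (μ : Measure ℤ) (n : ℕ) (j : ℤ) : ℝ :=
  (n + 1 - j) * (residual μ n j - residual μ (n + 1) j)

theorem weight_nonneg (hint : Integrable (fun j : ℤ => (j : ℝ)) μ) (n : ℕ) (j : ℤ) :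
    0 ≤ weight μ n j := by
  rcases lt_or_ge (n : ℤ) j with h | h
  · rw [weight, residual_eq_residual_succ_of_lt h, sub_self, mul_zero]
  · have : (j : ℝ) ≤ n := by exact_mod_cast h
    exact mul_nonneg (by linarith) (sub_nonneg.2 (residual_succ_le hint n j))

/-- The weights have the same total as the residual masses, by the barycentre property at `n` and at
`n + 1`. -/
theorem hasSum_weight (hint : Integrable (fun j : ℤ => (j : ℝ)) μ)
    (hcent : ∫ j : ℤ, (j : ℝ) ∂μ = 0) (n : ℕ) : HasSum (weight μ n) (reach μ n) := by
  have h := (((hasSum_residual hint n).sub (hasSum_sub_mul_residual hint hcent n))).add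
    (hasSum_sub_mul_residual hint hcent (n + 1))
  rw [sub_zero, add_zero] at h
  refine h.congr_fun fun j => ?_
  rw [weight]; push_cast; ring

end Residual

/-! ### The barycentre, its inverse and the level sets -/

section Barycentre

open Set Filter Topology

variable {μ : Measure ℤ} [IsProbabilityMeasure μ]

theorem intCast_lt_upper_iff (m : ℤ) :
    ((m : ℝ) : EReal) < upper μ ↔ ∃ j, m < j ∧ μ {j} ≠ 0 := by
  rw [upper, lt_sSup_iff]
  constructor
  · rintro ⟨x, ⟨j, hj, rfl⟩, hlt⟩
    exact ⟨j, by exact_mod_cast hlt, hj⟩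
  · rintro ⟨j, hlt, hj⟩
    exact ⟨_, ⟨j, hj, rfl⟩, by exact_mod_cast hlt⟩

theorem natCast_lt_upper_iff (n : ℕ) :
    ((n : ℝ) : EReal) < upper μ ↔ ∃ j, (n : ℤ) < j ∧ μ {j} ≠ 0 := by
  rw [← intCast_lt_upper_iff]; simp

theorem measureReal_singleton_ne_zero {j : ℤ} : μ.real {j} ≠ 0 ↔ μ {j} ≠ 0 := by
  rw [Ne, measureReal_eq_zero_iff]

theorem measureReal_singleton_pos {j : ℤ} : 0 < μ.real {j} ↔ μ {j} ≠ 0 := by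
  rw [← measureReal_singleton_ne_zero, measureReal_nonneg.lt_iff_ne']

theorem measureReal_Ici_pos_iff {j : ℤ} : 0 < μ.real (Ici j) ↔ ∃ i ≥ j, μ {i} ≠ 0 := by
  constructor
  · intro h
    by_contra! hc
    refine h.ne' ?_
    rw [measureReal_eq_zero_iff, ← biUnion_of_singleton (Ici j),
      measure_biUnion_null_iff (to_countable _)]
    exact fun i hi => hc i hi
  · rintro ⟨i, hi, h⟩
    exact (measureReal_singleton_pos.2 h).trans_le
      (measureReal_mono (singleton_subset_iff.2 hi))

theorem excess_pos (hint : Integrable (fun j : ℤ => (j : ℝ)) μ) {y : ℝ} {i j : ℤ}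
    (hyj : y ≤ j) (hji : j ≤ i) (hyi : y < i) (hi : μ {i} ≠ 0) : 0 < excess μ y j := by
  have hs := hasSum_setIntegral (integrable_sub_const hint y) (Ici j)
  have h := le_hasSum hs i fun k _ => indicator_nonneg (fun k (hk : j ≤ k) =>
    mul_nonneg (sub_nonneg.2 (hyj.trans (by exact_mod_cast hk))) measureReal_nonneg) k
  rw [indicator_of_mem (by exact hji)] at h
  exact (mul_pos (sub_pos.2 hyi) (measureReal_singleton_pos.2 hi)).trans_le h

theorem exists_of_excess_pos (hint : Integrable (fun j : ℤ => (j : ℝ)) μ) {y : ℝ} {j : ℤ}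
    (h : 0 < excess μ y j) : ∃ i ≥ j, y < i ∧ μ {i} ≠ 0 := by
  by_contra! hc
  refine h.not_ge (hasSum_le (fun i => ?_)
    (hasSum_setIntegral (integrable_sub_const hint y) (Ici j)) hasSum_zero)
  refine indicator_nonpos (fun i hi => ?_) i
  rcases le_or_gt (i : ℝ) y with h1 | h1
  · exact mul_nonpos_of_nonpos_of_nonneg (by linarith) measureReal_nonneg
  · simp [measureReal_def, hc i hi h1]

theorem barycentre_of_tail_ne_zero {x : ℝ} (h : tail μ x ≠ 0) :
    barycentre μ x = (∫ i in Ici ⌈x⌉, (i : ℝ) ∂μ) / μ.real (Ici ⌈x⌉) := by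
  rw [barycentre, if_neg h, tail_eq, setOf_le_intCast]

theorem barycentre_le_iff (hint : Integrable (fun j : ℤ => (j : ℝ)) μ) {x y : ℝ}
    (h : tail μ x ≠ 0) : barycentre μ x ≤ y ↔ excess μ y ⌈x⌉ ≤ 0 := by
  have hpos : 0 < μ.real (Ici ⌈x⌉) := measureReal_nonneg.lt_of_ne' (by rwa [← tail_eq])
  rw [barycentre_of_tail_ne_zero h, div_le_iff₀ hpos, excess_eq hint, sub_nonpos]

theorem bInv_le (hint : Integrable (fun j : ℤ => (j : ℝ)) μ) {y : ℝ} {j : ℤ}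
    (h : 0 < excess μ y (j + 1)) : bInv μ y ≤ ((j : ℝ) : EReal) := by
  refine sSup_le ?_
  rintro _ ⟨x, hx, rfl⟩
  rw [EReal.coe_le_coe_iff]
  by_contra! hjx
  have hc : j + 1 ≤ ⌈x⌉ := Int.add_one_le_iff.2 (Int.lt_ceil.2 hjx)
  by_cases ht : tail μ x = 0
  · rw [barycentre, if_pos ht] at hx
    obtain ⟨i, hi, hyi, hmi⟩ := exists_of_excess_pos hint h
    rw [tail_eq] at ht
    refine (measureReal_Ici_pos_iff.2 ⟨i, ?_, hmi⟩).ne' ht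
    exact Int.ceil_le.2 (hx.trans hyi.le)
  · rw [barycentre_le_iff hint ht] at hx
    rcases le_or_gt ((⌈x⌉ : ℤ) : ℝ) (y + 1) with h1 | h1
    · exact (h.trans_le (excess_mono hint hc h1)).not_ge hx
    · rw [tail_eq] at ht
      obtain ⟨i, hi, hmi⟩ := measureReal_Ici_pos_iff.1 (measureReal_nonneg.lt_of_ne' ht)
      have : ((⌈x⌉ : ℤ) : ℝ) ≤ i := by exact_mod_cast hi
      exact (excess_pos hint (by linarith) hi (by linarith) hmi).not_ge hx

theorem le_bInv (hint : Integrable (fun j : ℤ => (j : ℝ)) μ) {y : ℝ} {j : ℤ}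
    (ht : tail μ j ≠ 0) (h : excess μ y j ≤ 0) : ((j : ℝ) : EReal) ≤ bInv μ y :=
  le_sSup ⟨j, (barycentre_le_iff hint ht).2 (by rwa [Int.ceil_intCast]), rfl⟩

theorem tail_intCast_pos_iff {j : ℤ} : 0 < tail μ j ↔ ∃ i ≥ j, μ {i} ≠ 0 := by
  rw [tail_intCast, measureReal_Ici_pos_iff]

/-- The inverse barycentre function takes the value `j` at `y` if the excess over `y` changes sign
between `j` and `j + 1`. -/
theorem bInv_eq (hint : Integrable (fun j : ℤ => (j : ℝ)) μ) {y : ℝ} {j : ℤ}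
    (h0 : excess μ y j ≤ 0) (h1 : 0 < excess μ y (j + 1)) : bInv μ y = ((j : ℝ) : EReal) := by
  refine (bInv_le hint h1).antisymm (le_bInv hint ?_ h0)
  obtain ⟨i, hi, -, hm⟩ := exists_of_excess_pos hint h1
  exact (tail_intCast_pos_iff.2 ⟨i, by omega, hm⟩).ne'

/-- The levels at `n` are the atoms of `μ` between the transition points of the residual masses at
`n` and at `n + 1`, both included, that are at most `n`. -/
theorem mem_levelSet_iff (hint : Integrable (fun j : ℤ => (j : ℝ)) μ) {n : ℕ}
    (hn : ((n : ℝ) : EReal) < upper μ) {j : ℤ} :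
    j ∈ levelSet μ n ↔
      j ≤ n ∧ excess μ (n + 1) j ≤ 0 ∧ 0 < excess μ n (j + 1) ∧ μ {j} ≠ 0 := by
  obtain ⟨i, hi, hm⟩ := (natCast_lt_upper_iff n).1 hn
  constructor
  · rintro ⟨hj, y, hy0, hy1, hb⟩
    have h0 : excess μ y j ≤ 0 := by
      by_contra! hc
      have := bInv_le hint (j := j - 1) (by simpa using hc)
      rw [hb, EReal.coe_le_coe_iff] at this
      push_cast at this; linarith
    have h1 : 0 < excess μ y (j + 1) := by
      by_contra! hc
      have := le_bInv hint (j := j + 1) (tail_intCast_pos_iff.2 ⟨i, by omega, hm⟩).ne' hc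
      rw [hb, EReal.coe_le_coe_iff] at this
      push_cast at this; linarith
    refine ⟨hj, (excess_anti hint hy1 j).trans h0, h1.trans_le (excess_anti hint hy0 _), ?_⟩
    intro hz
    rw [excess_eq_add hint, measureReal_def, hz] at h0
    simp at h0
    linarith
  · rintro ⟨hj, h0, h1, h2⟩
    have hpos : 0 < μ.real (Ici j) := measureReal_Ici_pos_iff.2 ⟨i, by omega, hm⟩
    -- the barycentre of `[j, ∞)`
    set b : ℝ := (∫ i in Ici j, (i : ℝ) ∂μ) / μ.real (Ici j) with hb
    have hb0 : excess μ b j = 0 := by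
      rw [excess_eq hint, hb]; field_simp; ring
    have hbn : b ≤ n + 1 := by
      rw [hb, div_le_iff₀ hpos]; rw [excess_eq hint] at h0; linarith
    have hbj : (j : ℝ) < b := by
      by_contra! hc
      have hji : j < i := by omega
      exact (excess_pos hint hc hji.le
        (lt_of_le_of_lt hc (by exact_mod_cast hji)) hm).ne' hb0
    refine ⟨hj, max n b, le_max_left _ _, max_le (by linarith) hbn, bInv_eq hint ?_ ?_⟩
    · exact (excess_anti hint (le_max_right _ _) j).trans hb0.le
    · rcases max_choice (n : ℝ) b with h | h <;> rw [h]
      · exact h1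
      · have := excess_eq_add hint b j
        have := mul_pos (sub_pos.2 hbj) (measureReal_singleton_pos.2 h2)
        linarith

/-- Off the level set the residual mass does not change from `n` to `n + 1`. -/
theorem weight_eq_zero (hint : Integrable (fun j : ℤ => (j : ℝ)) μ) {n : ℕ}
    (hn : ((n : ℝ) : EReal) < upper μ) {j : ℤ} (hj : j ∉ levelSet μ n) : weight μ n j = 0 := by
  suffices residual μ n j = residual μ (n + 1) j by rw [weight, this, sub_self, mul_zero]
  rcases lt_or_ge (n : ℤ) j with h | h
  · exact (residual_eq_residual_succ_of_lt h).symm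
  refine le_antisymm ?_ (residual_succ_le hint n j)
  by_cases hm : μ {j} = 0
  · refine (residual_le hint n j).trans ?_
    rw [measureReal_def, hm]
    exact residual_nonneg hint _ _
  by_cases h0 : excess μ (n + 1) j ≤ 0
  · have h1 : excess μ n (j + 1) ≤ 0 := by
      by_contra! hc
      exact hj ((mem_levelSet_iff hint hn).2 ⟨h, h0, hc, hm⟩)
    obtain ⟨i, hi, hmi⟩ := (natCast_lt_upper_iff n).1 hn
    have hjn : j ≠ n := by
      rintro rfl
      refine h1.not_gt (excess_pos hint (i := i) ?_ hi ?_ hmi)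
      · push_cast; simp
      · exact_mod_cast hi
    rw [residual_of_excess_nonpos hint (lt_of_le_of_ne h hjn) h1]
    exact residual_nonneg hint _ _
  · rw [residual_of_excess_nonneg hint (n := n + 1) (by push_cast; omega)
      (by push_cast; exact (not_le.1 h0).le)]
    exact residual_le hint n j

theorem residual_succ_eq_zero_of_mem (hint : Integrable (fun j : ℤ => (j : ℝ)) μ) {n : ℕ}
    (hn : ((n : ℝ) : EReal) < upper μ) {i j : ℤ} (hj : j ∈ levelSet μ n)
    (hij : i < j) : residual μ (n + 1) i = 0 := by
  obtain ⟨hjn, h0, -⟩ := (mem_levelSet_iff hint hn).1 hj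
  refine residual_of_excess_nonpos hint (by push_cast; omega) ?_
  push_cast
  refine (excess_mono hint (show i + 1 ≤ j by omega) ?_).trans h0
  have : (j : ℝ) ≤ n := by exact_mod_cast hjn
  linarith

theorem residual_eq_of_mem (hint : Integrable (fun j : ℤ => (j : ℝ)) μ) {n : ℕ}
    (hn : ((n : ℝ) : EReal) < upper μ) {i j : ℤ} (hi : i ∈ levelSet μ n) (hj : j ∈ levelSet μ n)
    (hij : i < j) : residual μ n j = μ.real {j} := by
  obtain ⟨hin, -, h0, -⟩ := (mem_levelSet_iff hint hn).1 hi
  rcases hj.1.lt_or_eq with h | h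
  · refine residual_of_excess_nonneg hint h
      (h0.le.trans (excess_mono hint (show i + 1 ≤ j by omega) ?_))
    have : (j : ℝ) ≤ n := by exact_mod_cast h.le
    linarith
  · exact residual_of_le h.ge

theorem excess_pos_of_lt_upper (hint : Integrable (fun j : ℤ => (j : ℝ)) μ) {n : ℕ}
    (hn : ((n : ℝ) : EReal) < upper μ) : 0 < excess μ n n := by
  obtain ⟨i, hi, hm⟩ := (natCast_lt_upper_iff n).1 hn
  exact excess_pos hint (by simp) hi.le (by exact_mod_cast hi) hm

theorem lower_le {j : ℤ} (h : μ {j} ≠ 0) : lower μ ≤ ((j : ℝ) : EReal) :=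
  sInf_le ⟨j, h, rfl⟩

theorem exists_lower (h : lower μ ≠ ⊥) :
    ∃ z : ℤ, μ {z} ≠ 0 ∧ ∀ j, μ {j} ≠ 0 → z ≤ j := by
  have hne : ∃ j, μ {j} ≠ 0 := by
    by_contra! hc
    have h1 := hasSum_measureReal_singleton (μ := μ)
    simp only [measureReal_def, hc, ENNReal.toReal_zero] at h1
    exact zero_ne_one (hasSum_zero.unique h1)
  obtain ⟨j₀, hj₀⟩ := hne
  have hlt : ⊥ < lower μ := bot_lt_iff_ne_bot.2 h
  obtain ⟨r, -, hr⟩ := EReal.lt_iff_exists_real_btwn.1 hlt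
  have hbdd : ∀ j, μ {j} ≠ 0 → ⌊r⌋ ≤ j := fun j hj => by
    have : (r : EReal) < ((j : ℝ) : EReal) := hr.trans_le (lower_le hj)
    rw [EReal.coe_lt_coe_iff] at this
    exact Int.floor_le_iff.2 (by linarith)
  exact Int.exists_least_of_bdd ⟨_, hbdd⟩ ⟨j₀, hj₀⟩

theorem exists_lt_of_lower_eq_bot (h : lower μ = ⊥) (m : ℤ) : ∃ j < m, μ {j} ≠ 0 := by
  have : lower μ < ((m : ℝ) : EReal) := by rw [h]; exact EReal.bot_lt_coe _
  rw [lower, sInf_lt_iff] at this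
  obtain ⟨x, ⟨j, hj, rfl⟩, hlt⟩ := this
  exact ⟨j, by exact_mod_cast hlt, hj⟩

/-- The transition point of the residual mass is the smallest level. -/
theorem exists_lowest (hint : Integrable (fun j : ℤ => (j : ℝ)) μ)
    (hcent : ∫ j : ℤ, (j : ℝ) ∂μ = 0) {n : ℕ} (hn : ((n : ℝ) : EReal) < upper μ)
    (h : ¬ (n = 0 ∧ lower μ = ⊥)) :
    ∃ z : ℤ, z < n ∧ z ∈ levelSet μ n ∧ excess μ n z ≤ 0 ∧ 0 < excess μ n (z + 1) ∧
      ∀ j ∈ levelSet μ n, z ≤ j := by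
  have key : ∃ z : ℤ, z < n ∧ excess μ n z ≤ 0 ∧ 0 < excess μ n (z + 1) := by
    rcases Nat.eq_zero_or_pos n with rfl | hpos
    · obtain ⟨z, hz, hmin⟩ := exists_lower (μ := μ) (by simpa using h)
      have hall : excess μ 0 z = 0 := by
        refine tendsto_nhds_unique (tendsto_const_nhds.congr' ?_)
          (by simpa using tendsto_excess_atBot hint hcent 0)
        filter_upwards [eventually_le_atBot z] with i hi
        induction i, hi using Int.leInductionDown with
        | base => rfl
        | pred i hi ih =>
          have hm : μ {i - 1} = 0 := by
            by_contra hc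
            have := hmin _ hc
            omega
          rw [excess_eq_add hint 0 (i - 1), measureReal_def, hm, sub_add_cancel, ← ih]; simp
      obtain ⟨i, hi, hm⟩ := (natCast_lt_upper_iff 0).1 hn
      have hz0 : z < 0 := by
        by_contra! hc
        refine (excess_pos hint (y := 0) (i := i) (j := z) (by exact_mod_cast hc) (hmin i hm)
          (by exact_mod_cast hi) hm).ne' hall
      refine ⟨z, by simpa using hz0, by simpa using hall.le, ?_⟩
      have h1 := excess_eq_add hint 0 z
      have h2 : (z : ℝ) < 0 := by exact_mod_cast hz0
      have := mul_pos (neg_pos.2 h2) (measureReal_singleton_pos.2 hz)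
      push_cast
      rw [hall] at h1
      linarith
    · obtain ⟨z, hz, h0, h1, h2⟩ := exists_crossing hint hcent hpos
      refine ⟨z, hz, h0, ?_⟩
      rcases (show z + 1 ≤ n by omega).lt_or_eq with h | h
      · exact h2 _ (by omega) h
      · rw [h]; exact excess_pos_of_lt_upper hint hn
  obtain ⟨z, hz, h0, h1⟩ := key
  refine ⟨z, hz, (mem_levelSet_iff hint hn).2 ⟨hz.le, (excess_anti hint (by linarith) z).trans h0,
    h1, ?_⟩, h0, h1, fun j hj => ?_⟩
  · intro hm
    rw [excess_eq_add hint, measureReal_def, hm] at h0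
    simp at h0
    linarith
  · obtain ⟨hjn, -, hj1, -⟩ := (mem_levelSet_iff hint hn).1 hj
    by_contra! hc
    refine hj1.not_ge ((excess_mono hint (show j + 1 ≤ z by omega) ?_).trans h0)
    have : (z : ℝ) < n := by exact_mod_cast hz
    linarith

theorem levelSet_finite (hint : Integrable (fun j : ℤ => (j : ℝ)) μ)
    (hcent : ∫ j : ℤ, (j : ℝ) ∂μ = 0) {n : ℕ} (hn : ((n : ℝ) : EReal) < upper μ)
    (h : ¬ (n = 0 ∧ lower μ = ⊥)) : (levelSet μ n).Finite := by
  obtain ⟨z, -, -, -, -, hz⟩ := exists_lowest hint hcent hn h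
  exact (finite_Icc z n).subset fun j hj => ⟨hz j hj, hj.1⟩

theorem levelSet_infinite (hint : Integrable (fun j : ℤ => (j : ℝ)) μ)
    (hcent : ∫ j : ℤ, (j : ℝ) ∂μ = 0) (hn : (((0 : ℕ) : ℝ) : EReal) < upper μ)
    (h : lower μ = ⊥) : (levelSet μ 0).Infinite := by
  have h1 := (tendsto_excess_atBot hint hcent 1).eventually
      (gt_mem_nhds (show -(1 : ℝ) < 0 by norm_num))
  obtain ⟨J, hJ⟩ := eventually_atBot.1 h1
  refine infinite_of_forall_exists_lt fun m => ?_
  obtain ⟨j, hj, hmj⟩ := exists_lt_of_lower_eq_bot h (min (min m J) 0)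
  obtain ⟨i, hi, hmi⟩ := exists_lt_of_lower_eq_bot h j
  refine ⟨j, (mem_levelSet_iff hint hn).2 ⟨by simp; omega, ?_, ?_, hmj⟩, by omega⟩
  · simpa using (hJ j (by omega)).le
  · have h2 := excess_zero_nonneg hint hcent i
    have h3 := excess_eq_add hint 0 i
    have hi0 : (i : ℝ) < 0 := by exact_mod_cast (show i < 0 by omega)
    have hj0 : (j : ℝ) < 0 := by exact_mod_cast (show j < 0 by omega)
    have h4 := mul_pos (neg_pos.2 hi0) (measureReal_singleton_pos.2 hmi)
    have h5 := excess_mono hint (y := 0) (show i + 1 ≤ j + 1 by omega) (by push_cast; linarith)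
    push_cast
    linarith

theorem reach_pos (hint : Integrable (fun j : ℤ => (j : ℝ)) μ) {n : ℕ}
    (hn : ((n : ℝ) : EReal) < upper μ) : 0 < reach μ n := by
  obtain ⟨i, hi, hm⟩ := (natCast_lt_upper_iff n).1 hn
  refine lt_of_lt_of_le ?_ ((summable_residual hint n).le_tsum i
    fun j _ => residual_nonneg hint n j)
  rw [residual_of_le hi.le]
  exact measureReal_singleton_pos.2 hm

/-- The residual mass at the transition point and the total residual mass, in terms of the
barycentre. -/
theorem crossing_formulas (hint : Integrable (fun j : ℤ => (j : ℝ)) μ)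
    (hcent : ∫ j : ℤ, (j : ℝ) ∂μ = 0) {n : ℕ} {z : ℤ} (hz : z < n)
    (h0 : excess μ n z ≤ 0) (h1 : 0 < excess μ n (z + 1)) :
    tail μ z * ((barycentre μ z - z) / (n - z)) = reach μ n ∧
      μ.real {z} - tail μ z * ((n - barycentre μ z) / (n - z)) = residual μ n z := by
  obtain ⟨ha, hb, hc⟩ := residual_eq_of_crossing hint hz h0 h1.le
  obtain ⟨i, hi, -, hm⟩ := exists_of_excess_pos hint h1
  have ht : tail μ z ≠ 0 := (tail_intCast_pos_iff.2 ⟨i, by omega, hm⟩).ne'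
  have hE : tail μ z * barycentre μ z = ∫ i in Ici z, (i : ℝ) ∂μ := by
    have ht' := ht
    rw [tail_intCast] at ht'
    rw [barycentre_of_tail_ne_zero ht, tail_intCast, Int.ceil_intCast]
    field_simp
  have hnz := intCast_sub_pos hz
  have h2 := mul_reach_eq hint hcent ha hc
  have h3 := excess_eq_add hint z z
  have h4 := excess_eq hint z z
  have h5 := excess_eq_add hint n z
  have h6 := excess_eq hint n z
  rw [← hE, ← tail_intCast] at h4 h6
  constructor
  · rw [← mul_div_assoc, div_eq_iff hnz.ne']
    linarith
  · rw [hb, ← mul_div_assoc, sub_eq_iff_eq_add, ← add_div, eq_div_iff hnz.ne']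
    linarith

theorem excess_nonpos_of_upper_le (hint : Integrable (fun j : ℤ => (j : ℝ)) μ) {y : ℝ}
    (hy : ∀ j : ℤ, μ {j} ≠ 0 → (j : ℝ) ≤ y) (j : ℤ) : excess μ y j ≤ 0 := by
  by_contra! hc
  obtain ⟨i, -, h1, h2⟩ := exists_of_excess_pos hint hc
  exact h1.not_ge (hy i h2)

theorem le_of_upper_le {n : ℕ} (hn : ¬ ((n : ℝ) : EReal) < upper μ) {j : ℤ} (hj : μ {j} ≠ 0) :
    j ≤ n := by
  by_contra! hc
  exact hn ((natCast_lt_upper_iff n).2 ⟨j, hc, hj⟩)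

theorem bInv_of_upper_le (hint : Integrable (fun j : ℤ => (j : ℝ)) μ) {n : ℕ}
    (hn : ¬ ((n : ℝ) : EReal) < upper μ) : bInv μ n = ((n : ℝ) : EReal) := by
  have hall : ∀ j : ℤ, μ {j} ≠ 0 → (j : ℝ) ≤ n := fun j hj => by
    exact_mod_cast le_of_upper_le hn hj
  refine le_antisymm (sSup_le ?_) (le_sSup ⟨n, ?_, rfl⟩)
  · rintro _ ⟨x, hx, rfl⟩
    rw [EReal.coe_le_coe_iff]
    by_contra! hc
    have ht : tail μ x = 0 := by
      by_contra ht
      rw [tail_eq] at ht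
      obtain ⟨i, hi, hmi⟩ := measureReal_Ici_pos_iff.1 (measureReal_nonneg.lt_of_ne' ht)
      have := hall i hmi
      have := Int.ceil_le.1 hi
      linarith
    rw [barycentre, if_pos ht] at hx
    linarith
  · by_cases ht : tail μ n = 0
    · rw [barycentre, if_pos ht]
    · exact (barycentre_le_iff hint ht).2 (excess_nonpos_of_upper_le hint hall _)

/-- At and above the top of the support `b(n) = n`, and the convention `0 / 0 = 1` matters when `n`
is the top of the support. -/
theorem maxBound_eq_reach (hint : Integrable (fun j : ℤ => (j : ℝ)) μ)
    (hcent : ∫ j : ℤ, (j : ℝ) ∂μ = 0) {n : ℕ} (hn : 1 ≤ n) : maxBound μ n = reach μ n := by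
  by_cases hu : ((n : ℝ) : EReal) < upper μ
  · obtain ⟨z, hz, -, h0, h1, -⟩ := exists_lowest hint hcent hu (by omega)
    have hb := bInv_eq hint h0 h1
    rw [maxBound, hb, EReal.toReal_coe, ratio, if_neg fun h => (intCast_sub_pos hz).ne' h.2]
    exact (crossing_formulas hint hcent hz h0 h1).1
  · have hall : ∀ j : ℤ, μ {j} ≠ 0 → (j : ℝ) ≤ n := fun j hj => by
      exact_mod_cast le_of_upper_le hu hj
    have hU := excess_nonpos_of_upper_le hint hall
    have h2 := mul_reach_eq hint hcent (n := n) (z := n - 1)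
      (fun j hj => residual_of_excess_nonpos hint (by omega) (hU _))
      (fun j hj => residual_of_le (by omega))
    have hnn : excess μ n n = 0 := le_antisymm (hU n) (excess_nonneg_of_le (by simp))
    have h3 : reach μ n = tail μ n := by
      have h4 := excess_eq hint (n : ℝ) n
      have h5 := excess_eq hint ((n - 1 : ℤ) : ℝ) n
      rw [sub_add_cancel, h5] at h2
      rw [hnn] at h4
      have := tail_intCast (μ := μ) n
      push_cast at *
      rw [this]
      linarith
    rw [maxBound, bInv_of_upper_le hint hu, EReal.toReal_coe, h3]
    by_cases ht : tail μ n = 0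
    · rw [ht, zero_mul]
    · have hb : barycentre μ n = n := by
        rw [barycentre_of_tail_ne_zero ht]
        rw [tail_eq] at ht
        have h4 := excess_eq hint (n : ℝ) n
        rw [hnn] at h4
        rw [div_eq_iff ht, Int.ceil_natCast]
        linarith
      rw [hb, ratio, if_pos (by simp), mul_one]

end Barycentre

/-! ### The coin biases as ratios of residual masses -/

section Levels

open Set Filter Topology

variable {μ : Measure ℤ} [IsProbabilityMeasure μ]

/-- `k` is the position, counted from `1`, of an element of the level set. -/
def IsPosition (μ : Measure ℤ) (n k : ℕ) : Prop := 1 ≤ k ∧ (k : ℕ∞) ≤ (levelSet μ n).encard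

theorem isCoin_iff {n k : ℕ} :
    IsCoin μ (n, k) ↔ ((n : ℝ) : EReal) < upper μ ∧ IsPosition μ n k := Iff.rfl

theorem IsPosition.of_le {n k i : ℕ} (h : IsPosition μ n k) (hi : 1 ≤ i) (hik : i ≤ k) :
    IsPosition μ n i := ⟨hi, le_trans (by exact_mod_cast hik) h.2⟩

theorem levelSet_eq_image (n : ℕ) :
    levelSet μ n = (fun i : ℕ => (n : ℤ) - i) '' {i : ℕ | (n : ℤ) - i ∈ levelSet μ n} := by
  ext j
  constructor
  · intro hj
    have := hj.1
    exact ⟨((n : ℤ) - j).toNat, by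
      simp only [mem_ofPred_eq]; rw [Int.toNat_of_nonneg (by omega)]; simpa using hj,
      by simp only; rw [Int.toNat_of_nonneg (by omega)]; omega⟩
  · rintro ⟨i, hi, rfl⟩
    exact hi

theorem encard_levelSet (n : ℕ) :
    (levelSet μ n).encard = {i : ℕ | (n : ℤ) - i ∈ levelSet μ n}.encard := by
  conv_lhs => rw [levelSet_eq_image]
  exact Function.Injective.encard_image (fun a b h => by simpa using h) _

theorem IsPosition.lt_card {n k : ℕ} (h : IsPosition μ n k)
    (hf : {i : ℕ | (n : ℤ) - i ∈ levelSet μ n}.Finite) : k - 1 < hf.toFinset.card := by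
  obtain ⟨h1, h2⟩ := h
  rw [encard_levelSet, hf.encard_eq_coe_toFinset_card] at h2
  have : k ≤ hf.toFinset.card := by exact_mod_cast h2
  omega

theorem IsPosition.level_mem {n k : ℕ} (h : IsPosition μ n k) : level μ n k ∈ levelSet μ n :=
  Nat.nth_mem (p := fun i : ℕ => (n : ℤ) - i ∈ levelSet μ n) (k - 1) h.lt_card

theorem IsPosition.level_lt {n i k : ℕ} (h : IsPosition μ n k) (hi : 1 ≤ i) (hik : i < k) :
    level μ n k < level μ n i := by
  have := Nat.nth_lt_nth' (p := fun i : ℕ => (n : ℤ) - i ∈ levelSet μ n)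
    (show i - 1 < k - 1 by omega) h.lt_card
  simp only [level]
  omega

theorem IsPosition.level_le {n i k : ℕ} (h : IsPosition μ n k) (hi : 1 ≤ i) (hik : i ≤ k) :
    level μ n k ≤ level μ n i := by
  rcases hik.lt_or_eq with h' | rfl
  · exact (h.level_lt hi h').le
  · rfl

theorem level_injOn (n : ℕ) : InjOn (level μ n) {k | IsPosition μ n k} := by
  intro i hi k hk h
  rcases lt_trichotomy i k with h' | h' | h'
  · exact absurd h (IsPosition.level_lt hk hi.1 h').ne'
  · exact h'
  · exact absurd h (IsPosition.level_lt hi hk.1 h').ne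

theorem exists_level_eq {n : ℕ} {j : ℤ} (hj : j ∈ levelSet μ n) :
    ∃ k, IsPosition μ n k ∧ level μ n k = j := by
  have hj' := hj
  rw [levelSet_eq_image] at hj'
  obtain ⟨i, hi, rfl⟩ := hj'
  obtain ⟨k, hk, hki⟩ := Nat.exists_lt_card_nth_eq
    (p := fun i : ℕ => (n : ℤ) - i ∈ levelSet μ n) hi
  refine ⟨k + 1, ⟨by omega, ?_⟩, by simp [level, hki]⟩
  rw [encard_levelSet]
  by_cases hf : {i : ℕ | (n : ℤ) - i ∈ levelSet μ n}.Finite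
  · rw [hf.encard_eq_coe_toFinset_card]
    exact_mod_cast hk hf
  · rw [Set.Infinite.encard_eq hf]; exact le_top

theorem numLevels_eq {n : ℕ} (hf : (levelSet μ n).Finite) :
    (numLevels μ n : ℕ∞) = (levelSet μ n).encard :=
  hf.cast_ncard_eq

theorem isPosition_iff {n : ℕ} (hf : (levelSet μ n).Finite) {k : ℕ} :
    IsPosition μ n k ↔ 1 ≤ k ∧ k ≤ numLevels μ n := by
  rw [IsPosition, ← numLevels_eq hf, Nat.cast_le]

/-- The probability of passing the first `k` levels below `n` without stopping. -/
noncomputable def pass (μ : Measure ℤ) (n k : ℕ) : ℝ :=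
  1 - ∑ i ∈ Finset.Ioc 0 k, weight μ n (level μ n i) / reach μ n

theorem pass_zero (n : ℕ) : pass μ n 0 = 1 := by simp [pass]

theorem pass_sub (n : ℕ) {k : ℕ} (hk : 1 ≤ k) :
    pass μ n (k - 1) - pass μ n k = weight μ n (level μ n k) / reach μ n := by
  obtain ⟨k, rfl⟩ : ∃ i, k = i + 1 := ⟨k - 1, by omega⟩
  rw [pass, pass, add_tsub_cancel_right, Finset.sum_Ioc_succ_top (Nat.zero_le k)]
  ring

theorem pass_le (hint : Integrable (fun j : ℤ => (j : ℝ)) μ) (n : ℕ) {k : ℕ} (hk : 1 ≤ k) :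
    pass μ n k ≤ pass μ n (k - 1) := by
  rw [← sub_nonneg, pass_sub n hk]
  exact div_nonneg (weight_nonneg hint _ _) (reach_nonneg hint _)

theorem pass_nonneg (hint : Integrable (fun j : ℤ => (j : ℝ)) μ)
    (hcent : ∫ j : ℤ, (j : ℝ) ∂μ = 0) {n : ℕ} (hn : ((n : ℝ) : EReal) < upper μ) {k : ℕ}
    (hk : k = 0 ∨ IsPosition μ n k) : 0 ≤ pass μ n k := by
  rw [pass, sub_nonneg, ← Finset.sum_div, div_le_one (reach_pos hint hn)]
  have hinj : InjOn (level μ n) (Finset.Ioc 0 k) := (level_injOn n).mono fun i hi => by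
    simp only [Finset.coe_Ioc, mem_Ioc] at hi
    rcases hk with rfl | hk
    · omega
    · exact hk.of_le hi.1 hi.2
  rw [← Finset.sum_image (f := weight μ n) hinj]
  exact sum_le_hasSum _ (fun j _ => weight_nonneg hint n j) (hasSum_weight hint hcent n)

theorem pass_numLevels (hint : Integrable (fun j : ℤ => (j : ℝ)) μ)
    (hcent : ∫ j : ℤ, (j : ℝ) ∂μ = 0) {n : ℕ} (hn : ((n : ℝ) : EReal) < upper μ)
    (hf : (levelSet μ n).Finite) : pass μ n (numLevels μ n) = 0 := by
  rw [pass, sub_eq_zero, ← Finset.sum_div, eq_comm, div_eq_one_iff_eq (reach_pos hint hn).ne']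
  have hinj : InjOn (level μ n) (Finset.Ioc 0 (numLevels μ n)) :=
    (level_injOn n).mono fun i hi => by
      simp only [Finset.coe_Ioc, mem_Ioc] at hi
      exact (isPosition_iff hf).2 hi
  rw [← Finset.sum_image (f := weight μ n) hinj]
  refine (hasSum_sum_of_ne_finset_zero fun j hj => ?_).unique (hasSum_weight hint hcent n)
  refine weight_eq_zero hint hn fun hmem => hj ?_
  obtain ⟨k, hk, rfl⟩ := exists_level_eq hmem
  exact Finset.mem_image_of_mem _ (Finset.mem_Ioc.2 ((isPosition_iff hf).1 hk))

theorem weight_level (hint : Integrable (fun j : ℤ => (j : ℝ)) μ) {n : ℕ}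
    (hn : ((n : ℝ) : EReal) < upper μ) {k : ℕ} (hk : IsPosition μ n k) (h2 : 2 ≤ k) :
    weight μ n (level μ n k) = (n + 1 - level μ n k) * residual μ n (level μ n k) := by
  rw [weight, residual_succ_eq_zero_of_mem hint hn (hk.of_le le_rfl hk.1).level_mem
    (hk.level_lt le_rfl h2), sub_zero]

/-- The numbers `g^n_k` are the probabilities of the levels in the normalized weight. -/
theorem gFin_eq (hint : Integrable (fun j : ℤ => (j : ℝ)) μ)
    (hcent : ∫ j : ℤ, (j : ℝ) ∂μ = 0) {n : ℕ} (hn : ((n : ℝ) : EReal) < upper μ)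
    (h : ¬ (n = 0 ∧ lower μ = ⊥)) {k : ℕ} (hk : IsPosition μ n k) (h2 : 2 ≤ k) :
    gFin μ n k = weight μ n (level μ n k) / reach μ n := by
  have hf := levelSet_finite hint hcent hn h
  have hk' := (isPosition_iff hf).1 hk
  have hM : IsPosition μ n (numLevels μ n) := (isPosition_iff hf).2 ⟨by omega, le_rfl⟩
  obtain ⟨z, hz, hmem, h0, h1, hmin⟩ := exists_lowest hint hcent hn h
  have hzl : lowest μ n = z := by
    obtain ⟨i, hi, rfl⟩ := exists_level_eq hmem
    exact le_antisymm (hM.level_le hi.1 ((isPosition_iff hf).1 hi).2) (hmin _ hM.level_mem)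
  obtain ⟨hG, hr⟩ := crossing_formulas hint hcent hz h0 h1
  rw [weight_level hint hn hk h2, gFin, bigGamma, hzl, hG]
  split_ifs with hkM
  · rw [hr, hkM, ← hzl, lowest]; ring
  · rw [residual_eq_of_mem hint hn hM.level_mem hk.level_mem (hM.level_lt hk.1 (by omega))]
    ring

theorem fFin_eq (hint : Integrable (fun j : ℤ => (j : ℝ)) μ)
    (hcent : ∫ j : ℤ, (j : ℝ) ∂μ = 0) {n : ℕ} (hn : ((n : ℝ) : EReal) < upper μ)
    (h : ¬ (n = 0 ∧ lower μ = ⊥)) {k : ℕ} (hk : k ≤ numLevels μ n) :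
    fFin μ n k = pass μ n k := by
  rcases Nat.eq_zero_or_pos k with rfl | hpos
  · rw [fFin, if_pos rfl, pass_zero]
  have hf := levelSet_finite hint hcent hn h
  have h1 := pass_numLevels hint hcent hn hf
  rw [fFin, if_neg (by omega), pass, ← sub_zero (1 - _), ← h1, pass,
    ← Finset.sum_Ioc_consecutive _ (Nat.zero_le k) hk]
  rw [Finset.sum_congr rfl fun i hi => gFin_eq hint hcent hn h ((isPosition_iff hf).2 ?_) ?_]
  · ring
  all_goals (rw [Finset.mem_Ioc] at hi; omega)

theorem fInf_eq (hint : Integrable (fun j : ℤ => (j : ℝ)) μ)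
    (hcent : ∫ j : ℤ, (j : ℝ) ∂μ = 0) (hn : (((0 : ℕ) : ℝ) : EReal) < upper μ)
    (h : lower μ = ⊥) (k : ℕ) : fInf μ k = pass μ 0 k := by
  rcases Nat.eq_zero_or_pos k with rfl | hpos
  · rw [fInf, if_pos rfl, pass_zero]
  have hinf := levelSet_infinite hint hcent hn h
  have hp : ∀ i, 1 ≤ i → IsPosition μ 0 i := fun i hi => ⟨hi, by rw [hinf.encard_eq]; exact le_top⟩
  have hsum : HasSum (fun i : ℕ => weight μ 0 (level μ 0 (i + 1))) 1 := by
    have := hasSum_weight hint hcent 0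
    rw [reach_zero hint hcent] at this
    have hinj : Function.Injective fun i : ℕ => level μ 0 (i + 1) := by
      intro i j hij
      have := level_injOn 0 (hp (i + 1) (by omega)) (hp (j + 1) (by omega)) hij
      omega
    have hsupp : ∀ j ∉ range fun i : ℕ => level μ 0 (i + 1), weight μ 0 j = 0 := by
      intro j hj
      refine weight_eq_zero hint hn fun hmem => hj ?_
      obtain ⟨i, hi, rfl⟩ := exists_level_eq hmem
      exact ⟨i - 1, by simp only; rw [Nat.sub_add_cancel hi.1]⟩
    exact (hinj.hasSum_iff hsupp).2 this
  have h2 := hsum.summable.sum_add_tsum_nat_add k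
  rw [hsum.tsum_eq] at h2
  rw [fInf, if_neg (by omega), pass, ← h2, reach_zero hint hcent]
  have h3 : ∑ i ∈ Finset.Ioc 0 k, weight μ 0 (level μ 0 i) / 1 =
      ∑ i ∈ Finset.range k, weight μ 0 (level μ 0 (i + 1)) := by
    rw [Finset.range_eq_Ico, Finset.sum_Ico_add' (fun i => weight μ 0 (level μ 0 i)) 0 k 1]
    refine Finset.sum_congr ?_ fun i _ => div_one _
    ext i; simp only [Finset.mem_Ioc, Finset.mem_Ico]; omega
  rw [h3, add_sub_cancel_left]
  refine tsum_congr fun i => ?_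
  rw [weight_level hint hn (hp _ (by omega)) (by omega), residual_zero hint hcent, gInf]
  rw [show k + 1 + i = i + k + 1 by omega]
  push_cast; ring

/-- The bias of the `k`-th coin is the conditional probability that the `k`-th level is chosen,
given that no higher one is. -/
theorem rho_eq (hint : Integrable (fun j : ℤ => (j : ℝ)) μ)
    (hcent : ∫ j : ℤ, (j : ℝ) ∂μ = 0) {n k : ℕ} (hc : IsCoin μ (n, k)) :
    rho μ n k = 1 - pass μ n k / pass μ n (k - 1) := by
  obtain ⟨hn, hk⟩ := isCoin_iff.1 hc
  rw [rho]
  split_ifs with h h'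
  · obtain ⟨rfl, h⟩ := h
    rw [fInf_eq hint hcent hn h, fInf_eq hint hcent hn h]
  · rw [h', pass_numLevels hint hcent hn (levelSet_finite hint hcent hn h), zero_div, sub_zero]
  · have := ((isPosition_iff (levelSet_finite hint hcent hn h)).1 hk).2
    rw [fFin_eq hint hcent hn h this, fFin_eq hint hcent hn h (by omega)]

theorem pass_nonneg_of_isCoin (hint : Integrable (fun j : ℤ => (j : ℝ)) μ)
    (hcent : ∫ j : ℤ, (j : ℝ) ∂μ = 0) {n k : ℕ} (hc : IsCoin μ (n, k)) :
    0 ≤ pass μ n k ∧ pass μ n k ≤ pass μ n (k - 1) :=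
  ⟨pass_nonneg hint hcent hc.1 (Or.inr hc.2), pass_le hint n hc.2.1⟩

theorem rho_mem_Icc (hint : Integrable (fun j : ℤ => (j : ℝ)) μ)
    (hcent : ∫ j : ℤ, (j : ℝ) ∂μ = 0) {n k : ℕ} (hc : IsCoin μ (n, k)) :
    0 ≤ rho μ n k ∧ rho μ n k ≤ 1 := by
  obtain ⟨h0, h1⟩ := pass_nonneg_of_isCoin hint hcent hc
  rw [rho_eq hint hcent hc]
  have h2 := div_le_one_of_le₀ h1 (h0.trans h1)
  have h3 := div_nonneg h0 (h0.trans h1)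
  constructor <;> linarith

theorem pass_mul_one_sub_rho (hint : Integrable (fun j : ℤ => (j : ℝ)) μ)
    (hcent : ∫ j : ℤ, (j : ℝ) ∂μ = 0) {n k : ℕ} (hc : IsCoin μ (n, k)) :
    pass μ n (k - 1) * (1 - rho μ n k) = pass μ n k := by
  obtain ⟨h0, h1⟩ := pass_nonneg_of_isCoin hint hcent hc
  rw [rho_eq hint hcent hc, sub_sub_cancel]
  rcases (h0.trans h1).eq_or_lt with h | h
  · rw [← h, zero_mul]; linarith
  · field_simp

end Levels

/-! ### The Hardy–Littlewood transform -/

section Quantile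

open Set Filter Topology

variable {μ : Measure ℤ} [IsProbabilityMeasure μ]

theorem measureReal_Ici_anti {i j : ℤ} (h : i ≤ j) : μ.real (Ici j) ≤ μ.real (Ici i) :=
  measureReal_mono (Ici_subset_Ici.2 h)

theorem tendsto_measureReal_Ici_atBot : Tendsto (fun j : ℤ => μ.real (Ici j)) atBot (𝓝 1) := by
  have h := (ENNReal.tendsto_toReal (measure_ne_top μ univ)).comp (tendsto_measure_Ici_atBot μ)
  rwa [measure_univ, ENNReal.toReal_one] at h

theorem tendsto_measureReal_Ici_atTop :
    Tendsto (fun j : ℤ => μ.real (Ici (j + 1))) atTop (𝓝 0) := by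
  have h := (ENNReal.tendsto_toReal (measure_ne_top μ univ)).comp (tendsto_measure_Iic_atTop μ)
  rw [measure_univ, ENNReal.toReal_one] at h
  have h2 := h.const_sub 1
  rw [sub_self] at h2
  refine h2.congr fun j => ?_
  have : Ici (j + 1) = (Iic j)ᶜ := by ext i; simp
  rw [this, measureReal_compl measurableSet_Iic, probReal_univ]
  rfl

/-- On `(0, 1)` the tail quantile is the Galois adjoint of the tail; in particular it takes integer
values. -/
theorem exists_tailQuantile_eq {w : ℝ} (hw : w ∈ Ioo (0 : ℝ) 1) :
    ∃ q : ℤ, tailQuantile μ w = q ∧ ∀ j : ℤ, μ.real (Ici (j + 1)) ≤ w ↔ q ≤ j := by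
  obtain ⟨j₁, h₁⟩ := eventually_atBot.1
    ((tendsto_measureReal_Ici_atBot (μ := μ)).eventually (lt_mem_nhds hw.2))
  have h₂ := ((tendsto_measureReal_Ici_atTop (μ := μ)).eventually (gt_mem_nhds hw.1)).exists
  have hb : ∀ j, μ.real (Ici (j + 1)) ≤ w → j₁ ≤ j := fun j hj => by
    by_contra! hc
    exact (h₁ (j + 1) (by omega)).not_ge hj
  obtain ⟨q, hq, hmin⟩ := Int.exists_least_of_bdd (P := fun j => μ.real (Ici (j + 1)) ≤ w)
    ⟨j₁, hb⟩ (h₂.imp fun j hj => hj.le)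
  have hiff : ∀ j : ℤ, μ.real (Ici (j + 1)) ≤ w ↔ q ≤ j := fun j =>
    ⟨hmin j, fun h => (measureReal_Ici_anti (by omega)).trans hq⟩
  refine ⟨q, ?_, hiff⟩
  have hset : {x : ℝ | μ.real {j : ℤ | x < (j : ℝ)} ≤ w} = Ici (q : ℝ) := by
    ext x
    have : {j : ℤ | x < (j : ℝ)} = Ici (⌊x⌋ + 1) := by
      ext j
      simp only [mem_ofPred_eq, mem_Ici, ← Int.floor_lt]
      omega
    rw [mem_ofPred_eq, this, hiff, mem_Ici, Int.le_floor]
  rw [tailQuantile, hset, csInf_Ici]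

theorem tailQuantile_anti {v w : ℝ} (hv : v ∈ Ioo (0 : ℝ) 1) (hw : w ∈ Ioo (0 : ℝ) 1)
    (h : v ≤ w) : tailQuantile μ w ≤ tailQuantile μ v := by
  obtain ⟨a, ha, ha'⟩ := exists_tailQuantile_eq (μ := μ) hv
  obtain ⟨b, hb, hb'⟩ := exists_tailQuantile_eq (μ := μ) hw
  rw [ha, hb]
  exact_mod_cast (hb' a).1 (((ha' a).2 le_rfl).trans h)

open Classical in
/-- The tail quantile as an integer-valued function, cut off outside `(0, 1)`. -/
noncomputable def intQuantile (μ : Measure ℤ) (w : ℝ) : ℤ :=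
  if w ∈ Ioo (0 : ℝ) 1 then ⌊tailQuantile μ w⌋ else 0

theorem intQuantile_cast {w : ℝ} (hw : w ∈ Ioo (0 : ℝ) 1) :
    (intQuantile μ w : ℝ) = tailQuantile μ w := by
  obtain ⟨q, hq, -⟩ := exists_tailQuantile_eq (μ := μ) hw
  rw [intQuantile, if_pos hw, hq, Int.floor_intCast]

theorem intQuantile_le_iff {w : ℝ} (hw : w ∈ Ioo (0 : ℝ) 1) (j : ℤ) :
    intQuantile μ w ≤ j ↔ μ.real (Ici (j + 1)) ≤ w := by
  obtain ⟨q, hq, h⟩ := exists_tailQuantile_eq (μ := μ) hw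
  rw [h, intQuantile, if_pos hw, hq, Int.floor_intCast]

theorem intQuantile_preimage_inter (j : ℤ) :
    intQuantile μ ⁻¹' {j} ∩ Ioo 0 1 = Ioo 0 1 ∩ Ico (μ.real (Ici (j + 1))) (μ.real (Ici j)) := by
  ext w
  rw [inter_comm, mem_inter_iff, mem_inter_iff]
  refine and_congr_right fun hw => ?_
  have h1 := intQuantile_le_iff (μ := μ) hw j
  have h2 := intQuantile_le_iff (μ := μ) hw (j - 1)
  rw [sub_add_cancel] at h2
  rw [mem_preimage, mem_singleton_iff, mem_Ico, ← h1, ← not_le, ← h2]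
  omega

theorem measurable_intQuantile : Measurable (intQuantile μ) := by
  refine measurable_to_countable' fun j => ?_
  rw [← inter_union_compl (intQuantile μ ⁻¹' {j}) (Ioo 0 1), intQuantile_preimage_inter]
  refine (measurableSet_Ioo.inter measurableSet_Ico).union ?_
  have : intQuantile μ ⁻¹' {j} ∩ (Ioo 0 1)ᶜ = (if j = 0 then univ else ∅) ∩ (Ioo 0 1)ᶜ := by
    ext w
    rw [inter_comm, mem_inter_iff, inter_comm, mem_inter_iff]
    refine and_congr_right fun hw => ?_
    rw [mem_preimage, intQuantile, if_neg hw]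
    split_ifs with h
    · simp [h]
    · simpa using fun h' => h h'.symm
  rw [this]
  split_ifs <;> measurability

/-- The tail quantile of a uniform variable has law `μ`. -/
theorem map_intQuantile : (volume.restrict (Ioo (0 : ℝ) 1)).map (intQuantile μ) = μ := by
  refine Measure.ext_of_singleton fun j => ?_
  rw [Measure.map_apply measurable_intQuantile (measurableSet_singleton j),
    Measure.restrict_apply (measurable_intQuantile (measurableSet_singleton j)),
    intQuantile_preimage_inter]
  have h : ENNReal.ofReal (μ.real (Ici j) - μ.real (Ici (j + 1))) = μ {j} := by
    rw [measureReal_Ici_eq j, add_sub_cancel_right, ofReal_measureReal]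
  refine le_antisymm ?_ ?_
  · rw [← h, ← Real.volume_Ico]
    exact measure_mono inter_subset_right
  · rw [← h, ← Real.volume_Ioo]
    refine measure_mono fun w hw => ⟨⟨?_, ?_⟩, hw.1.le, hw.2⟩
    · exact measureReal_nonneg.trans_lt hw.1
    · exact hw.2.trans_le measureReal_le_one

theorem integrableOn_tailQuantile (hint : Integrable (fun j : ℤ => (j : ℝ)) μ) :
    IntegrableOn (tailQuantile μ) (Ioo 0 1) := by
  rw [← map_intQuantile (μ := μ), integrable_map_measure
    (measurable_of_countable _).aestronglyMeasurable measurable_intQuantile.aemeasurable] at hint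
  exact IntegrableOn.congr_fun hint (fun w hw => intQuantile_cast hw) measurableSet_Ioo

theorem intervalIntegrable_tailQuantile_sub (hint : Integrable (fun j : ℤ => (j : ℝ)) μ) (y : ℝ)
    {a b : ℝ} (ha : 0 ≤ a) (ha' : a ≤ 1) (hb : 0 ≤ b) (hb' : b ≤ 1) :
    IntervalIntegrable (fun w => tailQuantile μ w - y) volume a b := by
  refine IntervalIntegrable.sub ?_ intervalIntegrable_const
  have h : IntervalIntegrable (tailQuantile μ) volume 0 1 :=
    (intervalIntegrable_iff_integrableOn_Ioo_of_le zero_le_one).2 (integrableOn_tailQuantile hint)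
  refine h.mono_set ?_
  rw [uIcc_of_le (zero_le_one' ℝ)]
  exact uIcc_subset_Icc ⟨ha, ha'⟩ ⟨hb, hb'⟩

/-- Transport of the excess to `(0, 1)` by the quantile function. -/
theorem integral_tailQuantile_sub (y : ℝ) (j : ℤ) :
    ∫ w in (0 : ℝ)..μ.real (Ici j), (tailQuantile μ w - y) = excess μ y j := by
  rw [intervalIntegral.integral_of_le measureReal_nonneg, integral_Ioc_eq_integral_Ioo, excess]
  conv_rhs => rw [← map_intQuantile (μ := μ)]
  rw [setIntegral_map measurableSet_Ici (measurable_of_countable _).aestronglyMeasurable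
    measurable_intQuantile.aemeasurable, Measure.restrict_restrict
      (measurable_intQuantile measurableSet_Ici)]
  have hset : intQuantile μ ⁻¹' Ici j ∩ Ioo 0 1 = Ioo 0 (μ.real (Ici j)) := by
    ext w
    constructor
    · rintro ⟨h1, h2⟩
      refine ⟨h2.1, ?_⟩
      have := intQuantile_le_iff (μ := μ) h2 (j - 1)
      rw [sub_add_cancel] at this
      rw [← not_le, ← this]
      have : j ≤ intQuantile μ w := h1
      omega
    · rintro ⟨h1, h2⟩
      have hw : w ∈ Ioo (0 : ℝ) 1 := ⟨h1, h2.trans_le measureReal_le_one⟩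
      refine ⟨?_, hw⟩
      have := intQuantile_le_iff (μ := μ) hw (j - 1)
      rw [sub_add_cancel, ← not_iff_not, not_le, not_le] at this
      have := this.2 h2
      change j ≤ intQuantile μ w
      omega
  rw [hset]
  refine setIntegral_congr_fun measurableSet_Ioo fun w hw => ?_
  rw [intQuantile_cast ⟨hw.1, hw.2.trans_le measureReal_le_one⟩]

/-- The average of the tail quantile over `(0, v)` is at least `n` exactly for `v` up to the total
residual mass, where it equals `n`. -/
theorem integral_tailQuantile_sub_nonneg_iff (hint : Integrable (fun j : ℤ => (j : ℝ)) μ)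
    (hcent : ∫ j : ℤ, (j : ℝ) ∂μ = 0) {n : ℕ} (hn : 1 ≤ n) {v : ℝ} (hv : v ∈ Ioo (0 : ℝ) 1) :
    0 ≤ ∫ w in (0 : ℝ)..v, (tailQuantile μ w - n) ↔ v ≤ reach μ n := by
  obtain ⟨z, hz, h0, h1, -⟩ := exists_crossing hint hcent hn
  obtain ⟨ha, hb, hc⟩ := residual_eq_of_crossing hint hz h0 h1
  have hzn := intCast_sub_pos hz
  have hr : reach μ n = residual μ n z + μ.real (Ici (z + 1)) := by
    have := hasSum_of_crossing (f := fun _ => 1) (integrable_const (1 : ℝ)) ha hc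
    simp only [one_mul, integral_const, smul_eq_mul, mul_one, measureReal_restrict_apply_univ]
      at this
    exact (hasSum_residual hint n).unique this
  have hr0 := residual_nonneg hint n z
  have hr1 := reach_le_one hint n
  have hT0 : 0 ≤ μ.real (Ici (z + 1)) := measureReal_nonneg
  have hle : ∀ w ∈ Ioo (0 : ℝ) 1, μ.real (Ici (z + 1)) < w → tailQuantile μ w ≤ z := by
    intro w hw h
    rw [← intQuantile_cast hw]
    exact_mod_cast (intQuantile_le_iff hw z).2 h.le
  have heq : ∀ w ∈ Ioo (μ.real (Ici (z + 1))) (reach μ n), tailQuantile μ w - n = z - n := by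
    intro w hw
    have hw' : w ∈ Ioo (0 : ℝ) 1 := ⟨hT0.trans_lt hw.1, hw.2.trans_le hr1⟩
    have h2 := hle w hw' hw.1
    rw [sub_left_inj]
    refine le_antisymm h2 ?_
    rw [← intQuantile_cast hw']
    have h3 := intQuantile_le_iff (μ := μ) hw' (z - 1)
    rw [sub_add_cancel, measureReal_Ici_eq] at h3
    have h4 := residual_le hint n z
    have h5 : ¬ intQuantile μ w ≤ z - 1 := by rw [h3]; linarith [hw.2]
    exact_mod_cast (show z ≤ intQuantile μ w by omega)
  have hII : ∀ {a b : ℝ}, 0 ≤ a → a ≤ 1 → 0 ≤ b → b ≤ 1 →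
      IntervalIntegrable (fun w => tailQuantile μ w - n) volume a b :=
    fun h1 h2 h3 h4 => intervalIntegrable_tailQuantile_sub hint n h1 h2 h3 h4
  have hzero : ∫ w in (0 : ℝ)..reach μ n, (tailQuantile μ w - n) = 0 := by
    rw [← intervalIntegral.integral_add_adjacent_intervals
      (hII le_rfl zero_le_one hT0 measureReal_le_one)
      (hII hT0 measureReal_le_one (reach_nonneg hint n) hr1), integral_tailQuantile_sub,
      intervalIntegral.integral_of_le (by linarith), integral_Ioc_eq_integral_Ioo,
      setIntegral_congr_fun measurableSet_Ioo heq, ← integral_Ioc_eq_integral_Ioo,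
      ← intervalIntegral.integral_of_le (by linarith), intervalIntegral.integral_const, hr,
      add_sub_cancel_right, hb, smul_eq_mul]
    field_simp
    ring
  have hsplit : ∫ w in (0 : ℝ)..v, (tailQuantile μ w - n) =
      ∫ w in reach μ n..v, (tailQuantile μ w - n) := by
    rw [← intervalIntegral.integral_add_adjacent_intervals
      (hII le_rfl zero_le_one (reach_nonneg hint n) hr1)
      (hII (reach_nonneg hint n) hr1 hv.1.le hv.2.le), hzero, zero_add]
  constructor
  · intro h
    by_contra! hlt
    have : ∫ w in reach μ n..v, (tailQuantile μ w - n) ≤ ∫ w in reach μ n..v, ((z : ℝ) - n) := by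
      refine intervalIntegral.integral_mono_on_of_le_Ioo hlt.le
        (hII (reach_nonneg hint n) hr1 hv.1.le hv.2.le) intervalIntegrable_const fun w hw => ?_
      have := hle w ⟨(reach_nonneg hint n).trans_lt hw.1, hw.2.trans hv.2⟩ (by linarith [hw.1])
      linarith
    rw [intervalIntegral.integral_const, smul_eq_mul] at this
    rw [hsplit] at h
    nlinarith [mul_pos (sub_pos.2 hlt) hzn]
  · intro h
    rcases le_or_gt (n : ℝ) (tailQuantile μ v) with hq | hq
    · have : ∫ w in (0 : ℝ)..v, (0 : ℝ) ≤ ∫ w in (0 : ℝ)..v, (tailQuantile μ w - n) := by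
        refine intervalIntegral.integral_mono_on_of_le_Ioo hv.1.le intervalIntegrable_const
          (hII le_rfl zero_le_one hv.1.le hv.2.le) fun w hw => ?_
        have := tailQuantile_anti (μ := μ) ⟨hw.1, hw.2.trans hv.2⟩ hv hw.2.le
        linarith
      simpa using this
    · have : ∫ w in v..reach μ n, (tailQuantile μ w - n) ≤ ∫ w in v..reach μ n, (0 : ℝ) := by
        refine intervalIntegral.integral_mono_on_of_le_Ioo h
          (hII hv.1.le hv.2.le (reach_nonneg hint n) hr1) intervalIntegrable_const fun w hw => ?_
        have := tailQuantile_anti (μ := μ) hv ⟨hv.1.trans hw.1, hw.2.trans_le hr1⟩ hw.1.le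
        linarith
      rw [hsplit, intervalIntegral.integral_symm]
      simpa using this

theorem hardyLittlewoodTail_eq_reach (hint : Integrable (fun j : ℤ => (j : ℝ)) μ)
    (hcent : ∫ j : ℤ, (j : ℝ) ∂μ = 0) {n : ℕ} (hn : 1 ≤ n) :
    hardyLittlewoodTail μ n = reach μ n := by
  have hset : {v : ℝ | v ∈ Ioo 0 1 ∧ (n : ℝ) ≤ (1 / v) * ∫ w in (0 : ℝ)..v, tailQuantile μ w} =
      {v : ℝ | v ∈ Ioo 0 1 ∧ v ≤ reach μ n} := by
    ext v
    refine and_congr_right fun hv => ?_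
    rw [← integral_tailQuantile_sub_nonneg_iff hint hcent hn hv, intervalIntegral.integral_sub
      (by simpa using intervalIntegrable_tailQuantile_sub hint 0 le_rfl zero_le_one hv.1.le hv.2.le)
      intervalIntegrable_const, intervalIntegral.integral_const, sub_zero, smul_eq_mul, sub_nonneg,
      one_div, inv_mul_eq_div, le_div_iff₀ hv.1, mul_comm]
  rw [hardyLittlewoodTail, hset]
  have hr := reach_nonneg hint n
  have hr1 := reach_le_one hint n
  have hfin : volume {v : ℝ | v ∈ Ioo 0 1 ∧ v ≤ reach μ n} ≠ ⊤ :=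
    ((measure_mono (t := Ioo 0 1) fun v hv => hv.1).trans_lt measure_Ioo_lt_top).ne
  have hsub : Ioo 0 (reach μ n) ⊆ {v : ℝ | v ∈ Ioo 0 1 ∧ v ≤ reach μ n} := fun v hv =>
    ⟨⟨hv.1, hv.2.trans_le hr1⟩, hv.2.le⟩
  refine le_antisymm ?_ ?_
  · calc _ ≤ volume.real (Ioc 0 (reach μ n)) :=
          measureReal_mono (fun v hv => ⟨hv.1.1, hv.2⟩) measure_Ioc_lt_top.ne
      _ = _ := by rw [Real.volume_real_Ioc_of_le hr, sub_zero]
  · calc _ = volume.real (Ioo 0 (reach μ n)) := by rw [Real.volume_real_Ioo_of_le hr, sub_zero]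
      _ ≤ _ := measureReal_mono hsub
        hfin

end Quantile

/-! ### Nearest-neighbour paths and stopped times -/

section Path

open Set Filter Topology

/-- A nearest-neighbour path started at `0`. -/
def UnitPath (s : ℕ → ℤ) : Prop := s 0 = 0 ∧ ∀ t, s (t + 1) = s t + 1 ∨ s (t + 1) = s t - 1

variable {Ω : Type*} {S : ℕ → Ω → ℤ} {ω : Ω}

theorem runMax_le_iff {t : ℕ} {c : ℤ} : runMax S t ω ≤ c ↔ ∀ r ≤ t, S r ω ≤ c := by
  simp only [runMax, Finset.sup'_le_iff, Finset.mem_range]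
  exact forall_congr' fun r => by rw [Nat.lt_succ_iff]

theorem le_runMax (t : ℕ) : S t ω ≤ runMax S t ω := runMax_le_iff.1 le_rfl t le_rfl

theorem runMax_mono {r t : ℕ} (h : r ≤ t) : runMax S r ω ≤ runMax S t ω :=
  runMax_le_iff.2 fun u hu => runMax_le_iff.1 le_rfl u (hu.trans h)

theorem runMax_zero : runMax S 0 ω = S 0 ω := by simp [runMax]

theorem runMax_succ (t : ℕ) : runMax S (t + 1) ω = max (runMax S t ω) (S (t + 1) ω) := by
  refine eq_of_forall_ge_iff fun c => ?_
  rw [max_le_iff, runMax_le_iff, runMax_le_iff]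
  constructor
  · exact fun h => ⟨fun r hr => h r (by omega), h _ le_rfl⟩
  · rintro ⟨h1, h2⟩ r hr
    rcases Nat.le_succ_iff.1 hr with h | rfl
    · exact h1 r h
    · exact h2

theorem UnitPath.runMax_le (h : UnitPath fun t => S t ω) (t : ℕ) : runMax S t ω ≤ t := by
  induction t with
  | zero => rw [runMax_zero]; exact h.1.le
  | succ t ih =>
    rw [runMax_succ]
    have := h.2 t
    have := le_runMax (S := S) (ω := ω) t
    simp only at *
    push_cast
    omega

/-- When the maximum increases, it increases by one and the path is at its maximum. -/
theorem UnitPath.runMax_succ_cases (h : UnitPath fun t => S t ω) (t : ℕ) :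
    runMax S (t + 1) ω = runMax S t ω ∧ S (t + 1) ω ≤ runMax S t ω ∨
      runMax S (t + 1) ω = runMax S t ω + 1 ∧ S (t + 1) ω = runMax S t ω + 1 ∧
        S t ω = runMax S t ω := by
  have h1 := h.2 t
  have h2 := le_runMax (S := S) (ω := ω) t
  have h3 := runMax_succ (S := S) (ω := ω) t
  simp only at h1
  omega

theorem UnitPath.exists_first (h : UnitPath fun t => S t ω) {n : ℕ} {t : ℕ}
    (ht : (n : ℤ) ≤ runMax S t ω) : ∃ u ≤ t, S u ω = n ∧ ∀ r < u, runMax S r ω < n := by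
  classical
  have hex : ∃ u, (n : ℤ) ≤ runMax S u ω := ⟨t, ht⟩
  refine ⟨Nat.find hex, Nat.find_min' hex ht, ?_, fun r hr => not_le.1 (Nat.find_min hex hr)⟩
  have hs := Nat.find_spec hex
  rcases Nat.eq_zero_or_pos (Nat.find hex) with h0 | h0
  · rw [h0] at hs ⊢
    rw [runMax_zero] at hs
    have := h.1
    simp only at this
    omega
  · obtain ⟨u, hu⟩ : ∃ u, Nat.find hex = u + 1 := ⟨Nat.find hex - 1, by omega⟩
    have hlt := Nat.find_min hex (m := u) (by omega)
    rw [hu] at hs ⊢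
    have := h.runMax_succ_cases u
    omega

theorem exists_natCast_eq {σ : WithTop ℕ} (h : σ ≠ ⊤) : ∃ k : ℕ, σ = k := by
  lift σ to ℕ using h
  exact ⟨σ, rfl⟩

theorem natCast_withTop_ne_top (k : ℕ) : (k : WithTop ℕ) ≠ ⊤ := WithTop.coe_ne_top

theorem exists_natCast_eq_of_le {σ : WithTop ℕ} {t : ℕ} (h : σ ≤ t) : ∃ k : ℕ, σ = k ∧ k ≤ t := by
  obtain ⟨k, rfl⟩ := exists_natCast_eq (ne_top_of_le_ne_top (natCast_withTop_ne_top t) h)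
  exact ⟨k, rfl, by exact_mod_cast h⟩

theorem succ_le_of_natCast_lt {σ : WithTop ℕ} {t : ℕ} (h : (t : WithTop ℕ) < σ) :
    ((t + 1 : ℕ) : WithTop ℕ) ≤ σ := by
  by_cases hσ : σ = ⊤
  · rw [hσ]; exact le_top
  · obtain ⟨k, rfl⟩ := exists_natCast_eq hσ
    have : t < k := by exact_mod_cast h
    exact_mod_cast this

/-- The time `t ∧ σ` as a natural number. -/
noncomputable def cutTime (σ : WithTop ℕ) (t : ℕ) : ℕ := (min (t : WithTop ℕ) σ).untopA

theorem cutTime_of_le {σ : WithTop ℕ} {t : ℕ} (h : (t : WithTop ℕ) ≤ σ) : cutTime σ t = t := by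
  rw [cutTime, min_eq_left h]; rfl

theorem cutTime_of_ge {k t : ℕ} (h : k ≤ t) : cutTime (k : WithTop ℕ) t = k := by
  rw [cutTime, min_eq_right (by exact_mod_cast h)]; rfl

theorem cutTime_le (σ : WithTop ℕ) (t : ℕ) : cutTime σ t ≤ t := by
  rcases le_total (t : WithTop ℕ) σ with h | h
  · rw [cutTime_of_le h]
  · obtain ⟨k, rfl, hk⟩ := exists_natCast_eq_of_le h
    rwa [cutTime_of_ge hk]

theorem cutTime_succ_of_lt {σ : WithTop ℕ} {t : ℕ} (h : (t : WithTop ℕ) < σ) :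
    cutTime σ (t + 1) = t + 1 :=
  cutTime_of_le (succ_le_of_natCast_lt h)

theorem cutTime_succ_of_not_lt {σ : WithTop ℕ} {t : ℕ} (h : ¬ (t : WithTop ℕ) < σ) :
    cutTime σ (t + 1) = cutTime σ t := by
  obtain ⟨k, rfl, hk⟩ := exists_natCast_eq_of_le (not_lt.1 h)
  rw [cutTime_of_ge hk, cutTime_of_ge (by omega)]

theorem coe_cutTime_le (σ : WithTop ℕ) (t : ℕ) : (cutTime σ t : WithTop ℕ) ≤ σ := by
  rcases le_total (t : WithTop ℕ) σ with h | h
  · rwa [cutTime_of_le h]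
  · obtain ⟨k, rfl, hk⟩ := exists_natCast_eq_of_le h
    rw [cutTime_of_ge hk]

theorem stoppedProcess_eq_cutTime {β : Type*} (u : ℕ → Ω → β) (τ : Ω → WithTop ℕ) (t : ℕ) (ω : Ω) :
    stoppedProcess u τ t ω = u (cutTime (τ ω) t) ω := rfl

theorem stoppedValue_of_eq {β : Type*} {u : ℕ → Ω → β} {τ : Ω → WithTop ℕ} {k : ℕ}
    (h : τ ω = k) : stoppedValue u τ ω = u k ω := by
  rw [stoppedValue, h]; rfl

end Path

/-! ### Gains of predictable bets on the walk -/

section Walk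

open Set Filter Topology

variable {Ω : Type*} {mΩ : MeasurableSpace Ω} {P : Measure Ω} [IsProbabilityMeasure P]
  {S : ℕ → Ω → ℤ} {𝔽 : Filtration ℕ mΩ}

theorem IsSimpleRandomWalk.ae_unitPath (h : IsSimpleRandomWalk S 𝔽 P) :
    ∀ᵐ ω ∂P, UnitPath fun t => S t ω := by
  have key : ∀ t, ∀ᵐ ω ∂P, S (t + 1) ω = S t ω + 1 ∨ S (t + 1) ω = S t ω - 1 := by
    intro t
    have hm : Measurable fun ω => S (t + 1) ω - S t ω :=
      (h.measurable (t + 1)).sub (h.measurable t)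
    have h1 : MeasurableSet {ω | S (t + 1) ω - S t ω = 1} := hm (measurableSet_singleton 1)
    have h2 : MeasurableSet {ω | S (t + 1) ω - S t ω = -1} := hm (measurableSet_singleton (-1))
    have hu : P ({ω | S (t + 1) ω - S t ω = 1} ∪ {ω | S (t + 1) ω - S t ω = -1}) = 1 := by
      rw [measure_union _ h2, h.up, h.down, ENNReal.add_halves]
      exact disjoint_left.2 fun ω (h : _ = _) (h' : _ = _) => by omega
    filter_upwards [(mem_ae_iff_prob_eq_one (h1.union h2)).2 hu] with ω hω
    rcases hω with h' | h'
    · left; have : S (t + 1) ω - S t ω = 1 := h'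
      omega
    · right; have : S (t + 1) ω - S t ω = -1 := h'
      omega
  filter_upwards [ae_all_iff.2 key] with ω hω
  exact ⟨h.zero ω, hω⟩

/-- The step of the walk, as a real number. -/
def step (S : ℕ → Ω → ℤ) (t : ℕ) (ω : Ω) : ℝ := ((S (t + 1) ω - S t ω : ℤ) : ℝ)

theorem IsSimpleRandomWalk.measurable_step (h : IsSimpleRandomWalk S 𝔽 P) (t : ℕ) :
    Measurable (step S t) :=
  (measurable_of_countable (fun j : ℤ => (j : ℝ))).comp
    ((h.measurable (t + 1)).sub (h.measurable t))

theorem UnitPath.step_eq {ω : Ω} (h : UnitPath fun t => S t ω) (t : ℕ) :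
    step S t ω = 1 ∨ step S t ω = -1 := by
  rcases h.2 t with h | h
  · left; simp only [step]; simp only at h; rw [h]; simp
  · right; simp only [step]; simp only at h; rw [h]; simp

theorem IsSimpleRandomWalk.ae_abs_step (h : IsSimpleRandomWalk S 𝔽 P) (t : ℕ) :
    ∀ᵐ ω ∂P, |step S t ω| ≤ 1 := by
  filter_upwards [h.ae_unitPath] with ω hω
  rcases hω.step_eq t with h | h <;> simp [h]

theorem IsSimpleRandomWalk.integral_step (h : IsSimpleRandomWalk S 𝔽 P) (t : ℕ) :
    ∫ ω, step S t ω ∂P = 0 := by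
  have hm : Measurable fun ω => S (t + 1) ω - S t ω :=
      (h.measurable (t + 1)).sub (h.measurable t)
  have h1 : MeasurableSet {ω | S (t + 1) ω - S t ω = 1} := hm (measurableSet_singleton 1)
  have h2 : MeasurableSet {ω | S (t + 1) ω - S t ω = -1} := hm (measurableSet_singleton (-1))
  have heq : step S t =ᵐ[P] fun ω => {ω | S (t + 1) ω - S t ω = 1}.indicator (fun _ => (1 : ℝ)) ω -
      {ω | S (t + 1) ω - S t ω = -1}.indicator (fun _ => (1 : ℝ)) ω := by
    filter_upwards [h.ae_unitPath] with ω hω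
    have := hω.2 t
    simp only at this
    rcases this with h' | h'
    · simp [step, indicator, h']
    · simp [step, indicator, h']
  rw [integral_congr_ae heq, integral_sub ((integrable_const _).indicator h1)
    ((integrable_const _).indicator h2), integral_indicator_const _ h1,
    integral_indicator_const _ h2, measureReal_def, measureReal_def, h.up, h.down, sub_self]

theorem IsSimpleRandomWalk.integral_mul_step (h : IsSimpleRandomWalk S 𝔽 P) (t : ℕ) {f : Ω → ℝ}
    (hf : Measurable[𝔽 t] f) : ∫ ω, f ω * step S t ω ∂P = 0 := by
  have hi : IndepFun f (step S t) P := by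
    rw [IndepFun_iff_Indep]
    refine indep_of_indep_of_le (h.indep t).symm hf.comap_le ?_
    rw [show step S t = (fun j : ℤ => (j : ℝ)) ∘ fun ω => S (t + 1) ω - S t ω from rfl,
      ← MeasurableSpace.comap_comp]
    exact MeasurableSpace.comap_mono le_top
  rw [hi.integral_fun_mul_eq_mul_integral (hf.mono (𝔽.le t) le_rfl).aestronglyMeasurable
    (h.measurable_step t).aestronglyMeasurable, h.integral_step, mul_zero]

/-- The gain at time `t` from betting one unit on each step `s` with `ω ∈ C s`. -/
noncomputable def gain (S : ℕ → Ω → ℤ) (C : ℕ → Set Ω) (t : ℕ) (ω : Ω) : ℝ :=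
  ∑ s ∈ Finset.range t, (C s).indicator (step S s) ω

theorem gain_succ (C : ℕ → Set Ω) (t : ℕ) (ω : Ω) :
    gain S C (t + 1) ω = gain S C t ω + (C t).indicator (step S t) ω :=
  Finset.sum_range_succ _ _

variable {C : ℕ → Set Ω}

theorem IsSimpleRandomWalk.measurable_gain (h : IsSimpleRandomWalk S 𝔽 P)
    (hC : ∀ t, MeasurableSet[𝔽 t] (C t)) (t : ℕ) : Measurable[𝔽 t] (gain S C t) := by
  refine Finset.measurable_fun_sum _ fun s hs => ?_
  have hst : s + 1 ≤ t := Finset.mem_range.1 hs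
  have h1 : Measurable[𝔽 t] (step S s) :=
    (measurable_of_countable (fun j : ℤ => (j : ℝ))).comp
      (((h.adapted (s + 1)).mono (𝔽.mono hst) le_rfl).sub
        ((h.adapted s).mono (𝔽.mono (by omega)) le_rfl))
  exact h1.indicator (𝔽.mono (by omega) _ (hC s))

theorem IsSimpleRandomWalk.ae_abs_gain_le (h : IsSimpleRandomWalk S 𝔽 P) (t : ℕ) :
    ∀ᵐ ω ∂P, |gain S C t ω| ≤ t := by
  filter_upwards [h.ae_unitPath] with ω hω
  refine (Finset.abs_sum_le_sum_abs _ _).trans ((Finset.sum_le_card_nsmul _ _ 1 fun s _ => ?_).trans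
    (by simp))
  by_cases hs : ω ∈ C s
  · rw [indicator_of_mem hs]
    rcases hω.step_eq s with h | h <;> simp [h]
  · simp [indicator_of_notMem hs]

theorem IsSimpleRandomWalk.integrable_gain (h : IsSimpleRandomWalk S 𝔽 P)
    (hC : ∀ t, MeasurableSet[𝔽 t] (C t)) (t : ℕ) : Integrable (gain S C t) P :=
  Integrable.of_bound ((h.measurable_gain hC t).mono (𝔽.le t) le_rfl).aestronglyMeasurable t
    (h.ae_abs_gain_le t)

theorem IsSimpleRandomWalk.integrable_step (h : IsSimpleRandomWalk S 𝔽 P) (t : ℕ) :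
    Integrable (step S t) P :=
  Integrable.of_bound (h.measurable_step t).aestronglyMeasurable 1 (h.ae_abs_step t)

theorem IsSimpleRandomWalk.integral_indicator_step (h : IsSimpleRandomWalk S 𝔽 P)
    (hC : ∀ t, MeasurableSet[𝔽 t] (C t)) (t : ℕ) :
    ∫ ω, (C t).indicator (step S t) ω ∂P = 0 := by
  rw [← h.integral_mul_step t (f := (C t).indicator fun _ => 1)
    ((measurable_const (a := (1 : ℝ))).indicator (hC t))]
  refine integral_congr_ae (Eventually.of_forall fun ω => ?_)
  by_cases hω : ω ∈ C t <;> simp [hω]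

theorem IsSimpleRandomWalk.integral_gain (h : IsSimpleRandomWalk S 𝔽 P)
    (hC : ∀ t, MeasurableSet[𝔽 t] (C t)) (t : ℕ) : ∫ ω, gain S C t ω ∂P = 0 := by
  simp only [gain]
  rw [integral_finsetSum _ fun s _ => (h.integrable_step s).indicator (𝔽.le s _ (hC s))]
  exact Finset.sum_eq_zero fun s _ => h.integral_indicator_step hC s

/-- The increments of the gain are orthogonal. -/
theorem IsSimpleRandomWalk.integral_gain_sq (h : IsSimpleRandomWalk S 𝔽 P)
    (hC : ∀ t, MeasurableSet[𝔽 t] (C t)) (t : ℕ) :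
    ∫ ω, gain S C t ω ^ 2 ∂P = ∑ s ∈ Finset.range t, P.real (C s) := by
  induction t with
  | zero => simp [gain]
  | succ t ih =>
    have hCt : MeasurableSet (C t) := 𝔽.le t _ (hC t)
    have hg := (h.measurable_gain hC t).mono (𝔽.le t) le_rfl
    rw [Finset.sum_range_succ, ← ih]
    have heq : (fun ω => gain S C (t + 1) ω ^ 2) =ᵐ[P] fun ω => (gain S C t ω ^ 2 +
        2 * (((C t).indicator (gain S C t) ω) * step S t ω)) +
          (C t).indicator (fun _ => (1 : ℝ)) ω := by
      filter_upwards [h.ae_unitPath] with ω hω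
      rw [gain_succ]
      by_cases hm : ω ∈ C t
      · simp only [indicator_of_mem hm]
        rcases hω.step_eq t with h | h <;> rw [h] <;> ring
      · simp [indicator_of_notMem hm]
    have hi1 : Integrable (fun ω => gain S C t ω ^ 2) P := by
      refine Integrable.of_bound (hg.pow_const 2).aestronglyMeasurable ((t : ℝ) ^ 2) ?_
      filter_upwards [h.ae_abs_gain_le (C := C) t] with ω hω
      rw [Real.norm_eq_abs, abs_pow]
      gcongr
    have hi2 : Integrable (fun ω => ((C t).indicator (gain S C t) ω) * step S t ω) P := by
      refine Integrable.mul_bdd (c := 1) ((h.integrable_gain hC t).indicator hCt)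
        (h.measurable_step t).aestronglyMeasurable (h.ae_abs_step t)
    have hi3 : Integrable (fun ω => gain S C t ω ^ 2 +
        2 * (((C t).indicator (gain S C t) ω) * step S t ω)) P := hi1.add (hi2.const_mul 2)
    rw [integral_congr_ae heq, integral_add hi3
      ((integrable_const _).indicator hCt), integral_add hi1 (hi2.const_mul 2),
      integral_const_mul, h.integral_mul_step t ((h.measurable_gain hC t).indicator (hC t)),
      integral_indicator_const _ hCt]
    simp

/-- A bounded gain stops betting almost surely. -/
theorem IsSimpleRandomWalk.ae_eventually_notMem_of_bounded (h : IsSimpleRandomWalk S 𝔽 P)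
    (hC : ∀ t, MeasurableSet[𝔽 t] (C t)) {K : ℝ} (hK : ∀ t, ∀ᵐ ω ∂P, |gain S C t ω| ≤ K) :
    ∀ᵐ ω ∂P, ∀ᶠ t in atTop, ω ∉ C t := by
  have hsum : Summable fun s => P.real (C s) := by
    refine summable_of_sum_range_le (c := K ^ 2) (fun _ => measureReal_nonneg) fun t => ?_
    rw [← h.integral_gain_sq hC t]
    calc ∫ ω, gain S C t ω ^ 2 ∂P ≤ ∫ ω, K ^ 2 ∂P := by
          refine integral_mono_of_nonneg (Eventually.of_forall fun ω => sq_nonneg _)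
            (integrable_const _) ?_
          filter_upwards [hK t] with ω hω
          exact sq_le_sq' (by linarith [neg_abs_le (gain S C t ω)]) ((le_abs_self _).trans hω)
      _ = K ^ 2 := by simp
  refine ae_eventually_notMem ?_
  have := hsum.tsum_ofReal_ne_top
  simpa [ofReal_measureReal] using this

theorem IsSimpleRandomWalk.integral_limit_gain (h : IsSimpleRandomWalk S 𝔽 P)
    (hC : ∀ t, MeasurableSet[𝔽 t] (C t)) {K : ℝ} (hK : ∀ t, ∀ᵐ ω ∂P, |gain S C t ω| ≤ K)
    {L : Ω → ℝ} (hL : ∀ᵐ ω ∂P, Tendsto (fun t => gain S C t ω) atTop (𝓝 (L ω))) :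
    ∫ ω, L ω ∂P = 0 := by
  have := tendsto_integral_of_dominated_convergence (fun _ => K)
    (fun t => (h.integrable_gain hC t).aestronglyMeasurable) (integrable_const K) hK hL
  simp only [h.integral_gain hC] at this
  exact tendsto_nhds_unique this tendsto_const_nhds

/-- A functional of the path, stopped at `σ`, is a gain if, before `σ`, its increments are the steps
taken while `ω ∈ C t`. -/
theorem eq_add_gain {ω : Ω} {σ : WithTop ℕ} {g : ℕ → ℝ}
    (hg : ∀ t : ℕ, (t : WithTop ℕ) < σ → g (t + 1) - g t = (C t).indicator (step S t) ω)
    (hC : ∀ t : ℕ, ¬ (t : WithTop ℕ) < σ → ω ∉ C t) (t : ℕ) :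
    g (cutTime σ t) = g 0 + gain S C t ω := by
  induction t with
  | zero =>
    have := cutTime_le σ 0
    simp [gain, show cutTime σ 0 = 0 by omega]
  | succ t ih =>
    rw [gain_succ, ← add_assoc, ← ih]
    by_cases ht : (t : WithTop ℕ) < σ
    · rw [cutTime_succ_of_lt ht, cutTime_of_le ht.le, ← hg t ht]; ring
    · rw [cutTime_succ_of_not_lt ht, indicator_of_notMem (hC t ht), add_zero]

theorem step_eq_sub (t : ℕ) (ω : Ω) : step S t ω = (S (t + 1) ω : ℝ) - S t ω := by
  simp [step]

end Walk

/-! ### Independence and countable families of events -/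

section Independence

open Set

variable {Ω : Type*} {mΩ : MeasurableSpace Ω} {P : Measure Ω} [IsProbabilityMeasure P]

/-- If `m₂` and `m₃` are independent and `m₁` is independent of both together, then `m₁` and `m₂`
together are independent of `m₃`. -/
theorem indep_sup_of_indep_sup {m₁ m₂ m₃ : MeasurableSpace Ω} (h₁ : m₁ ≤ mΩ) (h₂ : m₂ ≤ mΩ)
    (h₃ : m₃ ≤ mΩ) (h : Indep m₁ (m₂ ⊔ m₃) P) (h' : Indep m₂ m₃ P) : Indep (m₁ ⊔ m₂) m₃ P := by
  refine IndepSets.indep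
    (p1 := image2 (· ∩ ·) {s | MeasurableSet[m₁] s} {s | MeasurableSet[m₂] s})
    (p2 := {s | MeasurableSet[m₃] s}) (sup_le h₁ h₂) h₃ ?_ m₃.isPiSystem_measurableSet ?_
    (@MeasurableSpace.generateFrom_measurableSet _ m₃).symm ?_
  · rintro _ ⟨a, ha, b, hb, rfl⟩ _ ⟨c, hc, d, hd, rfl⟩ -
    exact ⟨a ∩ c, MeasurableSet.inter ha hc, b ∩ d, MeasurableSet.inter hb hd,
      inter_inter_inter_comm _ _ _ _⟩
  · refine le_antisymm (sup_le ?_ ?_) (MeasurableSpace.generateFrom_le ?_)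
    · exact fun s hs => MeasurableSpace.measurableSet_generateFrom
        ⟨s, hs, univ, MeasurableSet.univ, inter_univ s⟩
    · exact fun s hs => MeasurableSpace.measurableSet_generateFrom
        ⟨univ, MeasurableSet.univ, s, hs, univ_inter s⟩
    · rintro _ ⟨a, ha, b, hb, rfl⟩
      exact MeasurableSet.inter ((le_sup_left : m₁ ≤ m₁ ⊔ m₂) a ha)
        ((le_sup_right : m₂ ≤ m₁ ⊔ m₂) b hb)
  · rw [IndepSets_iff]
    rintro _ c ⟨a, ha, b, hb, rfl⟩ hc
    rw [Indep_iff] at h h'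
    have hb' : MeasurableSet[m₂ ⊔ m₃] b := (le_sup_left : m₂ ≤ m₂ ⊔ m₃) b hb
    have hc' : MeasurableSet[m₂ ⊔ m₃] c := (le_sup_right : m₃ ≤ m₂ ⊔ m₃) c hc
    simp only
    rw [inter_assoc, h a (b ∩ c) ha (MeasurableSet.inter hb' hc'), h' b c hb hc, h a b ha hb',
      mul_assoc]

theorem hasSum_measureReal_iUnion {ι : Type*} [Countable ι] {E : ι → Set Ω}
    (hE : ∀ i, MeasurableSet (E i)) (hd : Pairwise (Function.onFun Disjoint E)) :
    HasSum (fun i => P.real (E i)) (P.real (⋃ i, E i)) := by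
  simp only [measureReal_def]
  rw [measure_iUnion hd hE, ENNReal.tsum_toReal_eq fun i => measure_ne_top _ _]
  refine ENNReal.hasSum_toReal ?_
  rw [← measure_iUnion hd hE]
  exact measure_ne_top _ _

theorem ae_exists_of_hasSum_one {ι : Type*} [Countable ι] {E : ι → Set Ω}
    (hE : ∀ i, MeasurableSet (E i)) (hd : Pairwise (Function.onFun Disjoint E))
    (hs : HasSum (fun i => P.real (E i)) 1) : ∀ᵐ ω ∂P, ∃ i, ω ∈ E i := by
  have h := (hasSum_measureReal_iUnion hE hd).unique hs
  have h1 : P (⋃ i, E i) = 1 := by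
    rw [← ofReal_measureReal (s := ⋃ i, E i), h, ENNReal.ofReal_one]
  filter_upwards [(mem_ae_iff_prob_eq_one (MeasurableSet.iUnion hE)).2 h1] with ω hω
  exact mem_iUnion.1 hω

end Independence

/-! ### The stopping rule along a path -/

section Coins

open Set

instance (μ : Measure ℤ) : Countable (CoinIndex μ) :=
  inferInstanceAs (Countable {p : ℕ × ℕ // IsCoin μ p})

variable {μ : Measure ℤ} {Ω : Type*} {S : ℕ → Ω → ℤ} {η : CoinIndex μ → Ω → Fin 2}

theorem coinAt_of_isCoin {n k : ℕ} (h : IsCoin μ (n, k)) (ω : Ω) :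
    coinAt η k n ω = η ⟨(n, k), h⟩ ω := dif_pos h

theorem coinAt_of_not_isCoin {n k : ℕ} (h : ¬ IsCoin μ (n, k)) (ω : Ω) :
    coinAt η k n ω = 1 := dif_neg h

theorem isCoin_of_coinAt_eq_zero {n k : ℕ} {ω : Ω} (h : coinAt η k n ω = 0) : IsCoin μ (n, k) := by
  by_contra hc
  rw [coinAt_of_not_isCoin hc] at h
  exact absurd h (by decide)

/-- The walk is in the stopping region at time `u`. -/
def Stops (S : ℕ → Ω → ℤ) (η : CoinIndex μ → Ω → Fin 2) (u : ℕ) (ω : Ω) : Prop :=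
  (∃ n k : ℕ, (n : ℤ) = runMax S u ω ∧ S u ω ≤ level μ n k ∧ coinAt η k n ω = 0) ∨
    ((S u ω : ℝ) : EReal) = upper μ

theorem natCast_le_firstTime_iff {A : Set ℕ} {t : ℕ} :
    (t : WithTop ℕ) ≤ firstTime A ↔ ∀ u ∈ A, t ≤ u := by
  change ((t : ℕ∞) ≤ sInf ((fun t : ℕ => (t : ℕ∞)) '' A)) ↔ _
  rw [le_sInf_iff]
  simp

theorem natCast_le_tauAY_iff {t : ℕ} {ω : Ω} :
    (t : WithTop ℕ) ≤ tauAY S η ω ↔ ∀ u < t, ¬ Stops S η u ω := by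
  rw [tauAY, le_min_iff, natCast_le_firstTime_iff, natCast_le_firstTime_iff]
  constructor
  · rintro ⟨h1, h2⟩ u hu (⟨n, k, hn, hl, hc⟩ | h)
    · exact hu.not_ge (h1 u ⟨⟨(n, k), isCoin_of_coinAt_eq_zero hc⟩, hn, hl,
        (coinAt_of_isCoin _ ω).symm.trans hc⟩)
    · exact hu.not_ge (h2 u h)
  · intro h
    refine ⟨fun u => ?_, fun u hu => ?_⟩
    · rintro ⟨⟨⟨n, k⟩, hi⟩, hn, hl, hc⟩
      by_contra! hut
      exact h u hut (Or.inl ⟨n, k, hn, hl, (coinAt_of_isCoin hi ω).trans hc⟩)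
    · by_contra! hut
      exact h u hut (Or.inr hu)

theorem natCast_lt_iff_succ_le {σ : WithTop ℕ} {t : ℕ} :
    (t : WithTop ℕ) < σ ↔ ((t + 1 : ℕ) : WithTop ℕ) ≤ σ :=
  ⟨succ_le_of_natCast_lt, fun h => lt_of_lt_of_le (by exact_mod_cast Nat.lt_succ_self t) h⟩

theorem natCast_lt_tauAY_iff {t : ℕ} {ω : Ω} :
    (t : WithTop ℕ) < tauAY S η ω ↔ ∀ u ≤ t, ¬ Stops S η u ω := by
  rw [natCast_lt_iff_succ_le, natCast_le_tauAY_iff]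
  simp only [Nat.lt_succ_iff]

theorem stops_of_tauAY_eq {t : ℕ} {ω : Ω} (h : tauAY S η ω = t) : Stops S η t ω := by
  have h1 : ¬ (t : WithTop ℕ) < tauAY S η ω := by rw [h]; exact lt_irrefl _
  have h2 := natCast_le_tauAY_iff.1 h.ge
  rw [natCast_lt_tauAY_iff] at h1
  push Not at h1
  obtain ⟨u, hu, hs⟩ := h1
  rcases hu.lt_or_eq with h3 | rfl
  · exact absurd hs (h2 u h3)
  · exact hs

/-- The walk reaches `n` before being stopped, or when it is stopped. -/
def Reached (S : ℕ → Ω → ℤ) (η : CoinIndex μ → Ω → Fin 2) (n : ℕ) : Set Ω :=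
  {ω | ∃ t, S t ω = n ∧ ∀ u < t, runMax S u ω < n ∧ ¬ Stops S η u ω}

theorem mem_reached_iff {n : ℕ} {ω : Ω} (h : UnitPath fun t => S t ω) :
    ω ∈ Reached S η n ↔ ∃ t : ℕ, (t : WithTop ℕ) ≤ tauAY S η ω ∧ (n : ℤ) ≤ runMax S t ω := by
  constructor
  · rintro ⟨t, ht, hu⟩
    exact ⟨t, natCast_le_tauAY_iff.2 fun u hut => (hu u hut).2, ht ▸ le_runMax t⟩
  · rintro ⟨t, ht, hn⟩
    obtain ⟨u, hu, hun, hlt⟩ := h.exists_first hn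
    exact ⟨u, hun, fun r hr => ⟨hlt r hr, natCast_le_tauAY_iff.1 ht r (by omega)⟩⟩

theorem reached_succ_subset {n : ℕ} {ω : Ω} (h : UnitPath fun t => S t ω)
    (hω : ω ∈ Reached S η (n + 1)) : ω ∈ Reached S η n := by
  rw [mem_reached_iff h] at hω ⊢
  obtain ⟨t, ht, hn⟩ := hω
  exact ⟨t, ht, by push_cast at hn; omega⟩

/-- The walk is stopped at `j`. -/
def StoppedAt (S : ℕ → Ω → ℤ) (η : CoinIndex μ → Ω → Fin 2) (j : ℤ) : Set Ω :=
  {ω | ∃ t : ℕ, tauAY S η ω = t ∧ S t ω = j}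

/-- The `k`-th level is the highest one below the running maximum `n` whose coin shows `0`. -/
def ChosenLevel (η : CoinIndex μ → Ω → Fin 2) (n k : ℕ) : Set Ω :=
  {ω | coinAt η k n ω = 0 ∧ ∀ i < k, coinAt η i n ω ≠ 0}

theorem chosenLevel_disjoint (n : ℕ) :
    Pairwise (Function.onFun Disjoint (ChosenLevel η n)) := by
  intro i k hik
  refine Set.disjoint_left.2 fun ω h1 h2 => ?_
  rcases hik.lt_or_gt with h | h
  · exact h2.2 i h h1.1
  · exact h1.2 k h h2.1

theorem stoppedAt_disjoint : Pairwise (Function.onFun Disjoint (StoppedAt S η)) := by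
  intro i k hik
  refine Set.disjoint_left.2 ?_
  rintro ω ⟨t, ht, h1⟩ ⟨s, hs, h2⟩
  have : t = s := by rw [ht] at hs; exact_mod_cast hs
  subst this
  exact hik (h1.symm.trans h2)

theorem measurable_runMax_of {m : MeasurableSpace Ω} {t : ℕ}
    (h : ∀ r ≤ t, Measurable[m] (S r)) : Measurable[m] (runMax S t) := by
  induction t with
  | zero =>
    rw [show runMax S 0 = S 0 from funext fun ω => runMax_zero]
    exact h 0 le_rfl
  | succ t ih =>
    rw [show runMax S (t + 1) = fun ω => max (runMax S t ω) (S (t + 1) ω) from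
      funext fun ω => runMax_succ t]
    exact (ih fun r hr => h r (by omega)).max (h _ le_rfl)

theorem measurable_shownCoin_of {m : MeasurableSpace Ω} {u : ℕ}
    (hS : ∀ r ≤ u, Measurable[m] (S r)) (hη : ∀ i, Measurable[m] (η i)) (k : ℕ) :
    Measurable[m] (shownCoin S η u k) := by
  have h1 : Measurable[m] fun ω => (runMax S u ω).toNat :=
    (measurable_of_countable Int.toNat).comp (measurable_runMax_of hS)
  have h2 := (measurable_coinAt_prod hη k).comp (h1.prodMk measurable_id)
  exact h2

theorem shownCoin_eq {u n k : ℕ} {ω : Ω} (h : (n : ℤ) = runMax S u ω) :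
    shownCoin S η u k ω = coinAt η k n ω := by
  rw [shownCoin, ← h, Int.toNat_natCast]

theorem measurableSet_stops_of {m : MeasurableSpace Ω} {u : ℕ}
    (hS : ∀ r ≤ u, Measurable[m] (S r)) (hη : ∀ k, Measurable[m] (shownCoin S η u k)) :
    MeasurableSet[m] {ω | Stops S η u ω} := by
  have heq : {ω | Stops S η u ω} =
      (⋃ n : ℕ, ⋃ k : ℕ, runMax S u ⁻¹' {(n : ℤ)} ∩ (S u ⁻¹' Iic (level μ n k) ∩
        shownCoin S η u k ⁻¹' {0})) ∪ S u ⁻¹' {j | ((j : ℝ) : EReal) = upper μ} := by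
    ext ω
    simp only [Stops, mem_ofPred_eq, mem_union, mem_iUnion, mem_inter_iff, mem_preimage,
      mem_singleton_iff, mem_Iic]
    refine or_congr (exists_congr fun n => exists_congr fun k => ?_) Iff.rfl
    rw [eq_comm (a := (n : ℤ))]
    refine and_congr_right fun h => ?_
    rw [shownCoin_eq h.symm]
  rw [heq]
  refine MeasurableSet.union (MeasurableSet.iUnion fun n => MeasurableSet.iUnion fun k => ?_) ?_
  · exact (measurable_runMax_of hS (measurableSet_singleton _)).inter
      ((hS u le_rfl measurableSet_Iic).inter (hη k (measurableSet_singleton _)))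
  · exact hS u le_rfl (to_countable _).measurableSet

theorem measurableSet_reached_of {m : MeasurableSpace Ω} {n : ℕ} (hS : ∀ r, Measurable[m] (S r))
    (hη : ∀ i : CoinIndex μ, i.1.1 < n → Measurable[m] (η i)) :
    MeasurableSet[m] (Reached S η n) := by
  have hcoin : ∀ k l : ℕ, l < n → Measurable[m] (coinAt η k l) := by
    intro k l hl
    by_cases hc : IsCoin μ (l, k)
    · rw [show coinAt η k l = η ⟨(l, k), hc⟩ from funext fun ω => coinAt_of_isCoin hc ω]
      exact hη _ hl
    · rw [show coinAt η k l = fun _ => 1 from funext fun ω => coinAt_of_not_isCoin hc ω]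
      exact measurable_const
  have heq : Reached S η n = ⋃ t : ℕ, S t ⁻¹' {(n : ℤ)} ∩ ⋂ u : ℕ, ⋂ _ : u < t,
      runMax S u ⁻¹' Iio (n : ℤ) ∩ ((⋃ l : ℕ, ⋃ _ : l < n, ⋃ k : ℕ, runMax S u ⁻¹' {(l : ℤ)} ∩
        (S u ⁻¹' Iic (level μ l k) ∩ coinAt η k l ⁻¹' {0})) ∪
          S u ⁻¹' {j | ((j : ℝ) : EReal) = upper μ})ᶜ := by
    ext ω
    simp only [Reached, mem_ofPred_eq, mem_iUnion, mem_iInter, mem_inter_iff, mem_preimage,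
      mem_singleton_iff, mem_Iio, mem_compl_iff]
    refine exists_congr fun t => and_congr_right fun _ => forall_congr' fun u =>
      forall_congr' fun _ => and_congr_right fun hlt => not_congr ?_
    simp only [Stops, mem_union, mem_iUnion, mem_inter_iff, mem_preimage, mem_ofPred_eq,
      mem_singleton_iff, mem_Iic]
    refine or_congr (exists_congr fun l => ?_) Iff.rfl
    constructor
    · rintro ⟨k, h1, h2⟩
      exact ⟨by omega, k, h1.symm, h2⟩
    · rintro ⟨-, k, h1, h2⟩
      exact ⟨k, h1.symm, h2⟩
  rw [heq]
  refine MeasurableSet.iUnion fun t => (hS t (measurableSet_singleton _)).inter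
    (MeasurableSet.iInter fun u => MeasurableSet.iInter fun _ =>
      (measurable_runMax_of (fun r _ => hS r) measurableSet_Iio).inter
      (MeasurableSet.compl (MeasurableSet.union (MeasurableSet.iUnion fun l =>
        MeasurableSet.iUnion fun hl => MeasurableSet.iUnion fun k => ?_) ?_)))
  · exact (measurable_runMax_of (fun r _ => hS r) (measurableSet_singleton _)).inter
      ((hS u measurableSet_Iic).inter (hcoin k l hl (measurableSet_singleton _)))
  · exact hS u (to_countable _).measurableSet

end Coins

/-! ### Filtrations generated by the walk and the coins -/

section Enlargement

open Set

variable {μ : Measure ℤ} {Ω : Type*} {mΩ : MeasurableSpace Ω} {P : Measure Ω}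
  [IsProbabilityMeasure P] {S : ℕ → Ω → ℤ} {η : CoinIndex μ → Ω → Fin 2} {𝔽 : Filtration ℕ mΩ}

theorem IsSimpleRandomWalk.mono {𝔾 : Filtration ℕ mΩ} (h : IsSimpleRandomWalk S 𝔾 P)
    (hle : ∀ t, 𝔽 t ≤ 𝔾 t) (ha : ∀ t, Measurable[𝔽 t] (S t)) : IsSimpleRandomWalk S 𝔽 P where
  adapted := ha
  zero := h.zero
  up := h.up
  down := h.down
  indep t := indep_of_indep_of_le_right (h.indep t) (hle t)

/-- The filtration of the walk, enlarged at time `0` by all the coins. -/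
def enlarged (S : ℕ → Ω → ℤ) (η : CoinIndex μ → Ω → Fin 2) (hS : ∀ t, Measurable (S t))
    (hη : ∀ i, Measurable (η i)) : Filtration ℕ mΩ where
  seq t := MeasurableSpace.comap (fun ω i => η i ω) MeasurableSpace.pi ⊔
    ⨆ u : ℕ, ⨆ _ : u ≤ t, MeasurableSpace.comap (S u) ⊤
  mono' := fun _ _ hst => sup_le le_sup_left (iSup₂_le fun u hu => le_sup_of_le_right
    (le_iSup₂_of_le u (hu.trans hst) le_rfl))
  le' := fun _ => sup_le (measurable_pi_lambda _ hη).comap_le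
    (iSup₂_le fun u _ => (hS u).comap_le)

theorem measurable_walk_enlarged (hS : ∀ t, Measurable (S t)) (hη : ∀ i, Measurable (η i))
    {u t : ℕ} (h : u ≤ t) : Measurable[enlarged S η hS hη t] (S u) :=
  measurable_iff_comap_le.2 (le_sup_of_le_right
    (le_iSup₂_of_le (f := fun u (_ : u ≤ t) => MeasurableSpace.comap (S u) ⊤) u h le_rfl))

theorem measurable_coin_enlarged (hS : ∀ t, Measurable (S t)) (hη : ∀ i, Measurable (η i))
    (i : CoinIndex μ) (t : ℕ) : Measurable[enlarged S η hS hη t] (η i) := by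
  have h : Measurable[MeasurableSpace.comap (fun ω i => η i ω) MeasurableSpace.pi] (η i) :=
    (measurable_pi_apply i).comp (comap_measurable (fun ω i => η i ω))
  exact h.mono le_sup_left le_rfl

/-- The coins are independent of the whole walk, hence knowing them in advance does not disturb the
increments. -/
theorem isSimpleRandomWalk_enlarged (hS : IsSimpleRandomWalk S 𝔽 P) (hη : IsCoinFamily μ η S P) :
    IsSimpleRandomWalk S (enlarged S η hS.measurable hη.measurable) P where
  adapted _ := measurable_walk_enlarged _ _ le_rfl
  zero := hS.zero
  up := hS.up
  down := hS.down
  indep t := by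
    have hle : (⨆ u : ℕ, ⨆ _ : u ≤ t, MeasurableSpace.comap (S u) ⊤) ≤ 𝔽 t :=
      iSup₂_le fun u hu => ((hS.adapted u).mono (𝔽.mono hu) le_rfl).comap_le
    have hd : Measurable fun ω => S (t + 1) ω - S t ω :=
      (hS.measurable (t + 1)).sub (hS.measurable t)
    refine (indep_sup_of_indep_sup (measurable_pi_lambda _ hη.measurable).comap_le
      (hle.trans (𝔽.le t)) hd.comap_le ?_ ?_).symm
    · refine indep_of_indep_of_le_right ((IndepFun_iff_Indep _ _ _).1 hη.indep) (sup_le ?_ ?_)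
      · refine iSup₂_le fun u _ => ?_
        exact ((measurable_pi_apply u).comp (comap_measurable (fun ω t => S t ω))).comap_le
      · exact (((measurable_pi_apply (t + 1)).comp (comap_measurable (fun ω t => S t ω))).sub
          ((measurable_pi_apply t).comp (comap_measurable (fun ω t => S t ω)))).comap_le
    · exact (indep_of_indep_of_le_right (hS.indep t) hle).symm

theorem coinFiltration_le_enlarged (hS : ∀ t, Measurable (S t)) (hη : ∀ i, Measurable (η i))
    (t : ℕ) : coinFiltration S η hS hη t ≤ enlarged S η hS hη t :=
  iSup₂_le fun _ hu => sup_le (measurable_walk_enlarged hS hη hu).comap_le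
    (iSup_le fun k => (measurable_shownCoin_of
      (fun _ hr => measurable_walk_enlarged hS hη (hr.trans hu))
      (fun i => measurable_coin_enlarged hS hη i t) k).comap_le)

theorem measurable_walk_coinFiltration (hS : ∀ t, Measurable (S t)) (hη : ∀ i, Measurable (η i))
    {u t : ℕ} (h : u ≤ t) : Measurable[coinFiltration S η hS hη t] (S u) :=
  measurable_iff_comap_le.2 (le_trans le_sup_left (le_iSup₂_of_le
    (f := fun u (_ : u ≤ t) => MeasurableSpace.comap (S u) ⊤ ⊔
      ⨆ k : ℕ, MeasurableSpace.comap (shownCoin S η u k) ⊤) u h le_rfl))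

theorem measurable_shownCoin_coinFiltration (hS : ∀ t, Measurable (S t))
    (hη : ∀ i, Measurable (η i)) {u t : ℕ} (h : u ≤ t) (k : ℕ) :
    Measurable[coinFiltration S η hS hη t] (shownCoin S η u k) :=
  measurable_iff_comap_le.2 (le_trans (le_sup_of_le_right (le_iSup
    (fun k => MeasurableSpace.comap (shownCoin S η u k) ⊤) k)) (le_iSup₂_of_le
    (f := fun u (_ : u ≤ t) => MeasurableSpace.comap (S u) ⊤ ⊔
      ⨆ k : ℕ, MeasurableSpace.comap (shownCoin S η u k) ⊤) u h le_rfl))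

theorem isSimpleRandomWalk_coinFiltration (hS : IsSimpleRandomWalk S 𝔽 P)
    (hη : IsCoinFamily μ η S P) :
    IsSimpleRandomWalk S (coinFiltration S η hS.measurable hη.measurable) P :=
  (isSimpleRandomWalk_enlarged hS hη).mono (coinFiltration_le_enlarged _ _)
    fun _ => measurable_walk_coinFiltration _ _ le_rfl

theorem isStoppingTime_tauAY (hS : ∀ t, Measurable (S t)) (hη : ∀ i, Measurable (η i)) :
    IsStoppingTime (coinFiltration S η hS hη) (tauAY S η) := by
  intro t
  have heq : {ω | tauAY S η ω ≤ t} = ⋃ u : ℕ, ⋃ _ : u ≤ t, {ω | Stops S η u ω} := by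
    ext ω
    have h : tauAY S η ω ≤ (t : ℕ) ↔ ¬ ((t : WithTop ℕ) < tauAY S η ω) := not_lt.symm
    rw [natCast_lt_tauAY_iff] at h
    push Not at h
    simpa using h
  have hmeas : MeasurableSet[coinFiltration S η hS hη t]
      (⋃ u : ℕ, ⋃ _ : u ≤ t, {ω | Stops S η u ω}) :=
    MeasurableSet.iUnion fun u => MeasurableSet.iUnion fun hu => measurableSet_stops_of
      (fun r hr => measurable_walk_coinFiltration hS hη (hr.trans hu))
      fun k => measurable_shownCoin_coinFiltration hS hη hu k
  rw [← heq] at hmeas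
  exact hmeas

/-- The walk together with some of the coins is independent of the other coins. -/
theorem indep_walk_coins (hS : IsSimpleRandomWalk S 𝔽 P) (hη : IsCoinFamily μ η S P)
    {A B : Set (CoinIndex μ)} (hAB : Disjoint A B) :
    Indep (MeasurableSpace.comap (fun ω t => S t ω) MeasurableSpace.pi ⊔
      ⨆ i ∈ A, MeasurableSpace.comap (η i) ⊤) (⨆ i ∈ B, MeasurableSpace.comap (η i) ⊤) P := by
  have hle : ∀ i, MeasurableSpace.comap (η i) ⊤ ≤ mΩ := fun i => (hη.measurable i).comap_le
  have hle' : ∀ i, MeasurableSpace.comap (η i) ⊤ ≤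
      MeasurableSpace.comap (fun ω i => η i ω) MeasurableSpace.pi := fun i =>
    ((measurable_pi_apply i).comp (comap_measurable (fun ω i => η i ω))).comap_le
  refine indep_sup_of_indep_sup (measurable_pi_lambda _ hS.measurable).comap_le
    (iSup₂_le fun i _ => hle i) (iSup₂_le fun i _ => hle i) ?_
    (indep_iSup_of_disjoint hle hη.iIndep.iIndep hAB)
  exact indep_of_indep_of_le_right ((IndepFun_iff_Indep _ _ _).1 hη.indep).symm
    (sup_le (iSup₂_le fun i _ => hle' i) (iSup₂_le fun i _ => hle' i))

end Enlargement

/-! ### Probabilities of coin patterns -/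

section CoinProbabilities

open Set

variable {μ : Measure ℤ} [IsProbabilityMeasure μ] {Ω : Type*} {mΩ : MeasurableSpace Ω}
  {P : Measure Ω} [IsProbabilityMeasure P] {S : ℕ → Ω → ℤ} {η : CoinIndex μ → Ω → Fin 2}
  {𝔽 : Filtration ℕ mΩ}

theorem measurable_coinAt_of {m : MeasurableSpace Ω} {n k : ℕ}
    (h : ∀ hc : IsCoin μ (n, k), Measurable[m] (η ⟨(n, k), hc⟩)) :
    Measurable[m] (coinAt η k n) := by
  by_cases hc : IsCoin μ (n, k)
  · rw [show coinAt η k n = η ⟨(n, k), hc⟩ from funext fun ω => coinAt_of_isCoin hc ω]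
    exact h hc
  · rw [show coinAt η k n = fun _ => 1 from funext fun ω => coinAt_of_not_isCoin hc ω]
    exact measurable_const

theorem measurable_coin_iSup {B : Set (CoinIndex μ)} {i : CoinIndex μ} (hi : i ∈ B) :
    Measurable[⨆ i ∈ B, MeasurableSpace.comap (η i) ⊤] (η i) :=
  measurable_iff_comap_le.2
    (le_iSup₂_of_le (f := fun i (_ : i ∈ B) => MeasurableSpace.comap (η i) ⊤) i hi le_rfl)

theorem measurableSet_forall_coinAt_of {m : MeasurableSpace Ω} {n k : ℕ}
    (h : ∀ i ≤ k, Measurable[m] (coinAt η i n)) :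
    MeasurableSet[m] {ω | ∀ i ≤ k, coinAt η i n ω ≠ 0} := by
  have heq : {ω | ∀ i ≤ k, coinAt η i n ω ≠ 0} = ⋂ i : ℕ, ⋂ _ : i ≤ k, coinAt η i n ⁻¹' {0}ᶜ := by
    ext ω; simp
  rw [heq]
  exact MeasurableSet.iInter fun i => MeasurableSet.iInter fun hi =>
    h i hi (measurableSet_singleton _).compl

theorem measurableSet_chosenLevel_of {m : MeasurableSpace Ω} {n : ℕ}
    (h : ∀ k, Measurable[m] (coinAt η k n)) (k : ℕ) : MeasurableSet[m] (ChosenLevel η n k) := by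
  have heq : ChosenLevel η n k =
      coinAt η k n ⁻¹' {0} ∩ ⋂ i : ℕ, ⋂ _ : i < k, coinAt η i n ⁻¹' {0}ᶜ := by
    ext ω; simp [ChosenLevel]
  rw [heq]
  exact (h k (measurableSet_singleton _)).inter (MeasurableSet.iInter fun i =>
    MeasurableSet.iInter fun _ => h i (measurableSet_singleton _).compl)

theorem measurableSet_chosenLevel (hη : ∀ i, Measurable (η i)) (n k : ℕ) :
    MeasurableSet (ChosenLevel η n k) :=
  measurableSet_chosenLevel_of (fun _ => measurable_coinAt_of fun _ => hη _) k

/-- The next coin is independent of the previous ones. -/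
theorem measureReal_inter_coinAt (hη : IsCoinFamily μ η S P) {n k : ℕ}
    (hc : IsCoin μ (n, k + 1)) (s : Set (Fin 2)) :
    P.real ({ω | ∀ i ≤ k, coinAt η i n ω ≠ 0} ∩ coinAt η (k + 1) n ⁻¹' s) =
      P.real {ω | ∀ i ≤ k, coinAt η i n ω ≠ 0} * P.real (coinAt η (k + 1) n ⁻¹' s) := by
  have hd : Disjoint {i : CoinIndex μ | i.1.2 ≤ k} {⟨(n, k + 1), hc⟩} :=
    disjoint_singleton_right.2 fun h : k + 1 ≤ k => by omega
  have hi := indep_iSup_of_disjoint (fun i => (hη.measurable i).comap_le) hη.iIndep.iIndep hd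
  rw [Indep_iff] at hi
  have := hi {ω | ∀ i ≤ k, coinAt η i n ω ≠ 0} (coinAt η (k + 1) n ⁻¹' s)
    (measurableSet_forall_coinAt_of fun i hik => measurable_coinAt_of fun _ =>
      measurable_coin_iSup (by exact hik))
    (measurable_coinAt_of (fun _ => measurable_coin_iSup (by rfl))
      (to_countable s).measurableSet)
  simp only [measureReal_def, this, ENNReal.toReal_mul]

theorem measureReal_coinAt_eq_zero (hη : IsCoinFamily μ η S P) {n k : ℕ} (hc : IsCoin μ (n, k)) :
    P.real (coinAt η k n ⁻¹' {0}) = rho μ n k := by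
  rw [← hη.prob_zero ⟨(n, k), hc⟩]
  congr 1
  ext ω
  exact Eq.congr_left (coinAt_of_isCoin hc ω)

theorem measureReal_coinAt_ne_zero (hη : IsCoinFamily μ η S P) {n k : ℕ} (hc : IsCoin μ (n, k)) :
    P.real (coinAt η k n ⁻¹' {0}ᶜ) = 1 - rho μ n k := by
  rw [preimage_compl, measureReal_compl (measurable_coinAt_of (fun _ => hη.measurable _)
    (measurableSet_singleton _)), probReal_univ, measureReal_coinAt_eq_zero hη hc]

theorem measureReal_forall_coinAt (hint : Integrable (fun j : ℤ => (j : ℝ)) μ)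
    (hcent : ∫ j : ℤ, (j : ℝ) ∂μ = 0) (hη : IsCoinFamily μ η S P) {n : ℕ}
    (hn : ((n : ℝ) : EReal) < upper μ) {k : ℕ} (hk : k = 0 ∨ IsPosition μ n k) :
    P.real {ω | ∀ i ≤ k, coinAt η i n ω ≠ 0} = pass μ n k := by
  induction k with
  | zero =>
    have : {ω | ∀ i ≤ 0, coinAt η i n ω ≠ 0} = univ := by
      refine eq_univ_of_forall fun ω i hi h => ?_
      have := (isCoin_of_coinAt_eq_zero h).2.1
      simp only at this
      omega
    rw [this, probReal_univ, pass_zero]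
  | succ k ih =>
    have hc : IsCoin μ (n, k + 1) := ⟨hn, hk.resolve_left (by omega)⟩
    have hk' : k = 0 ∨ IsPosition μ n k := by
      rcases Nat.eq_zero_or_pos k with h | h
      · exact Or.inl h
      · exact Or.inr (IsPosition.of_le hc.2 h (by omega))
    have heq : {ω | ∀ i ≤ k + 1, coinAt η i n ω ≠ 0} =
        {ω | ∀ i ≤ k, coinAt η i n ω ≠ 0} ∩ coinAt η (k + 1) n ⁻¹' {0}ᶜ := by
      ext ω
      constructor
      · exact fun h => ⟨fun i hi => h i (by omega), h _ le_rfl⟩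
      · rintro ⟨h1, h2⟩ i hi
        rcases Nat.le_succ_iff.1 hi with h | rfl
        · exact h1 i h
        · exact h2
    rw [heq, measureReal_inter_coinAt hη hc, ih hk', measureReal_coinAt_ne_zero hη hc]
    exact pass_mul_one_sub_rho hint hcent hc

theorem measureReal_chosenLevel (hint : Integrable (fun j : ℤ => (j : ℝ)) μ)
    (hcent : ∫ j : ℤ, (j : ℝ) ∂μ = 0) (hη : IsCoinFamily μ η S P) {n : ℕ}
    (hn : ((n : ℝ) : EReal) < upper μ) {k : ℕ} (hk : IsPosition μ n k) :
    P.real (ChosenLevel η n k) = weight μ n (level μ n k) / reach μ n := by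
  obtain ⟨k, rfl⟩ : ∃ i, k = i + 1 := ⟨k - 1, by have := hk.1; omega⟩
  have hc : IsCoin μ (n, k + 1) := ⟨hn, hk⟩
  have hk' : k = 0 ∨ IsPosition μ n k := by
    rcases Nat.eq_zero_or_pos k with h | h
    · exact Or.inl h
    · exact Or.inr (IsPosition.of_le hc.2 h (by omega))
  have heq : ChosenLevel η n (k + 1) =
      {ω | ∀ i ≤ k, coinAt η i n ω ≠ 0} ∩ coinAt η (k + 1) n ⁻¹' {0} := by
    ext ω
    constructor
    · exact fun h => ⟨fun i hi => h.2 i (by omega), h.1⟩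
    · exact fun h => ⟨h.2, fun i hi => h.1 i (by omega)⟩
  rw [heq, measureReal_inter_coinAt hη hc, measureReal_forall_coinAt hint hcent hη hn hk',
    measureReal_coinAt_eq_zero hη hc, ← pass_sub n hk.1]
  have := pass_mul_one_sub_rho hint hcent hc
  rw [Nat.add_sub_cancel] at this ⊢
  linarith

/-- Almost surely some coin at `n` shows `0`. -/
theorem ae_exists_chosenLevel (hint : Integrable (fun j : ℤ => (j : ℝ)) μ)
    (hcent : ∫ j : ℤ, (j : ℝ) ∂μ = 0) (hη : IsCoinFamily μ η S P) {n : ℕ}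
    (hn : ((n : ℝ) : EReal) < upper μ) :
    ∀ᵐ ω ∂P, ∃ k, IsPosition μ n k ∧ ω ∈ ChosenLevel η n k := by
  have hs : HasSum (fun k : {k // IsPosition μ n k} => P.real (ChosenLevel η n k)) 1 := by
    have h1 := (hasSum_weight hint hcent n).div_const (reach μ n)
    rw [div_self (reach_pos hint hn).ne'] at h1
    have hinj : Function.Injective fun k : {k // IsPosition μ n k} => level μ n k :=
      fun i k h => Subtype.ext (level_injOn n i.2 k.2 h)
    have hsupp : ∀ j ∉ range fun k : {k // IsPosition μ n k} => level μ n k,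
        weight μ n j / reach μ n = 0 := fun j hj => by
      rw [weight_eq_zero hint hn, zero_div]
      intro hmem
      obtain ⟨k, hk, rfl⟩ := exists_level_eq hmem
      exact hj ⟨⟨k, hk⟩, rfl⟩
    exact ((hinj.hasSum_iff hsupp).2 h1).congr_fun fun k =>
      measureReal_chosenLevel hint hcent hη hn k.2
  filter_upwards [ae_exists_of_hasSum_one
    (fun k : {k // IsPosition μ n k} => measurableSet_chosenLevel hη.measurable n k)
    (fun i k hik => chosenLevel_disjoint n fun h => hik (Subtype.ext h)) hs] with ω ⟨k, hk⟩
  exact ⟨k, k.2, hk⟩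

theorem measurableSet_reached (hS : ∀ t, Measurable (S t)) (hη : ∀ i, Measurable (η i)) (n : ℕ) :
    MeasurableSet (Reached S η n) := measurableSet_reached_of hS fun i _ => hη i

/-- Whether `n` is reached depends on the walk and on the coins below `n` only. -/
theorem measureReal_chosenLevel_inter_reached (hS : IsSimpleRandomWalk S 𝔽 P)
    (hη : IsCoinFamily μ η S P) (n k : ℕ) :
    P.real (ChosenLevel η n k ∩ Reached S η n) =
      P.real (ChosenLevel η n k) * P.real (Reached S η n) := by
  have hd : Disjoint {i : CoinIndex μ | i.1.1 < n} {i : CoinIndex μ | i.1.1 = n} :=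
    disjoint_left.2 fun i (h1 : i.1.1 < n) (h2 : i.1.1 = n) => by omega
  have hi := indep_walk_coins hS hη hd
  rw [Indep_iff] at hi
  have := hi (Reached S η n) (ChosenLevel η n k)
    (measurableSet_reached_of
      (fun r => Measurable.mono ((measurable_pi_apply r).comp
        (comap_measurable (fun ω t => S t ω))) le_sup_left le_rfl)
      fun i hi => Measurable.mono (measurable_coin_iSup (B := {i : CoinIndex μ | i.1.1 < n})
        (by exact hi)) le_sup_right le_rfl)
    (measurableSet_chosenLevel_of
      (fun _ => measurable_coinAt_of fun _ => measurable_coin_iSup (by rfl)) k)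
  rw [inter_comm, mul_comm]
  simp only [measureReal_def, this, ENNReal.toReal_mul]

end CoinProbabilities

/-! ### Excursions below the running maximum -/

section Excursion

open Set Filter Topology

variable {μ : Measure ℤ} [IsProbabilityMeasure μ] {Ω : Type*} {S : ℕ → Ω → ℤ}
  {η : CoinIndex μ → Ω → Fin 2}

/-- The excursion functional of running maximum `m` and position `s`: it starts when the maximum
reaches `n`, follows the walk, and freezes at `1` when the maximum exceeds `n`. -/
noncomputable def excursion (n m s : ℤ) : ℝ := if m < n then 0 else if m = n then s - n else 1

theorem UnitPath.excursion_sub {ω : Ω} (h : UnitPath fun t => S t ω) (n : ℤ) (t : ℕ) :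
    excursion n (runMax S (t + 1) ω) (S (t + 1) ω) - excursion n (runMax S t ω) (S t ω) =
      if runMax S t ω = n then step S t ω else 0 := by
  have h1 := h.runMax_succ_cases t
  rw [step_eq_sub]
  unfold excursion
  rcases lt_trichotomy (runMax S t ω) n with hlt | heq | hgt
  · rw [if_pos hlt, if_neg hlt.ne]
    by_cases hlt' : runMax S (t + 1) ω < n
    · rw [if_pos hlt', sub_zero]
    · have e1 : runMax S (t + 1) ω = n := by omega
      have e2 : S (t + 1) ω = n := by omega
      rw [if_neg hlt', if_pos e1, e2]; simp
  · rw [if_neg heq.not_lt, if_pos heq, if_pos heq]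
    by_cases he : runMax S (t + 1) ω = n
    · rw [if_neg he.not_lt, if_pos he]; ring
    · have e1 : S (t + 1) ω = n + 1 := by omega
      have e2 : S t ω = n := by omega
      rw [if_neg (by omega), if_neg he, e1, e2]; push_cast; ring
  · rw [if_neg hgt.not_gt, if_neg hgt.ne', if_neg (by omega), if_neg (by omega), if_neg hgt.ne',
      sub_self]

theorem tauAY_eq_iff {t : ℕ} {ω : Ω} :
    tauAY S η ω = t ↔ Stops S η t ω ∧ ∀ u < t, ¬ Stops S η u ω := by
  constructor
  · exact fun h => ⟨stops_of_tauAY_eq h, natCast_le_tauAY_iff.1 h.ge⟩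
  · rintro ⟨h1, h2⟩
    refine le_antisymm (not_lt.1 fun h => ?_) (natCast_le_tauAY_iff.2 h2)
    exact natCast_lt_tauAY_iff.1 h t le_rfl h1

theorem level_lt_of_natCast_lt_tauAY {n k t : ℕ} {ω : Ω} (hω : ω ∈ ChosenLevel η n k)
    (ht : (t : WithTop ℕ) < tauAY S η ω) (hn : runMax S t ω = n) : level μ n k < S t ω := by
  by_contra! hc
  exact natCast_lt_tauAY_iff.1 ht t le_rfl (Or.inl ⟨n, k, hn.symm, hc, hω.1⟩)

theorem IsPosition.level_le_self {n k : ℕ} (hk : IsPosition μ n k) : level μ n k ≤ n :=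
  hk.level_mem.1

theorem level_le_of_natCast_le_tauAY {n k t : ℕ} {ω : Ω} (h : UnitPath fun t => S t ω)
    (hk : IsPosition μ n k) (hω : ω ∈ ChosenLevel η n k) (ht : (t : WithTop ℕ) ≤ tauAY S η ω)
    (hn : runMax S t ω = n) : level μ n k ≤ S t ω := by
  have hkn := hk.level_le_self
  rcases Nat.eq_zero_or_pos t with rfl | hpos
  · rw [runMax_zero] at hn
    omega
  · obtain ⟨u, rfl⟩ : ∃ u, t = u + 1 := ⟨t - 1, by omega⟩
    have h1 := h.runMax_succ_cases u
    have h2 := h.2 u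
    by_cases hu : runMax S u ω = n
    · have := level_lt_of_natCast_lt_tauAY hω (natCast_lt_iff_succ_le.2 ht) hu
      simp only at h2
      omega
    · omega

/-- The walk moves by unit steps and starts each excursion at `n`, hence it is stopped exactly at
the chosen level. -/
theorem eq_level_of_tauAY_eq {n k t : ℕ} {ω : Ω} (h : UnitPath fun t => S t ω)
    (hu : ((n : ℝ) : EReal) < upper μ) (hk : IsPosition μ n k) (hω : ω ∈ ChosenLevel η n k)
    (ht : tauAY S η ω = t) (hn : runMax S t ω = n) : S t ω = level μ n k := by
  refine le_antisymm ?_ (level_le_of_natCast_le_tauAY h hk hω ht.ge hn)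
  rcases stops_of_tauAY_eq ht with ⟨n', k', hn', hl, hc⟩ | htop
  · obtain rfl : n' = n := by omega
    have hk' : IsPosition μ n' k' := (isCoin_of_coinAt_eq_zero hc).2
    have hkk : k ≤ k' := by
      by_contra! hlt
      exact hω.2 k' hlt hc
    exact hl.trans (hk'.level_le hk.1 hkk)
  · rw [← htop, EReal.coe_lt_coe_iff] at hu
    have h1 : (n : ℤ) < S t ω := by exact_mod_cast hu
    have := le_runMax (S := S) (ω := ω) t
    omega

/-- The times at which the walk is not stopped and its running maximum is `n`, if the level in force
at `n` is the `k`-th one. -/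
def ActiveAt (S : ℕ → Ω → ℤ) (η : CoinIndex μ → Ω → Fin 2) (n k t : ℕ) : Set Ω :=
  {ω | ω ∈ ChosenLevel η n k ∧ (t : WithTop ℕ) < tauAY S η ω ∧ runMax S t ω = n}

theorem UnitPath.excursion_zero {ω : Ω} (h : UnitPath fun t => S t ω) (n : ℕ) :
    excursion n (runMax S 0 ω) (S 0 ω) = 0 := by
  have h0 : S 0 ω = 0 := h.1
  rw [runMax_zero, h0, excursion]
  rcases Nat.eq_zero_or_pos n with rfl | hn
  · simp
  · rw [if_pos (by exact_mod_cast hn)]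

theorem gain_activeAt_of_mem {n k : ℕ} {ω : Ω} (h : UnitPath fun t => S t ω)
    (hω : ω ∈ ChosenLevel η n k) (t : ℕ) :
    gain S (ActiveAt S η n k) t ω =
      excursion n (runMax S (cutTime (tauAY S η ω) t) ω) (S (cutTime (tauAY S η ω) t) ω) := by
  have := eq_add_gain (S := S) (C := ActiveAt S η n k) (σ := tauAY S η ω) (ω := ω)
    (g := fun t => excursion n (runMax S t ω) (S t ω)) (fun t ht => ?_) (fun t ht hm => ht hm.2.1) t
  · rw [this, h.excursion_zero, zero_add]
  · rw [h.excursion_sub]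
    by_cases hr : runMax S t ω = n
    · rw [if_pos hr, indicator_of_mem (show ω ∈ ActiveAt S η n k t from ⟨hω, ht, hr⟩)]
    · rw [if_neg hr, indicator_of_notMem fun hm => hr hm.2.2]

theorem gain_activeAt_of_notMem {n k : ℕ} {ω : Ω} (hω : ω ∉ ChosenLevel η n k) (t : ℕ) :
    gain S (ActiveAt S η n k) t ω = 0 :=
  Finset.sum_eq_zero fun _ _ => indicator_of_notMem (fun hm => hω hm.1) _

/-- While it is active, the excursion stays between the chosen level and `n + 1`. -/
theorem abs_gain_activeAt_le {n k : ℕ} {ω : Ω} (h : UnitPath fun t => S t ω)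
    (hk : IsPosition μ n k) (t : ℕ) :
    |gain S (ActiveAt S η n k) t ω| ≤ n + 1 - level μ n k := by
  have hkn : (level μ n k : ℝ) ≤ n := by exact_mod_cast hk.level_le_self
  by_cases hω : ω ∈ ChosenLevel η n k
  · rw [gain_activeAt_of_mem h hω, excursion]
    split_ifs with h1 h2
    · rw [abs_zero]; linarith
    · have h3 := level_le_of_natCast_le_tauAY h hk hω (coe_cutTime_le _ t) h2
      have h4 := le_runMax (S := S) (ω := ω) (cutTime (tauAY S η ω) t)
      rw [h2] at h4
      have h3' : (level μ n k : ℝ) ≤ S (cutTime (tauAY S η ω) t) ω := by exact_mod_cast h3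
      have h4' : (S (cutTime (tauAY S η ω) t) ω : ℝ) ≤ n := by exact_mod_cast h4
      rw [abs_le]
      push_cast
      constructor <;> linarith
    · rw [abs_one]; linarith
  · rw [gain_activeAt_of_notMem hω, abs_zero]; linarith

open Classical in
/-- The final value of the excursion functional. -/
theorem tendsto_gain_activeAt {n k : ℕ} {ω : Ω} (h : UnitPath fun t => S t ω)
    (hu : ((n : ℝ) : EReal) < upper μ) (hk : IsPosition μ n k) (hω : ω ∈ ChosenLevel η n k)
    (hev : ∀ᶠ t in atTop, ω ∉ ActiveAt S η n k t) :
    (ω ∈ Reached S η n \ Reached S η (n + 1) → ω ∈ StoppedAt S η (level μ n k)) ∧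
    Tendsto (fun t => gain S (ActiveAt S η n k) t ω) atTop
      (𝓝 (if ω ∈ Reached S η (n + 1) then 1
        else if ω ∈ Reached S η n then (level μ n k : ℝ) - n else 0)) := by
  simp only [gain_activeAt_of_mem h hω]
  by_cases htop : tauAY S η ω = ⊤
  · have hev' : ∀ᶠ t in atTop, runMax S t ω ≠ n := by
      filter_upwards [hev] with t ht hn
      exact ht ⟨hω, by rw [htop]; exact (natCast_withTop_ne_top t).lt_top, hn⟩
    have hcut : ∀ t, cutTime (tauAY S η ω) t = t := fun t =>
      cutTime_of_le (by rw [htop]; exact le_top)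
    simp only [hcut]
    have hr : ∀ n, ω ∈ Reached S η n ↔ ∃ t, (n : ℤ) ≤ runMax S t ω := fun n => by
      rw [mem_reached_iff h, htop]; simp
    have key : ω ∈ Reached S η n → ω ∈ Reached S η (n + 1) := by
      rw [hr, hr]
      rintro ⟨t₀, ht₀⟩
      obtain ⟨t, ht, hge⟩ := (hev'.and (eventually_ge_atTop t₀)).exists
      have := runMax_mono (S := S) (ω := ω) hge
      exact ⟨t, by push_cast; omega⟩
    refine ⟨fun hm => absurd (key hm.1) hm.2, tendsto_const_nhds.congr' ?_⟩
    split_ifs with h1 h2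
    · obtain ⟨t₀, ht₀⟩ := (hr _).1 h1
      filter_upwards [eventually_ge_atTop t₀] with t ht
      have := runMax_mono (S := S) (ω := ω) ht
      push_cast at ht₀
      rw [excursion, if_neg (by omega), if_neg (by omega)]
    · exact absurd (key h2) h1
    · rw [hr] at h2
      push Not at h2
      filter_upwards with t
      rw [excursion, if_pos (h2 t)]
  · obtain ⟨m, hm⟩ := exists_natCast_eq htop
    have hr : ∀ n, ω ∈ Reached S η n ↔ (n : ℤ) ≤ runMax S m ω := fun n => by
      rw [mem_reached_iff h, hm]
      constructor
      · rintro ⟨t, ht, hn⟩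
        exact hn.trans (runMax_mono (by exact_mod_cast ht))
      · exact fun hn => ⟨m, le_rfl, hn⟩
    have key : runMax S m ω = n → S m ω = level μ n k := eq_level_of_tauAY_eq h hu hk hω hm
    refine ⟨fun hmem => ⟨m, hm, key ?_⟩, tendsto_const_nhds.congr' ?_⟩
    · have h1 := (hr _).1 hmem.1
      have h2 := (hr _).not.1 hmem.2
      push_cast at h2
      omega
    · filter_upwards [eventually_ge_atTop m] with t ht
      rw [hm, cutTime_of_ge ht, excursion]
      simp only [hr]
      push_cast
      rcases lt_trichotomy (runMax S m ω) n with h1 | h1 | h1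
      · rw [if_neg (by omega), if_neg (by omega), if_pos h1]
      · rw [if_neg (by omega), if_pos h1.ge, if_neg h1.not_lt, if_pos h1, key h1]
      · rw [if_pos (by omega), if_neg (by omega), if_neg (by omega)]

theorem measurableSet_tauAY_eq {mΩ : MeasurableSpace Ω} (hS : ∀ t, Measurable (S t))
    (hη : ∀ i, Measurable (η i)) (t : ℕ) : MeasurableSet {ω | tauAY S η ω = t} := by
  have hst : ∀ u, MeasurableSet {ω | Stops S η u ω} := fun u =>
    measurableSet_stops_of (fun r _ => hS r) fun k => measurable_shownCoin hS hη u k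
  have heq : {ω | tauAY S η ω = t} =
      {ω | Stops S η t ω} ∩ ⋂ u : ℕ, ⋂ _ : u < t, {ω | Stops S η u ω}ᶜ := by
    ext ω
    rw [mem_ofPred_eq, tauAY_eq_iff]
    simp
  rw [heq]
  exact (hst t).inter (MeasurableSet.iInter fun u => MeasurableSet.iInter fun _ => (hst u).compl)

theorem measurableSet_stoppedAt {mΩ : MeasurableSpace Ω} (hS : ∀ t, Measurable (S t))
    (hη : ∀ i, Measurable (η i)) (j : ℤ) : MeasurableSet (StoppedAt S η j) := by
  have heq : StoppedAt S η j = ⋃ t : ℕ, {ω | tauAY S η ω = t} ∩ S t ⁻¹' {j} := by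
    ext ω; simp [StoppedAt]
  rw [heq]
  exact MeasurableSet.iUnion fun t =>
    (measurableSet_tauAY_eq hS hη t).inter (hS t (measurableSet_singleton _))

end Excursion

/-! ### The mass carried down by an excursion -/

section Embedding

open Set Filter Topology

variable {μ : Measure ℤ} [IsProbabilityMeasure μ] {Ω : Type*} {mΩ : MeasurableSpace Ω}
  {P : Measure Ω} [IsProbabilityMeasure P] {S : ℕ → Ω → ℤ} {η : CoinIndex μ → Ω → Fin 2}
  {𝔽 : Filtration ℕ mΩ}

theorem measurableSet_natCast_lt_tauAY {m : MeasurableSpace Ω} {t : ℕ}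
    (hS : ∀ r ≤ t, Measurable[m] (S r)) (hη : ∀ i, Measurable[m] (η i)) :
    MeasurableSet[m] {ω | (t : WithTop ℕ) < tauAY S η ω} := by
  have heq : {ω | (t : WithTop ℕ) < tauAY S η ω} =
      ⋂ u : ℕ, ⋂ _ : u ≤ t, {ω | Stops S η u ω}ᶜ := by
    ext ω
    rw [mem_ofPred_eq, natCast_lt_tauAY_iff]
    simp
  rw [heq]
  exact MeasurableSet.iInter fun u => MeasurableSet.iInter fun hu => (measurableSet_stops_of
    (fun r hr => hS r (hr.trans hu))
    fun k => measurable_shownCoin_of (fun r hr => hS r (hr.trans hu)) hη k).compl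

theorem measurableSet_activeAt (hS : ∀ t, Measurable (S t)) (hη : ∀ i, Measurable (η i))
    (n k t : ℕ) : MeasurableSet[enlarged S η hS hη t] (ActiveAt S η n k t) := by
  have hS' : ∀ r ≤ t, Measurable[enlarged S η hS hη t] (S r) := fun r hr =>
    measurable_walk_enlarged hS hη hr
  have hη' : ∀ i, Measurable[enlarged S η hS hη t] (η i) := fun i =>
    measurable_coin_enlarged hS hη i t
  exact MeasurableSet.inter
    (measurableSet_chosenLevel_of (fun _ => measurable_coinAt_of fun _ => hη' _) k)
    (MeasurableSet.inter (measurableSet_natCast_lt_tauAY hS' hη')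
      (measurable_runMax_of hS' (measurableSet_singleton (n : ℤ))))

theorem ae_eventually_notMem_activeAt (hS : IsSimpleRandomWalk S 𝔽 P) (hη : IsCoinFamily μ η S P)
    {n k : ℕ} (hk : IsPosition μ n k) :
    ∀ᵐ ω ∂P, ∀ᶠ t in atTop, ω ∉ ActiveAt S η n k t :=
  (isSimpleRandomWalk_enlarged hS hη).ae_eventually_notMem_of_bounded
    (measurableSet_activeAt hS.measurable hη.measurable n k) (K := n + 1 - level μ n k) fun t => by
      filter_upwards [hS.ae_unitPath] with ω hω
      exact abs_gain_activeAt_le hω hk t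

theorem ae_stoppedAt_level (hS : IsSimpleRandomWalk S 𝔽 P) (hη : IsCoinFamily μ η S P)
    {n k : ℕ} (hu : ((n : ℝ) : EReal) < upper μ) (hk : IsPosition μ n k) :
    ∀ᵐ ω ∂P, ω ∈ ChosenLevel η n k → ω ∈ Reached S η n \ Reached S η (n + 1) →
      ω ∈ StoppedAt S η (level μ n k) := by
  filter_upwards [hS.ae_unitPath, ae_eventually_notMem_activeAt hS hη hk] with ω h hev hω
  exact (tendsto_gain_activeAt h hu hk hω hev).1

/-- Gambler's ruin: from `n` the walk reaches `n + 1` before the level `x` with odds `n - x`. -/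
theorem measureReal_chosenLevel_inter_reached_succ (hS : IsSimpleRandomWalk S 𝔽 P)
    (hη : IsCoinFamily μ η S P) {n k : ℕ} (hu : ((n : ℝ) : EReal) < upper μ)
    (hk : IsPosition μ n k) :
    P.real (ChosenLevel η n k ∩ Reached S η (n + 1)) = (n - level μ n k) *
      P.real (ChosenLevel η n k ∩ (Reached S η n \ Reached S η (n + 1))) := by
  have hC := measurableSet_chosenLevel hη.measurable n k (μ := μ)
  have hR := measurableSet_reached hS.measurable hη.measurable (μ := μ)
  have h1 := hC.inter (hR (n + 1))
  have h2 := hC.inter ((hR n).diff (hR (n + 1)))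
  have key := (isSimpleRandomWalk_enlarged hS hη).integral_limit_gain
    (measurableSet_activeAt hS.measurable hη.measurable n k) (K := n + 1 - level μ n k)
    (L := fun ω => (ChosenLevel η n k ∩ Reached S η (n + 1)).indicator (fun _ => (1 : ℝ)) ω +
      (ChosenLevel η n k ∩ (Reached S η n \ Reached S η (n + 1))).indicator
        (fun _ => (level μ n k : ℝ) - n) ω)
    (fun t => by
      filter_upwards [hS.ae_unitPath] with ω hω
      exact abs_gain_activeAt_le hω hk t) ?_
  · rw [integral_add ((integrable_const _).indicator h1) ((integrable_const _).indicator h2),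
      integral_indicator_const _ h1, integral_indicator_const _ h2, smul_eq_mul, smul_eq_mul] at key
    linarith
  · filter_upwards [hS.ae_unitPath, ae_eventually_notMem_activeAt hS hη hk] with ω h hev
    by_cases hω : ω ∈ ChosenLevel η n k
    · convert (tendsto_gain_activeAt h hu hk hω hev).2 using 2
      by_cases ha : ω ∈ Reached S η (n + 1)
      · simp [hω, ha]
      · by_cases hb : ω ∈ Reached S η n <;> simp [hω, ha, hb]
    · simp [gain_activeAt_of_notMem hω, hω]

end Embedding

/-! ### The law of the stopped walk -/

section Law

open Set Filter Topology

variable {μ : Measure ℤ} [IsProbabilityMeasure μ] {Ω : Type*} {mΩ : MeasurableSpace Ω}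
  {P : Measure Ω} [IsProbabilityMeasure P] {S : ℕ → Ω → ℤ} {η : CoinIndex μ → Ω → Fin 2}
  {𝔽 : Filtration ℕ mΩ}

theorem exists_upper_eq (hint : Integrable (fun j : ℤ => (j : ℝ)) μ)
    (hcent : ∫ j : ℤ, (j : ℝ) ∂μ = 0) {n : ℕ} (hn : ¬ ((n : ℝ) : EReal) < upper μ) :
    ∃ u : ℕ, u ≤ n ∧ upper μ = ((u : ℝ) : EReal) := by
  have hne : ∃ j, 0 ≤ j ∧ μ {j} ≠ 0 := by
    by_contra! hc
    have h0 : ∀ j : ℤ, excess μ 0 j = 0 := fun j =>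
      le_antisymm (excess_nonpos_of_upper_le hint (fun i hi => by
        by_contra! hlt
        exact hi (hc i (by exact_mod_cast hlt.le))) j) (excess_zero_nonneg hint hcent j)
    have hall : ∀ j : ℤ, μ {j} = 0 := fun j => by
      rcases le_or_gt 0 j with hj | hj
      · exact hc j hj
      · have h1 := excess_eq_add hint 0 j
        rw [h0, h0, add_zero, sub_zero, zero_eq_mul] at h1
        by_contra hne
        exact h1.elim (fun h => hj.ne (by exact_mod_cast h)) (measureReal_singleton_ne_zero.2 hne)
    have h1 := hasSum_measureReal_singleton (μ := μ)
    simp only [measureReal_def, hall, ENNReal.toReal_zero] at h1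
    exact zero_ne_one (hasSum_zero.unique h1)
  obtain ⟨u, ⟨hu0, hu⟩, hmax⟩ := Int.exists_greatest_of_bdd
    (P := fun j : ℤ => 0 ≤ j ∧ μ {j} ≠ 0) ⟨n, fun j hj => le_of_upper_le hn hj.2⟩ hne
  lift u to ℕ using hu0
  refine ⟨u, by exact_mod_cast le_of_upper_le hn hu, le_antisymm (sSup_le ?_) (le_sSup ⟨u, hu, ?_⟩)⟩
  · rintro _ ⟨j, hj, rfl⟩
    rw [EReal.coe_le_coe_iff]
    rcases le_or_gt 0 j with h | h
    · exact_mod_cast hmax j ⟨h, hj⟩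
    · have h1 : (j : ℝ) < 0 := by exact_mod_cast h
      exact h1.le.trans (Nat.cast_nonneg u)
  · simp

theorem residual_of_upper_le (hint : Integrable (fun j : ℤ => (j : ℝ)) μ) {n : ℕ}
    (hn : ¬ ((n : ℝ) : EReal) < upper μ) {j : ℤ} (hj : j ≠ n) : residual μ n j = 0 := by
  rcases lt_or_gt_of_ne hj with h | h
  · exact residual_of_excess_nonpos hint h (excess_nonpos_of_upper_le hint
      (fun i hi => by exact_mod_cast le_of_upper_le hn hi) _)
  · rw [residual_of_le h.le]
    by_contra hc
    exact h.not_ge (le_of_upper_le hn (measureReal_singleton_ne_zero.1 hc))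

theorem residual_succ_of_upper_le (hint : Integrable (fun j : ℤ => (j : ℝ)) μ) {n : ℕ}
    (hn : ¬ ((n : ℝ) : EReal) < upper μ) (j : ℤ) : residual μ (n + 1) j = 0 := by
  by_cases hj : j = (n + 1 : ℕ)
  · subst hj
    rw [residual_of_le le_rfl]
    by_contra hc
    have := le_of_upper_le hn (measureReal_singleton_ne_zero.1 hc)
    push_cast at this
    omega
  · refine residual_of_upper_le hint (fun h => hn (lt_trans ?_ h)) hj
    exact_mod_cast Nat.lt_succ_self n

/-- The top of the support is never passed. -/
theorem stoppedAt_of_upper_le (hint : Integrable (fun j : ℤ => (j : ℝ)) μ)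
    (hcent : ∫ j : ℤ, (j : ℝ) ∂μ = 0) {n : ℕ} (hn : ¬ ((n : ℝ) : EReal) < upper μ) {ω : Ω}
    (h : UnitPath fun t => S t ω) (hω : ω ∈ Reached S η n) :
    ω ∈ StoppedAt S η n ∧ ω ∉ Reached S η (n + 1) := by
  obtain ⟨u, hun, hu⟩ := exists_upper_eq hint hcent hn
  obtain ⟨t, ht, hlt⟩ := hω
  have htn : (n : ℤ) ≤ runMax S t ω := ht ▸ le_runMax t
  obtain ⟨v, hvt, hv, -⟩ := h.exists_first (n := u) (t := t) (by omega)
  have hst : Stops S η v ω := Or.inr (by rw [hu, hv]; simp)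
  obtain rfl : v = t := by
    rcases hvt.lt_or_eq with h' | h'
    · exact absurd hst (hlt v h').2
    · exact h'
  have htau : tauAY S η ω = v := tauAY_eq_iff.2 ⟨hst, fun r hr => (hlt r hr).2⟩
  refine ⟨⟨v, htau, ht⟩, fun hr => ?_⟩
  obtain ⟨s, hs, hmax⟩ := (mem_reached_iff h).1 hr
  rw [htau] at hs
  have hsv : s ≤ v := by exact_mod_cast hs
  have : runMax S v ω ≤ n := runMax_le_iff.2 fun r hr => by
    rcases hr.lt_or_eq with h' | rfl
    · exact (le_runMax r).trans (hlt r h').1.le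
    · exact ht.le
  have := runMax_mono (S := S) (ω := ω) hsv
  push_cast at hmax
  omega

theorem measureReal_congr_of_ae {A B : Set Ω} (h : ∀ᵐ ω ∂P, ω ∈ A ↔ ω ∈ B) :
    P.real A = P.real B :=
  measureReal_congr (h.mono fun _ hω => propext hω)

theorem measureReal_reached_diff (hS : IsSimpleRandomWalk S 𝔽 P) (hη : IsCoinFamily μ η S P)
    {E : Set Ω} (n : ℕ) :
    P.real (E ∩ Reached S η n) = P.real (E ∩ Reached S η (n + 1)) +
      P.real (E ∩ (Reached S η n \ Reached S η (n + 1))) := by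
  rw [← measureReal_inter_add_sdiff (s := E ∩ Reached S η n)
    (measurableSet_reached hS.measurable hη.measurable (n + 1)), inter_sdiff_assoc]
  congr 1
  refine measureReal_congr_of_ae ?_
  filter_upwards [hS.ae_unitPath] with ω h
  exact ⟨fun hm => ⟨hm.1.1, hm.2⟩, fun hm => ⟨⟨hm.1, reached_succ_subset h hm.2⟩, hm.2⟩⟩

/-- Below the top of the support, the walk that has reached `n` chooses a level by the coins and
either reaches `n + 1` or is stopped at that level. -/
theorem stoppedAt_inter_of_lt_upper (hint : Integrable (fun j : ℤ => (j : ℝ)) μ)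
    (hcent : ∫ j : ℤ, (j : ℝ) ∂μ = 0) (hS : IsSimpleRandomWalk S 𝔽 P) (hη : IsCoinFamily μ η S P)
    {n : ℕ} (hn : ((n : ℝ) : EReal) < upper μ) (hr : P.real (Reached S η n) = reach μ n) :
    (∀ j, P.real (StoppedAt S η j ∩ (Reached S η n \ Reached S η (n + 1))) =
      residual μ n j - residual μ (n + 1) j) ∧
    ∀ᵐ ω ∂P, ω ∈ Reached S η n \ Reached S η (n + 1) → ∃ j, ω ∈ StoppedAt S η j := by
  have hex : ∀ᵐ ω ∂P, ω ∈ Reached S η n \ Reached S η (n + 1) →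
      ∃ k, IsPosition μ n k ∧ ω ∈ ChosenLevel η n k ∧ ω ∈ StoppedAt S η (level μ n k) := by
    have hall : ∀ᵐ ω ∂P, ∀ k, IsPosition μ n k → ω ∈ ChosenLevel η n k →
        ω ∈ Reached S η n \ Reached S η (n + 1) → ω ∈ StoppedAt S η (level μ n k) := by
      rw [ae_all_iff]
      intro k
      by_cases hk : IsPosition μ n k
      · filter_upwards [ae_stoppedAt_level hS hη hn hk] with ω h _ using h
      · exact Eventually.of_forall fun ω h => absurd h hk
    filter_upwards [hall, ae_exists_chosenLevel hint hcent hη hn] with ω h1 ⟨k, hk, hω⟩ hd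
    exact ⟨k, hk, hω, h1 k hk hω hd⟩
  refine ⟨fun j => ?_, hex.mono fun ω h hd => (h hd).imp' _ fun k hk => hk.2.2⟩
  by_cases hj : j ∈ levelSet μ n
  · obtain ⟨k, hk, rfl⟩ := exists_level_eq hj
    have h1 : P.real (StoppedAt S η (level μ n k) ∩ (Reached S η n \ Reached S η (n + 1))) =
        P.real (ChosenLevel η n k ∩ (Reached S η n \ Reached S η (n + 1))) := by
      refine measureReal_congr_of_ae ?_
      filter_upwards [hex, ae_stoppedAt_level hS hη hn hk] with ω h1 h2
      refine and_congr_left fun hd => ⟨fun hs => ?_, fun hc => h2 hc hd⟩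
      obtain ⟨k', hk', hc', hs'⟩ := h1 hd
      have : level μ n k = level μ n k' := by
        by_contra hne
        exact disjoint_left.1 (stoppedAt_disjoint hne) hs hs'
      rwa [level_injOn n hk hk' this]
    have h2 := measureReal_chosenLevel_inter_reached_succ hS hη hn hk
    have h3 := measureReal_reached_diff hS hη (E := ChosenLevel η n k) n
    have h4 : P.real (ChosenLevel η n k ∩ Reached S η n) = weight μ n (level μ n k) := by
      rw [measureReal_chosenLevel_inter_reached hS hη, hr,
        measureReal_chosenLevel hint hcent hη hn hk, div_mul_cancel₀ _ (reach_pos hint hn).ne']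
    have h5 : (level μ n k : ℝ) ≤ n := by exact_mod_cast hj.1
    rw [h1]
    rw [h4, h2, weight] at h3
    refine mul_left_cancel₀ (show (n : ℝ) + 1 - level μ n k ≠ 0 by linarith) ?_
    linarith
  · have h1 : residual μ n j - residual μ (n + 1) j = 0 := by
      by_cases hjn : j = n + 1
      · rw [residual_eq_residual_succ_of_lt (by omega), sub_self]
      · have := weight_eq_zero hint hn hj
        rw [weight, mul_eq_zero] at this
        refine this.resolve_left fun h => hjn ?_
        have : (j : ℝ) = n + 1 := by linarith
        exact_mod_cast this
    rw [h1]
    refine (measureReal_congr_of_ae (B := ∅) ?_).trans measureReal_empty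
    filter_upwards [hex] with ω h1
    refine iff_of_false ?_ (notMem_empty _)
    rintro ⟨hs, hd⟩
    obtain ⟨k, hk, -, hs'⟩ := h1 hd
    refine disjoint_left.1 (stoppedAt_disjoint ?_) hs hs'
    rintro rfl
    exact hj hk.level_mem

/-- The law of the position at which the walk is stopped while its maximum is `n`, for all `n`: at
the top of the support the only remaining mass is the atom there, and above it nothing remains. -/
theorem stoppedAt_inter (hint : Integrable (fun j : ℤ => (j : ℝ)) μ)
    (hcent : ∫ j : ℤ, (j : ℝ) ∂μ = 0) (hS : IsSimpleRandomWalk S 𝔽 P) (hη : IsCoinFamily μ η S P)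
    {n : ℕ} (hr : P.real (Reached S η n) = reach μ n) :
    (∀ j, P.real (StoppedAt S η j ∩ (Reached S η n \ Reached S η (n + 1))) =
      residual μ n j - residual μ (n + 1) j) ∧
    ∀ᵐ ω ∂P, ω ∈ Reached S η n \ Reached S η (n + 1) → ∃ j, ω ∈ StoppedAt S η j := by
  by_cases hn : ((n : ℝ) : EReal) < upper μ
  · exact stoppedAt_inter_of_lt_upper hint hcent hS hη hn hr
  have hall : ∀ᵐ ω ∂P, ω ∈ Reached S η n → ω ∈ StoppedAt S η n ∧ ω ∉ Reached S η (n + 1) := by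
    filter_upwards [hS.ae_unitPath] with ω h using stoppedAt_of_upper_le hint hcent hn h
  refine ⟨fun j => ?_, hall.mono fun ω h hd => ⟨n, (h hd.1).1⟩⟩
  rw [residual_succ_of_upper_le hint hn, sub_zero]
  by_cases hj : j = n
  · subst hj
    rw [← tsum_eq_single (L := .unconditional ℤ) (f := residual μ n) (n : ℤ)
      fun j hj => residual_of_upper_le hint hn hj]
    rw [← reach, ← hr]
    refine measureReal_congr_of_ae ?_
    filter_upwards [hall] with ω h
    exact ⟨fun hm => hm.2.1, fun hm => ⟨(h hm).1, hm, (h hm).2⟩⟩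
  · rw [residual_of_upper_le hint hn hj]
    refine (measureReal_congr_of_ae (B := ∅) ?_).trans measureReal_empty
    filter_upwards [hall] with ω h
    refine iff_of_false ?_ (notMem_empty _)
    rintro ⟨hs, hd⟩
    exact disjoint_left.1 (stoppedAt_disjoint hj) hs (h hd.1).1

/-- Induction on `n`: the mass stopped while the maximum is `n` is `reach μ n - reach μ (n + 1)`. -/
theorem measureReal_reached (hint : Integrable (fun j : ℤ => (j : ℝ)) μ)
    (hcent : ∫ j : ℤ, (j : ℝ) ∂μ = 0) (hS : IsSimpleRandomWalk S 𝔽 P) (hη : IsCoinFamily μ η S P)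
    (n : ℕ) : P.real (Reached S η n) = reach μ n := by
  induction n with
  | zero =>
    have : Reached S η 0 = univ :=
      eq_univ_of_forall fun ω => ⟨0, hS.zero ω, fun u hu => absurd hu (Nat.not_lt_zero u)⟩
    rw [this, probReal_univ, reach_zero hint hcent]
  | succ n ih =>
    obtain ⟨h1, h2⟩ := stoppedAt_inter hint hcent hS hη ih
    have hR := measurableSet_reached hS.measurable hη.measurable (μ := μ)
    have h3 := hasSum_measureReal_iUnion (P := P)
      (E := fun j => StoppedAt S η j ∩ (Reached S η n \ Reached S η (n + 1)))
      (fun j => (measurableSet_stoppedAt hS.measurable hη.measurable j).inter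
        ((hR n).diff (hR (n + 1))))
      (fun i j hij => (stoppedAt_disjoint hij).mono inter_subset_left inter_subset_left)
    simp only [h1] at h3
    have h4 := h3.unique ((hasSum_residual hint n).sub (hasSum_residual hint (n + 1)))
    have h5 : P.real (⋃ j, StoppedAt S η j ∩ (Reached S η n \ Reached S η (n + 1))) =
        P.real (univ ∩ (Reached S η n \ Reached S η (n + 1))) := by
      refine measureReal_congr_of_ae ?_
      filter_upwards [h2] with ω h
      rw [← iUnion_inter, univ_inter]
      exact ⟨fun hm => hm.2, fun hm => ⟨mem_iUnion.2 (h hm), hm⟩⟩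
    have h6 := measureReal_reached_diff hS hη (E := univ) n
    rw [← h5, h4, univ_inter, univ_inter, ih] at h6
    linarith

/-- Summation of the masses stopped at `j` while the maximum is `0, …, n - 1`. -/
theorem measureReal_stoppedAt_inter_reached_add (hint : Integrable (fun j : ℤ => (j : ℝ)) μ)
    (hcent : ∫ j : ℤ, (j : ℝ) ∂μ = 0) (hS : IsSimpleRandomWalk S 𝔽 P) (hη : IsCoinFamily μ η S P)
    (n : ℕ) (j : ℤ) :
    P.real (StoppedAt S η j ∩ Reached S η n) + μ.real {j} =
      P.real (StoppedAt S η j) + residual μ n j := by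
  induction n with
  | zero =>
    have : Reached S η 0 = univ :=
      eq_univ_of_forall fun ω => ⟨0, hS.zero ω, fun u hu => absurd hu (Nat.not_lt_zero u)⟩
    rw [this, inter_univ, residual_zero hint hcent]
  | succ n ih =>
    have h1 := (stoppedAt_inter hint hcent hS hη (measureReal_reached hint hcent hS hη n)).1 j
    have h2 := measureReal_reached_diff hS hη (E := StoppedAt S η j) n
    linarith

/-- For large `n` all the mass at `j` has been used up. -/
theorem exists_residual_eq_zero (hint : Integrable (fun j : ℤ => (j : ℝ)) μ) (j : ℤ) :
    ∃ n, residual μ n j = 0 := by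
  obtain ⟨N, hN⟩ := exists_nat_gt (max (j : ℝ)
    ((∫ i in Ici (j + 1), (i : ℝ) ∂μ) / μ.real (Ici (j + 1))))
  have hj : (j : ℝ) < N := (le_max_left _ _).trans_lt hN
  refine ⟨N, residual_of_excess_nonpos hint (by exact_mod_cast hj) ?_⟩
  rcases (measureReal_nonneg (μ := μ) (s := Ici (j + 1))).eq_or_lt with h | h
  · refine (setIntegral_measure_zero _ ?_).le
    rwa [eq_comm, measureReal_eq_zero_iff] at h
  · have h1 := ((le_max_right _ _).trans_lt hN).le
    rw [div_le_iff₀ h] at h1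
    rw [excess_eq hint]
    linarith

theorem le_measureReal_stoppedAt (hint : Integrable (fun j : ℤ => (j : ℝ)) μ)
    (hcent : ∫ j : ℤ, (j : ℝ) ∂μ = 0) (hS : IsSimpleRandomWalk S 𝔽 P) (hη : IsCoinFamily μ η S P)
    (j : ℤ) : μ.real {j} ≤ P.real (StoppedAt S η j) := by
  obtain ⟨n, hn⟩ := exists_residual_eq_zero hint j
  have h1 := measureReal_stoppedAt_inter_reached_add hint hcent hS hη n j
  have h2 := measureReal_nonneg (μ := P) (s := StoppedAt S η j ∩ Reached S η n)
  linarith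

/-- The walk is stopped at `j` with probability `μ {j}`: the inequality `≥` holds for every `j`, and
the masses on the right have sum `1`, those on the left at most `1`. -/
theorem measureReal_stoppedAt (hint : Integrable (fun j : ℤ => (j : ℝ)) μ)
    (hcent : ∫ j : ℤ, (j : ℝ) ∂μ = 0) (hS : IsSimpleRandomWalk S 𝔽 P) (hη : IsCoinFamily μ η S P)
    (j : ℤ) : P.real (StoppedAt S η j) = μ.real {j} := by
  refine le_antisymm ?_ (le_measureReal_stoppedAt hint hcent hS hη j)
  by_contra! hlt
  have h1 := hasSum_measureReal_iUnion (P := P) (E := StoppedAt S η)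
    (fun j => measurableSet_stoppedAt hS.measurable hη.measurable j) stoppedAt_disjoint
  exact (hasSum_lt (le_measureReal_stoppedAt hint hcent hS hη) hlt
    hasSum_measureReal_singleton h1).not_ge measureReal_le_one

theorem measureReal_stoppedAt_inter_reached (hint : Integrable (fun j : ℤ => (j : ℝ)) μ)
    (hcent : ∫ j : ℤ, (j : ℝ) ∂μ = 0) (hS : IsSimpleRandomWalk S 𝔽 P) (hη : IsCoinFamily μ η S P)
    (n : ℕ) (j : ℤ) : P.real (StoppedAt S η j ∩ Reached S η n) = residual μ n j := by
  have h1 := measureReal_stoppedAt_inter_reached_add hint hcent hS hη n j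
  rw [measureReal_stoppedAt hint hcent hS hη] at h1
  linarith

theorem ae_exists_stoppedAt (hint : Integrable (fun j : ℤ => (j : ℝ)) μ)
    (hcent : ∫ j : ℤ, (j : ℝ) ∂μ = 0) (hS : IsSimpleRandomWalk S 𝔽 P) (hη : IsCoinFamily μ η S P) :
    ∀ᵐ ω ∂P, ∃ j, ω ∈ StoppedAt S η j := by
  refine ae_exists_of_hasSum_one
    (fun j => measurableSet_stoppedAt hS.measurable hη.measurable j) stoppedAt_disjoint ?_
  simp only [measureReal_stoppedAt hint hcent hS hη]
  exact hasSum_measureReal_singleton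

theorem ae_tauAY_ne_top (hint : Integrable (fun j : ℤ => (j : ℝ)) μ)
    (hcent : ∫ j : ℤ, (j : ℝ) ∂μ = 0) (hS : IsSimpleRandomWalk S 𝔽 P) (hη : IsCoinFamily μ η S P) :
    ∀ᵐ ω ∂P, tauAY S η ω ≠ ⊤ := by
  filter_upwards [ae_exists_stoppedAt hint hcent hS hη] with ω ⟨j, t, ht, _⟩
  rw [ht]
  exact natCast_withTop_ne_top t

theorem stoppedValue_eq_iff {ω : Ω} (h : tauAY S η ω ≠ ⊤) (j : ℤ) :
    stoppedValue S (tauAY S η) ω = j ↔ ω ∈ StoppedAt S η j := by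
  obtain ⟨t, ht⟩ := exists_natCast_eq h
  rw [stoppedValue_of_eq ht]
  refine ⟨fun hj => ⟨t, ht, hj⟩, ?_⟩
  rintro ⟨s, hs, hj⟩
  have : t = s := by rw [ht] at hs; exact_mod_cast hs
  rwa [this]

theorem measurable_stoppedValue_of_isStoppingTime (hS : ∀ t, Measurable (S t))
    {τ : Ω → WithTop ℕ} (hτ : IsStoppingTime 𝔽 τ) : Measurable (stoppedValue S τ) := by
  have h1 : Measurable fun q : ℕ × Ω => S q.1 q.2 := measurable_from_prod_countable_right hS
  exact h1.comp (hτ.measurable'.untopA.prodMk measurable_id)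

theorem hasLaw_stoppedValue_tauAY (hint : Integrable (fun j : ℤ => (j : ℝ)) μ)
    (hcent : ∫ j : ℤ, (j : ℝ) ∂μ = 0) (hS : IsSimpleRandomWalk S 𝔽 P) (hη : IsCoinFamily μ η S P) :
    HasLaw (stoppedValue S (tauAY S η)) μ P := by
  have hm : AEMeasurable (stoppedValue S (tauAY S η)) P :=
    (measurable_stoppedValue_of_isStoppingTime hS.measurable
      (isStoppingTime_tauAY hS.measurable hη.measurable)).aemeasurable
  refine ⟨hm, Measure.ext_of_singleton fun j => ?_⟩
  have : P (stoppedValue S (tauAY S η) ⁻¹' {j}) = P (StoppedAt S η j) := by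
    refine measure_congr ?_
    filter_upwards [ae_tauAY_ne_top hint hcent hS hη] with ω hω
    exact propext (stoppedValue_eq_iff hω j)
  rw [Measure.map_apply_of_aemeasurable hm (measurableSet_singleton j), this,
    ← ofReal_measureReal (μ := P), measureReal_stoppedAt hint hcent hS hη, ofReal_measureReal]

end Law

/-! ### Uniform integrability of the stopped walk -/

section Stopped

open Set Filter Topology

variable {Ω : Type*} {mΩ : MeasurableSpace Ω} {P : Measure Ω} [IsProbabilityMeasure P]
  {S : ℕ → Ω → ℤ} {𝔽 : Filtration ℕ mΩ} {σ : Ω → WithTop ℕ}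

theorem measurable_stoppedProcess_of_isStoppingTime (hS : ∀ t, Measurable (S t))
    (hσ : IsStoppingTime 𝔽 σ) (t : ℕ) : Measurable (stoppedProcess S σ t) := by
  have h1 : Measurable fun q : ℕ × Ω => S q.1 q.2 := measurable_from_prod_countable_right hS
  have h2 : Measurable fun ω => min (t : WithTop ℕ) (σ ω) :=
    measurable_const.min hσ.measurable'
  exact h1.comp (h2.untopA.prodMk measurable_id)

theorem measurableSet_natCast_lt (hσ : IsStoppingTime 𝔽 σ) (t : ℕ) :
    MeasurableSet[𝔽 t] {ω | (t : WithTop ℕ) < σ ω} := hσ.measurableSet_gt t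

theorem stoppedProcess_eq_gain (hS : IsSimpleRandomWalk S 𝔽 P) (t : ℕ) (ω : Ω) :
    ((stoppedProcess S σ t ω : ℤ) : ℝ) =
      gain S (fun t => {ω | (t : WithTop ℕ) < σ ω}) t ω := by
  rw [stoppedProcess_eq_cutTime,
    eq_add_gain (S := S) (C := fun t => {ω | (t : WithTop ℕ) < σ ω}) (ω := ω)
      (g := fun t => (S t ω : ℝ)) (fun t ht => ?_) (fun t ht => ht) t, hS.zero]
  · simp
  · rw [indicator_of_mem (by exact ht), step_eq_sub]

theorem stoppedProcess_eventuallyEq {β : Type*} (u : ℕ → Ω → β) {ω : Ω} (h : σ ω ≠ ⊤) :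
    ∀ᶠ t : ℕ in atTop, stoppedProcess u σ t ω = stoppedValue u σ ω := by
  obtain ⟨k, hk⟩ := exists_natCast_eq h
  filter_upwards [eventually_ge_atTop k] with t ht
  rw [stoppedProcess_eq_cutTime, stoppedValue_of_eq hk, hk, cutTime_of_ge ht]

theorem stoppedProcess_eq_stoppedValue {β : Type*} (u : ℕ → Ω → β) {ω : Ω} {t : ℕ}
    (h : ¬ (t : WithTop ℕ) < σ ω) : stoppedProcess u σ t ω = stoppedValue u σ ω := by
  obtain ⟨k, hk, hkt⟩ := exists_natCast_eq_of_le (not_lt.1 h)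
  rw [stoppedProcess_eq_cutTime, stoppedValue_of_eq hk, hk, cutTime_of_ge hkt]

theorem integrable_stoppedProcess (hS : IsSimpleRandomWalk S 𝔽 P) (hσ : IsStoppingTime 𝔽 σ)
    (t : ℕ) : Integrable (fun ω => ((stoppedProcess S σ t ω : ℤ) : ℝ)) P := by
  simp only [stoppedProcess_eq_gain hS]
  exact hS.integrable_gain (measurableSet_natCast_lt hσ) t

theorem integral_stoppedProcess (hS : IsSimpleRandomWalk S 𝔽 P) (hσ : IsStoppingTime 𝔽 σ)
    (t : ℕ) : ∫ ω, ((stoppedProcess S σ t ω : ℤ) : ℝ) ∂P = 0 := by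
  simp only [stoppedProcess_eq_gain hS]
  exact hS.integral_gain (measurableSet_natCast_lt hσ) t

theorem eLpNorm_one_eq_ofReal {f : Ω → ℝ} (hf : Integrable f P) :
    eLpNorm f 1 P = ENNReal.ofReal (∫ ω, |f ω| ∂P) := by
  rw [eLpNorm_one_eq_lintegral_enorm]
  exact (ofReal_integral_norm_eq_lintegral_enorm hf).symm

/-- A stopped walk whose positive parts have mean at most that of the terminal value converges
to the terminal value in `L¹`. -/
theorem tendsto_integral_abs_sub_stoppedValue (hS : IsSimpleRandomWalk S 𝔽 P)
    (hσ : IsStoppingTime 𝔽 σ) (hfin : ∀ᵐ ω ∂P, σ ω ≠ ⊤)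
    (hi : Integrable (fun ω => ((stoppedValue S σ ω : ℤ) : ℝ)) P)
    (h0 : ∫ ω, ((stoppedValue S σ ω : ℤ) : ℝ) ∂P = 0)
    (hpos : ∀ t, ∫ ω, max ((stoppedProcess S σ t ω : ℤ) : ℝ) 0 ∂P ≤
      ∫ ω, max ((stoppedValue S σ ω : ℤ) : ℝ) 0 ∂P) :
    Tendsto (fun t => ∫ ω, |((stoppedProcess S σ t ω : ℤ) : ℝ) - ((stoppedValue S σ ω : ℤ) : ℝ)| ∂P)
      atTop (𝓝 0) := by
  have habs : ∀ x : ℝ, |x| = 2 * max x 0 - x := fun x => by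
    rcases le_total x 0 with h | h
    · rw [abs_of_nonpos h, max_eq_right h]; ring
    · rw [abs_of_nonneg h, max_eq_left h]; ring
  have hle : ∀ t, ∫ ω, |((stoppedProcess S σ t ω : ℤ) : ℝ)| ∂P ≤
      ∫ ω, |((stoppedValue S σ ω : ℤ) : ℝ)| ∂P := by
    intro t
    have ht := integrable_stoppedProcess hS hσ t
    simp only [habs]
    rw [integral_sub (ht.pos_part.const_mul 2) ht, integral_sub (hi.pos_part.const_mul 2) hi,
      integral_const_mul, integral_const_mul, h0, integral_stoppedProcess hS hσ]
    linarith [hpos t]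
  have hms : ∀ t : ℕ, MeasurableSet {ω | (t : WithTop ℕ) < σ ω} := fun t =>
    𝔽.le t _ (measurableSet_natCast_lt hσ t)
  have hbound : ∀ t : ℕ,
      ∫ ω, |((stoppedProcess S σ t ω : ℤ) : ℝ) - ((stoppedValue S σ ω : ℤ) : ℝ)| ∂P ≤
        2 * ∫ ω, {ω | (t : WithTop ℕ) < σ ω}.indicator
          (fun ω => |((stoppedValue S σ ω : ℤ) : ℝ)|) ω ∂P := by
    intro t
    have ht := integrable_stoppedProcess hS hσ t
    have h1 : ∫ ω, |((stoppedProcess S σ t ω : ℤ) : ℝ) - ((stoppedValue S σ ω : ℤ) : ℝ)| ∂P ≤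
        ∫ ω, ((|((stoppedProcess S σ t ω : ℤ) : ℝ)| - |((stoppedValue S σ ω : ℤ) : ℝ)|) + 2 *
          {ω | (t : WithTop ℕ) < σ ω}.indicator
            (fun ω => |((stoppedValue S σ ω : ℤ) : ℝ)|) ω) ∂P := by
      refine integral_mono (ht.sub hi).abs ((ht.abs.sub hi.abs).add
        ((hi.abs.indicator (hms t)).const_mul 2)) fun ω => ?_
      by_cases hω : (t : WithTop ℕ) < σ ω
      · simp only [indicator_of_mem (show ω ∈ {ω | (t : WithTop ℕ) < σ ω} from hω)]
        linarith [abs_sub ((stoppedProcess S σ t ω : ℤ) : ℝ) ((stoppedValue S σ ω : ℤ) : ℝ)]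
      · simp only [indicator_of_notMem (show ω ∉ {ω | (t : WithTop ℕ) < σ ω} from hω),
          stoppedProcess_eq_stoppedValue S hω]
        simp
    have hd : Integrable (fun ω => |((stoppedProcess S σ t ω : ℤ) : ℝ)| -
        |((stoppedValue S σ ω : ℤ) : ℝ)|) P := ht.abs.sub hi.abs
    rw [integral_add hd ((hi.abs.indicator (hms t)).const_mul 2),
      integral_sub ht.abs hi.abs, integral_const_mul] at h1
    linarith [hle t]
  have hlim : Tendsto (fun t : ℕ => ∫ ω, {ω | (t : WithTop ℕ) < σ ω}.indicator
      (fun ω => |((stoppedValue S σ ω : ℤ) : ℝ)|) ω ∂P) atTop (𝓝 (∫ _, (0 : ℝ) ∂P)) := by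
    refine tendsto_integral_of_dominated_convergence (fun ω => |((stoppedValue S σ ω : ℤ) : ℝ)|)
      (fun t => (hi.abs.indicator (hms t)).aestronglyMeasurable) hi.abs
      (fun t => Eventually.of_forall fun ω => ?_) ?_
    · rw [Real.norm_eq_abs, abs_of_nonneg (indicator_nonneg (fun _ _ => abs_nonneg _) _)]
      exact indicator_le_self' (fun _ _ => abs_nonneg _) _
    · filter_upwards [hfin] with ω hω
      obtain ⟨k, hk⟩ := exists_natCast_eq hω
      refine tendsto_const_nhds.congr' ?_
      filter_upwards [eventually_ge_atTop k] with t ht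
      refine (indicator_of_notMem ?_ _).symm
      change ¬ (t : WithTop ℕ) < σ ω
      rw [hk, not_lt]
      exact_mod_cast ht
  simp only [integral_zero] at hlim
  have := hlim.const_mul 2
  rw [mul_zero] at this
  exact squeeze_zero (fun t => integral_nonneg fun ω => abs_nonneg _) hbound this

theorem uniformIntegrable_stoppedProcess (hS : IsSimpleRandomWalk S 𝔽 P)
    (hσ : IsStoppingTime 𝔽 σ) (hfin : ∀ᵐ ω ∂P, σ ω ≠ ⊤)
    (hi : Integrable (fun ω => ((stoppedValue S σ ω : ℤ) : ℝ)) P)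
    (h0 : ∫ ω, ((stoppedValue S σ ω : ℤ) : ℝ) ∂P = 0)
    (hpos : ∀ t, ∫ ω, max ((stoppedProcess S σ t ω : ℤ) : ℝ) 0 ∂P ≤
      ∫ ω, max ((stoppedValue S σ ω : ℤ) : ℝ) 0 ∂P) :
    UniformIntegrable (fun (t : ℕ) ω => ((stoppedProcess S σ t ω : ℤ) : ℝ)) 1 P := by
  have ht := integrable_stoppedProcess hS hσ
  have hL := tendsto_integral_abs_sub_stoppedValue hS hσ hfin hi h0 hpos
  have hL' : Tendsto (fun t => eLpNorm ((fun ω => ((stoppedProcess S σ t ω : ℤ) : ℝ)) -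
      fun ω => ((stoppedValue S σ ω : ℤ) : ℝ)) 1 P) atTop (𝓝 0) := by
    have := ENNReal.tendsto_ofReal hL
    rw [ENNReal.ofReal_zero] at this
    refine this.congr fun t => ?_
    rw [eLpNorm_one_eq_ofReal ((ht t).sub hi)]
    rfl
  refine ⟨fun t => (ht t).aestronglyMeasurable, unifIntegrable_of_tendsto_Lp le_rfl
    ENNReal.one_ne_top (fun t => memLp_one_iff_integrable.2 (ht t))
    (memLp_one_iff_integrable.2 hi) hL', ?_⟩
  obtain ⟨B, hB⟩ := hL.bddAbove_range
  refine ⟨(B + ∫ ω, |((stoppedValue S σ ω : ℤ) : ℝ)| ∂P).toNNReal, fun t => ?_⟩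
  rw [eLpNorm_one_eq_ofReal (ht t)]
  refine ENNReal.ofReal_le_ofReal ?_
  have hd : Integrable (fun ω => |((stoppedProcess S σ t ω : ℤ) : ℝ) -
      ((stoppedValue S σ ω : ℤ) : ℝ)|) P := ((ht t).sub hi).abs
  have h1 : ∫ ω, |((stoppedProcess S σ t ω : ℤ) : ℝ)| ∂P ≤
      ∫ ω, (|((stoppedProcess S σ t ω : ℤ) : ℝ) - ((stoppedValue S σ ω : ℤ) : ℝ)| +
        |((stoppedValue S σ ω : ℤ) : ℝ)|) ∂P := by
    refine integral_mono (ht t).abs (hd.add hi.abs) fun ω => ?_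
    have := abs_add_le (((stoppedProcess S σ t ω : ℤ) : ℝ) - ((stoppedValue S σ ω : ℤ) : ℝ))
      ((stoppedValue S σ ω : ℤ) : ℝ)
    simpa using this
  rw [integral_add hd hi.abs] at h1
  linarith [hB (mem_range_self t)]

/-- Conversely, uniform integrability yields convergence in `L¹`. -/
theorem tendsto_integral_abs_sub_of_uniformIntegrable (hfin : ∀ᵐ ω ∂P, σ ω ≠ ⊤)
    (hi : Integrable (fun ω => ((stoppedValue S σ ω : ℤ) : ℝ)) P)
    (hui : UniformIntegrable (fun (t : ℕ) ω => ((stoppedProcess S σ t ω : ℤ) : ℝ)) 1 P) :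
    Tendsto (fun t => ∫ ω, |((stoppedProcess S σ t ω : ℤ) : ℝ) - ((stoppedValue S σ ω : ℤ) : ℝ)| ∂P)
      atTop (𝓝 0) := by
  have hL := tendsto_Lp_finite_of_tendsto_ae le_rfl ENNReal.one_ne_top hui.1
    (memLp_one_iff_integrable.2 hi) hui.2.1 (by
      filter_upwards [hfin] with ω hω
      refine tendsto_const_nhds.congr' ?_
      filter_upwards [stoppedProcess_eventuallyEq S hω] with t ht
      rw [ht])
  have := (ENNReal.tendsto_toReal ENNReal.zero_ne_top).comp hL
  refine this.congr fun t => ?_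
  have ht : Integrable (fun ω => ((stoppedProcess S σ t ω : ℤ) : ℝ)) P :=
    memLp_one_iff_integrable.1 (hui.memLp t)
  rw [Function.comp_apply, eLpNorm_one_eq_ofReal (ht.sub hi), ENNReal.toReal_ofReal
    (integral_nonneg fun ω => abs_nonneg _)]
  rfl

end Stopped

/-! ### The maximal inequality -/

section Doob

open Set Filter Topology

variable {μ : Measure ℤ} [IsProbabilityMeasure μ]
  {Ω : Type*} {mΩ : MeasurableSpace Ω} {P : Measure Ω} [IsProbabilityMeasure P]
  {S : ℕ → Ω → ℤ} {𝔽 : Filtration ℕ mΩ} {σ : Ω → WithTop ℕ}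

theorem integrable_of_hasLaw {X : Ω → ℤ} (h : HasLaw X μ P)
    (hint : Integrable (fun j : ℤ => (j : ℝ)) μ) : Integrable (fun ω => (X ω : ℝ)) P := by
  rw [← h.map_eq] at hint
  exact hint.comp_aemeasurable h.aemeasurable

theorem integral_of_hasLaw {X : Ω → ℤ} (h : HasLaw X μ P) (f : ℤ → ℝ) :
    ∫ ω, f (X ω) ∂P = ∫ j, f j ∂μ :=
  h.integral_comp (measurable_of_countable f).aestronglyMeasurable

/-- Optional stopping for `(S - n) 1 {S* ≥ n}`, a martingale since `S = n` when `S*` reaches `n`. -/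
theorem integral_sub_indicator_runMax (hS : IsSimpleRandomWalk S 𝔽 P) (hσ : IsStoppingTime 𝔽 σ)
    {n : ℕ} (hn : 1 ≤ n) (t : ℕ) :
    Integrable ({ω | (n : ℤ) ≤ stoppedProcess (runMax S) σ t ω}.indicator
      fun ω => ((stoppedProcess S σ t ω : ℤ) : ℝ) - n) P ∧
    ∫ ω, {ω | (n : ℤ) ≤ stoppedProcess (runMax S) σ t ω}.indicator
      (fun ω => ((stoppedProcess S σ t ω : ℤ) : ℝ) - n) ω ∂P = 0 := by
  classical
  set C : ℕ → Set Ω := fun t => {ω | (t : WithTop ℕ) < σ ω} ∩ {ω | (n : ℤ) ≤ runMax S t ω} with hC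
  have hCm : ∀ t, MeasurableSet[𝔽 t] (C t) := fun t =>
    (measurableSet_natCast_lt hσ t).inter
      (measurable_runMax_of (fun r hr => (hS.adapted r).mono (𝔽.mono hr) le_rfl)
        (measurableSet_Ici (a := (n : ℤ))))
  have heq : {ω | (n : ℤ) ≤ stoppedProcess (runMax S) σ t ω}.indicator
      (fun ω => ((stoppedProcess S σ t ω : ℤ) : ℝ) - n) =ᵐ[P] gain S C t := by
    filter_upwards [hS.ae_unitPath] with ω hω
    have h := eq_add_gain (S := S) (C := C) (ω := ω) (σ := σ ω)
      (g := fun t => if (n : ℤ) ≤ runMax S t ω then (S t ω : ℝ) - n else 0) ?_ ?_ t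
    · rw [if_neg (show ¬ (n : ℤ) ≤ runMax S 0 ω by rw [runMax_zero, hS.zero]; omega), zero_add] at h
      rw [← h]
      simp only [indicator_apply, stoppedProcess_eq_cutTime]
      rfl
    · intro s hs
      have hcases := hω.runMax_succ_cases s
      by_cases hR : (n : ℤ) ≤ runMax S s ω
      · have hR1 := hR.trans (runMax_mono (Nat.le_succ s))
        rw [indicator_of_mem (by exact ⟨hs, hR⟩), step_eq_sub]
        simp only [if_pos hR, if_pos hR1]
        ring
      · rw [indicator_of_notMem (by exact fun h => hR h.2), if_neg hR, sub_zero]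
        split_ifs with hR1
        · have : S (s + 1) ω = n := by omega
          rw [this]; simp
        · rfl
    · exact fun s hs h => hs h.1
  rw [integral_congr_ae heq, integrable_congr heq]
  exact ⟨hS.integrable_gain hCm t, hS.integral_gain hCm t⟩

/-- Doob's maximal inequality in the form `(n - z) P(S*_σ ≥ n) ≤ E (S_σ - z)⁺`, at the level `z` for
which the right-hand side is `(n - z) reach μ n`. -/
theorem measureReal_runMax_le_reach (hint : Integrable (fun j : ℤ => (j : ℝ)) μ)
    (hcent : ∫ j : ℤ, (j : ℝ) ∂μ = 0) (hS : IsSimpleRandomWalk S 𝔽 P) (hσ : σ ∈ SEP S 𝔽 P μ)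
    {n : ℕ} (hn : 1 ≤ n) :
    P.real {ω | (n : ℤ) ≤ stoppedValue (runMax S) σ ω} ≤ reach μ n := by
  obtain ⟨hst, hfin, hlaw, hui⟩ := hσ
  obtain ⟨z, hz, hz0, hz1, -⟩ := exists_crossing hint hcent hn
  obtain ⟨hr0, -, hr1⟩ := residual_eq_of_crossing hint hz hz0 hz1
  have hreach := mul_reach_eq hint hcent hr0 hr1
  have hnz := intCast_sub_pos hz
  have hi := integrable_of_hasLaw hlaw hint
  have hL := tendsto_integral_abs_sub_of_uniformIntegrable hfin hi hui
  have hterm : ∫ ω, max (((stoppedValue S σ ω : ℤ) : ℝ) - z) 0 ∂P = excess μ z (z + 1) := by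
    rw [integral_of_hasLaw hlaw (fun j => max ((j : ℝ) - z) 0), excess,
      ← integral_indicator measurableSet_Ici]
    refine integral_congr_ae (Eventually.of_forall fun j => ?_)
    by_cases hj : z + 1 ≤ j
    · have : (z : ℝ) ≤ j := by exact_mod_cast (by omega : z ≤ j)
      simp [indicator_of_mem (mem_Ici.2 hj), this]
    · have : (j : ℝ) ≤ z := by exact_mod_cast (by omega : j ≤ z)
      simp [indicator_of_notMem (mem_Ici.not.2 hj), this]
  have hms : ∀ t, MeasurableSet {ω | (n : ℤ) ≤ stoppedProcess (runMax S) σ t ω} := fun t =>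
    measurable_stoppedProcess_of_isStoppingTime (fun t => measurable_runMax hS.measurable t) hst t
      (measurableSet_Ici (a := (n : ℤ)))
  have hmv : MeasurableSet {ω | (n : ℤ) ≤ stoppedValue (runMax S) σ ω} :=
    measurable_stoppedValue_of_isStoppingTime (fun t => measurable_runMax hS.measurable t) hst
      (measurableSet_Ici (a := (n : ℤ)))
  have hbound : ∀ t, (n - z) * P.real {ω | (n : ℤ) ≤ stoppedProcess (runMax S) σ t ω} ≤
      excess μ z (z + 1) +
        ∫ ω, |((stoppedProcess S σ t ω : ℤ) : ℝ) - ((stoppedValue S σ ω : ℤ) : ℝ)| ∂P := by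
    intro t
    have ht := integrable_stoppedProcess hS hst t
    obtain ⟨hg, hg0⟩ := integral_sub_indicator_runMax hS hst hn t
    have h1 : (n - z) * P.real {ω | (n : ℤ) ≤ stoppedProcess (runMax S) σ t ω} =
        ∫ ω, ({ω | (n : ℤ) ≤ stoppedProcess (runMax S) σ t ω}.indicator
          (fun ω => ((stoppedProcess S σ t ω : ℤ) : ℝ) - n) ω +
          {ω | (n : ℤ) ≤ stoppedProcess (runMax S) σ t ω}.indicator
          (fun _ => ((n : ℝ) - z)) ω) ∂P := by
      rw [integral_add hg ((integrable_const _).indicator (hms t)), hg0,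
        integral_indicator_const _ (hms t), zero_add, smul_eq_mul, mul_comm]
    have hiz : Integrable (fun ω => max (((stoppedValue S σ ω : ℤ) : ℝ) - z) 0) P :=
      (hi.sub (integrable_const (z : ℝ))).pos_part
    have hd : Integrable (fun ω => |((stoppedProcess S σ t ω : ℤ) : ℝ) -
        ((stoppedValue S σ ω : ℤ) : ℝ)|) P := (ht.sub hi).abs
    rw [h1, ← hterm, ← integral_add hiz hd]
    refine integral_mono (hg.add ((integrable_const _).indicator (hms t)))
      (hiz.add hd) fun ω => ?_
    have h2 := le_abs_self (((stoppedProcess S σ t ω : ℤ) : ℝ) - ((stoppedValue S σ ω : ℤ) : ℝ))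
    have h3 := le_max_left (((stoppedValue S σ ω : ℤ) : ℝ) - z) 0
    have h4 := le_max_right (((stoppedValue S σ ω : ℤ) : ℝ) - z) 0
    have h5 := abs_nonneg (((stoppedProcess S σ t ω : ℤ) : ℝ) - ((stoppedValue S σ ω : ℤ) : ℝ))
    by_cases hω : (n : ℤ) ≤ stoppedProcess (runMax S) σ t ω
    · simp only [indicator_of_mem
        (show ω ∈ {ω | (n : ℤ) ≤ stoppedProcess (runMax S) σ t ω} from hω)]
      linarith
    · simp only [indicator_of_notMem
        (show ω ∉ {ω | (n : ℤ) ≤ stoppedProcess (runMax S) σ t ω} from hω)]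
      linarith
  have hlim : Tendsto (fun t => P.real {ω | (n : ℤ) ≤ stoppedProcess (runMax S) σ t ω}) atTop
      (𝓝 (P.real {ω | (n : ℤ) ≤ stoppedValue (runMax S) σ ω})) := by
    simp only [← integral_indicator_one (hms _), ← integral_indicator_one hmv]
    refine tendsto_integral_of_dominated_convergence (fun _ => 1)
      (fun t => ((integrable_const _).indicator (hms t)).aestronglyMeasurable) (integrable_const _)
      (fun t => Eventually.of_forall fun ω => ?_) ?_
    · by_cases hω : ω ∈ {ω | (n : ℤ) ≤ stoppedProcess (runMax S) σ t ω} <;> simp [hω]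
    · filter_upwards [hfin] with ω hω
      refine tendsto_const_nhds.congr' ?_
      filter_upwards [stoppedProcess_eventuallyEq (runMax S) hω] with t ht
      simp only [indicator_apply, mem_ofPred, ht]
  have h := le_of_tendsto_of_tendsto' (hlim.const_mul ((n : ℝ) - z)) (hL.const_add _) hbound
  rw [add_zero, ← hreach] at h
  exact le_of_mul_le_mul_left h hnz

end Doob

/-! ### The embedding and its maximum -/

section Embedding

open Set Filter Topology

variable {μ : Measure ℤ} [IsProbabilityMeasure μ] {Ω : Type*} {mΩ : MeasurableSpace Ω}
  {P : Measure Ω} [IsProbabilityMeasure P] {S : ℕ → Ω → ℤ} {η : CoinIndex μ → Ω → Fin 2}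
  {𝔽 : Filtration ℕ mΩ} {σ : Ω → WithTop ℕ}

/-- The positive part of the walk, frozen at `n` once the running maximum has reached `n`. -/
noncomputable def frozen (S : ℕ → Ω → ℤ) (n t : ℕ) (ω : Ω) : ℝ :=
  if (n : ℤ) ≤ runMax S t ω then n else max (S t ω : ℝ) 0

theorem measurable_frozen (hS : ∀ t, Measurable (S t)) (n t : ℕ) : Measurable (frozen S n t) := by
  refine Measurable.ite (measurable_runMax hS t (measurableSet_Ici (a := (n : ℤ))))
    measurable_const ?_
  exact ((measurable_of_countable fun j : ℤ => (j : ℝ)).comp (hS t)).max measurable_const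

theorem frozen_mem_Icc (n t : ℕ) (ω : Ω) : 0 ≤ frozen S n t ω ∧ frozen S n t ω ≤ n := by
  rw [frozen]
  split_ifs with h
  · exact ⟨Nat.cast_nonneg n, le_rfl⟩
  · have h1 := le_runMax (S := S) (ω := ω) t
    have h2 : (S t ω : ℝ) ≤ n := by exact_mod_cast (by omega : S t ω ≤ n)
    exact ⟨le_max_right _ _, max_le h2 (Nat.cast_nonneg n)⟩

/-- The frozen positive part is a submartingale: its increments dominate the steps taken from
strictly positive positions before the running maximum reaches `n`. -/
theorem indicator_step_le_frozen_succ_sub {ω : Ω} (h : UnitPath fun t => S t ω) (n t : ℕ) :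
    {ω | runMax S t ω < n ∧ 0 < S t ω}.indicator (step S t) ω ≤
      frozen S n (t + 1) ω - frozen S n t ω := by
  have hc := h.runMax_succ_cases t
  have hu := h.2 t
  simp only at hu
  by_cases hR : (n : ℤ) ≤ runMax S t ω
  · rw [indicator_of_notMem fun h => (not_lt.2 hR) h.1, frozen, frozen, if_pos hR,
      if_pos (hR.trans (runMax_mono (Nat.le_succ t))), sub_self]
  · by_cases hp : 0 < S t ω
    · have h1 : (0 : ℝ) ≤ S t ω := by exact_mod_cast hp.le
      have h2 : (0 : ℝ) ≤ S (t + 1) ω := by exact_mod_cast (by omega : 0 ≤ S (t + 1) ω)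
      rw [indicator_of_mem (by exact ⟨not_le.1 hR, hp⟩), step_eq_sub, frozen, frozen, if_neg hR,
        max_eq_left h1]
      split_ifs with hR1
      · rw [show S (t + 1) ω = n by omega]; simp
      · rw [max_eq_left h2]
    · have h1 : (S t ω : ℝ) ≤ 0 := by exact_mod_cast not_lt.1 hp
      rw [indicator_of_notMem fun h => hp h.2, frozen.eq_def S n t, if_neg hR, max_eq_right h1,
        sub_zero]
      exact (frozen_mem_Icc _ _ _).1

theorem integrable_stoppedProcess_frozen (hS : IsSimpleRandomWalk S 𝔽 P)
    (hσ : IsStoppingTime 𝔽 σ) (n t : ℕ) : Integrable (stoppedProcess (frozen S n) σ t) P := by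
  have h1 : Measurable fun q : ℕ × Ω => frozen S n q.1 q.2 :=
    measurable_from_prod_countable_right (measurable_frozen hS.measurable n)
  have h2 : Measurable fun ω => min (t : WithTop ℕ) (σ ω) := measurable_const.min hσ.measurable'
  refine Integrable.of_bound (C := n)
    (h1.comp (h2.untopA.prodMk measurable_id)).aestronglyMeasurable
    (Eventually.of_forall fun ω => ?_)
  rw [stoppedProcess_eq_cutTime, Real.norm_eq_abs, abs_of_nonneg (frozen_mem_Icc _ _ _).1]
  exact (frozen_mem_Icc _ _ _).2

theorem monotone_integral_frozen (hS : IsSimpleRandomWalk S 𝔽 P) (hσ : IsStoppingTime 𝔽 σ)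
    (n : ℕ) : Monotone fun t => ∫ ω, stoppedProcess (frozen S n) σ t ω ∂P := by
  refine monotone_nat_of_le_succ fun t => ?_
  set C : ℕ → Set Ω := fun t =>
    {ω | (t : WithTop ℕ) < σ ω} ∩ {ω | runMax S t ω < n ∧ 0 < S t ω} with hC
  have hCm : ∀ t, MeasurableSet[𝔽 t] (C t) := fun t =>
    (measurableSet_natCast_lt hσ t).inter
      ((measurable_runMax_of (fun r hr => (hS.adapted r).mono (𝔽.mono hr) le_rfl)
        (measurableSet_Iio (a := (n : ℤ)))).inter (hS.adapted t (measurableSet_Ioi (a := 0))))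
  have hi := integrable_stoppedProcess_frozen hS hσ n
  have hle : ∫ ω, (C t).indicator (step S t) ω ∂P ≤
      ∫ ω, (stoppedProcess (frozen S n) σ (t + 1) ω - stoppedProcess (frozen S n) σ t ω) ∂P := by
    refine integral_mono_ae ((hS.integrable_step t).indicator (𝔽.le t _ (hCm t)))
      ((hi _).sub (hi _)) ?_
    filter_upwards [hS.ae_unitPath] with ω hω
    simp only [stoppedProcess_eq_cutTime]
    by_cases ht : (t : WithTop ℕ) < σ ω
    · rw [cutTime_succ_of_lt ht, cutTime_of_le ht.le, hC, ← indicator_indicator,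
        indicator_of_mem (by exact ht)]
      exact indicator_step_le_frozen_succ_sub hω n t
    · rw [cutTime_succ_of_not_lt ht, indicator_of_notMem (fun h => ht h.1), sub_self]
  rw [hS.integral_indicator_step hCm, integral_sub (hi _) (hi _)] at hle
  linarith

/-- At time `t` the maximum has not reached `t + 1`, so the frozen functional is the positive
part. -/
theorem integral_pos_part_stoppedProcess_le (hS : IsSimpleRandomWalk S 𝔽 P)
    (hσ : IsStoppingTime 𝔽 σ) (hfin : ∀ᵐ ω ∂P, σ ω ≠ ⊤) (t : ℕ) :
    ∫ ω, max ((stoppedProcess S σ t ω : ℤ) : ℝ) 0 ∂P ≤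
      ∫ ω, stoppedValue (frozen S (t + 1)) σ ω ∂P := by
  have hi := integrable_stoppedProcess_frozen hS hσ (t + 1)
  have h1 : ∫ ω, max ((stoppedProcess S σ t ω : ℤ) : ℝ) 0 ∂P =
      ∫ ω, stoppedProcess (frozen S (t + 1)) σ t ω ∂P := by
    refine integral_congr_ae ?_
    filter_upwards [hS.ae_unitPath] with ω hω
    have h2 := hω.runMax_le (cutTime (σ ω) t)
    have h3 := cutTime_le (σ ω) t
    simp only [stoppedProcess_eq_cutTime, frozen]
    rw [if_neg (by push_cast; omega)]
  rw [h1]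
  refine ge_of_tendsto (tendsto_integral_of_dominated_convergence (fun _ => ((t + 1 : ℕ) : ℝ))
    (fun s => (hi s).aestronglyMeasurable) (integrable_const _)
    (fun s => Eventually.of_forall fun ω => ?_) ?_)
    ((eventually_ge_atTop t).mono fun s hs => monotone_integral_frozen hS hσ (t + 1) hs)
  · rw [stoppedProcess_eq_cutTime, Real.norm_eq_abs, abs_of_nonneg (frozen_mem_Icc _ _ _).1]
    exact (frozen_mem_Icc _ _ _).2
  · filter_upwards [hfin] with ω hω
    refine tendsto_const_nhds.congr' ?_
    filter_upwards [stoppedProcess_eventuallyEq (frozen S (t + 1)) hω] with s hs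
    rw [hs]

/-- Before stopping, the maximum reaches `n` exactly if its value upon stopping is at least `n`. -/
theorem mem_reached_iff_le_stoppedValue {ω : Ω} (h : UnitPath fun t => S t ω)
    (hfin : tauAY S η ω ≠ ⊤) (n : ℕ) :
    ω ∈ Reached S η n ↔ (n : ℤ) ≤ stoppedValue (runMax S) (tauAY S η) ω := by
  obtain ⟨k, hk⟩ := exists_natCast_eq hfin
  rw [mem_reached_iff h, stoppedValue_of_eq hk, hk]
  refine ⟨?_, fun hn => ⟨k, le_rfl, hn⟩⟩
  rintro ⟨t, ht, hn⟩
  exact hn.trans (runMax_mono (by exact_mod_cast ht))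

theorem measureReal_runMax_tauAY (hint : Integrable (fun j : ℤ => (j : ℝ)) μ)
    (hcent : ∫ j : ℤ, (j : ℝ) ∂μ = 0) (hS : IsSimpleRandomWalk S 𝔽 P) (hη : IsCoinFamily μ η S P)
    (n : ℕ) : P.real {ω | (n : ℤ) ≤ stoppedValue (runMax S) (tauAY S η) ω} = reach μ n := by
  rw [← measureReal_reached hint hcent hS hη n]
  refine measureReal_congr ?_
  filter_upwards [hS.ae_unitPath, ae_tauAY_ne_top hint hcent hS hη] with ω h1 h2
  exact propext (mem_reached_iff_le_stoppedValue h1 h2 n).symm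

/-- Given that the maximum reaches `n`, the stopped walk has conditional mean `n`. -/
theorem setIntegral_reached (hint : Integrable (fun j : ℤ => (j : ℝ)) μ)
    (hcent : ∫ j : ℤ, (j : ℝ) ∂μ = 0) (hS : IsSimpleRandomWalk S 𝔽 P) (hη : IsCoinFamily μ η S P)
    (n : ℕ) :
    ∫ ω in Reached S η n, (((stoppedValue S (tauAY S η) ω : ℤ) : ℝ) - n) ∂P = 0 := by
  have hlaw := hasLaw_stoppedValue_tauAY hint hcent hS hη
  have hm : AEMeasurable (stoppedValue S (tauAY S η)) (P.restrict (Reached S η n)) :=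
    hlaw.aemeasurable.restrict
  set ν := (P.restrict (Reached S η n)).map (stoppedValue S (tauAY S η)) with hν
  have hi : Integrable (fun j : ℤ => (j : ℝ) - n) ν :=
    (integrable_map_measure (measurable_of_countable _).aestronglyMeasurable hm).2
      ((integrable_of_hasLaw hlaw hint).sub (integrable_const (n : ℝ))).integrableOn
  have hsing : ∀ j, ν.real {j} = residual μ n j := by
    intro j
    rw [← measureReal_stoppedAt_inter_reached hint hcent hS hη n j, measureReal_def, hν,
      Measure.map_apply_of_aemeasurable hm (measurableSet_singleton j),
      Measure.restrict_apply' (measurableSet_reached hS.measurable hη.measurable n),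
      ← measureReal_def]
    refine measureReal_congr ?_
    filter_upwards [ae_tauAY_ne_top hint hcent hS hη] with ω hω
    exact propext (and_congr_left' (stoppedValue_eq_iff hω j))
  have hsum := hasSum_integral hi
  simp only [hsing] at hsum
  have hzero := hsum.unique (hasSum_sub_mul_residual hint hcent n)
  rwa [hν, integral_map hm (measurable_of_countable _).aestronglyMeasurable] at hzero

theorem uniformIntegrable_stoppedProcess_tauAY (hint : Integrable (fun j : ℤ => (j : ℝ)) μ)
    (hcent : ∫ j : ℤ, (j : ℝ) ∂μ = 0) (hS : IsSimpleRandomWalk S 𝔽 P)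
    (hη : IsCoinFamily μ η S P) :
    UniformIntegrable (fun (t : ℕ) ω => ((stoppedProcess S (tauAY S η) t ω : ℤ) : ℝ)) 1 P := by
  have hlaw := hasLaw_stoppedValue_tauAY hint hcent hS hη
  have hfin := ae_tauAY_ne_top hint hcent hS hη
  have hi := integrable_of_hasLaw hlaw hint
  have hS' := isSimpleRandomWalk_coinFiltration hS hη
  have hst := isStoppingTime_tauAY hS.measurable hη.measurable
  refine uniformIntegrable_stoppedProcess hS' hst hfin hi ?_ fun t => ?_
  · rw [integral_of_hasLaw hlaw (fun j => (j : ℝ)), hcent]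
  · have hR := measurableSet_reached hS.measurable hη.measurable (t + 1)
    have hn : Integrable (fun ω => ((stoppedValue S (tauAY S η) ω : ℤ) : ℝ) - (t + 1 : ℕ)) P :=
      hi.sub (integrable_const _)
    have h0 := setIntegral_reached hint hcent hS hη (t + 1)
    rw [← integral_indicator hR] at h0
    calc _ ≤ ∫ ω, stoppedValue (frozen S (t + 1)) (tauAY S η) ω ∂P :=
          integral_pos_part_stoppedProcess_le hS' hst hfin t
      _ ≤ ∫ ω, (max ((stoppedValue S (tauAY S η) ω : ℤ) : ℝ) 0 - (Reached S η (t + 1)).indicator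
            (fun ω => ((stoppedValue S (tauAY S η) ω : ℤ) : ℝ) - (t + 1 : ℕ)) ω) ∂P := by
          refine integral_mono_of_nonneg (Eventually.of_forall fun ω => (frozen_mem_Icc _ _ _).1)
            (hi.pos_part.sub (hn.indicator hR)) ?_
          filter_upwards [hS.ae_unitPath, hfin] with ω h1 h2
          have hiff := mem_reached_iff_le_stoppedValue h1 h2 (t + 1)
          by_cases hω : ω ∈ Reached S η (t + 1)
          · have : stoppedValue (frozen S (t + 1)) (tauAY S η) ω = (t + 1 : ℕ) :=
              if_pos (hiff.1 hω)
            rw [indicator_of_mem hω, this]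
            linarith [le_max_left ((stoppedValue S (tauAY S η) ω : ℤ) : ℝ) 0]
          · have : stoppedValue (frozen S (t + 1)) (tauAY S η) ω =
                max ((stoppedValue S (tauAY S η) ω : ℤ) : ℝ) 0 := if_neg (hiff.not.1 hω)
            rw [indicator_of_notMem hω, this, sub_zero]
      _ = _ := by
          rw [integral_sub hi.pos_part (hn.indicator hR), h0, sub_zero]

theorem tauAY_mem_SEP (hint : Integrable (fun j : ℤ => (j : ℝ)) μ)
    (hcent : ∫ j : ℤ, (j : ℝ) ∂μ = 0) (hS : IsSimpleRandomWalk S 𝔽 P)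
    (hη : IsCoinFamily μ η S P) :
    tauAY S η ∈ SEP S (coinFiltration S η hS.measurable hη.measurable) P μ :=
  ⟨isStoppingTime_tauAY hS.measurable hη.measurable, ae_tauAY_ne_top hint hcent hS hη,
    hasLaw_stoppedValue_tauAY hint hcent hS hη,
    uniformIntegrable_stoppedProcess_tauAY hint hcent hS hη⟩

end Embedding

end AzemaYor

theorem theorem2 (μ : MeasureTheory.Measure ℤ) [MeasureTheory.IsProbabilityMeasure μ]
    (hint : MeasureTheory.Integrable (fun j : ℤ => (j : ℝ)) μ)
    (hcent : ∫ j : ℤ, (j : ℝ) ∂μ = 0) :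
    -- the coin biases are probabilities
    (∀ i : AzemaYor.CoinIndex μ,
      0 ≤ AzemaYor.rho μ i.1.1 i.1.2 ∧ AzemaYor.rho μ i.1.1 i.1.2 ≤ 1) ∧
    -- for every walk `S` on a filtered probability space and every family of coins
    (∀ (Ω : Type*) (mΩ : MeasurableSpace Ω) (P : MeasureTheory.Measure Ω)
      (_ : MeasureTheory.IsProbabilityMeasure P)
      (𝔽 : MeasureTheory.Filtration ℕ mΩ) (S : ℕ → Ω → ℤ)
      (η : AzemaYor.CoinIndex μ → Ω → Fin 2)
      (hS : AzemaYor.IsSimpleRandomWalk S 𝔽 P) (hη : AzemaYor.IsCoinFamily μ η S P),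
      -- `S` is a random walk in the filtration generated by the walk and the coins shown
      AzemaYor.IsSimpleRandomWalk S
        (AzemaYor.coinFiltration S η hS.measurable hη.measurable) P ∧
      -- the stopping time embeds `μ`
      AzemaYor.tauAY S η ∈
        AzemaYor.SEP S (AzemaYor.coinFiltration S η hS.measurable hη.measurable) P μ ∧
      -- it maximizes the law of the maximum and attains the bound
      (∀ σ ∈ AzemaYor.SEP S 𝔽 P μ, ∀ n : ℕ, 1 ≤ n →
        P.real {ω | (n : ℤ) ≤ MeasureTheory.stoppedValue (AzemaYor.runMax S) σ ω} ≤
          P.real {ω | (n : ℤ) ≤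
            MeasureTheory.stoppedValue (AzemaYor.runMax S) (AzemaYor.tauAY S η) ω}) ∧
      (∀ n : ℕ, 1 ≤ n →
        P.real {ω | (n : ℤ) ≤
            MeasureTheory.stoppedValue (AzemaYor.runMax S) (AzemaYor.tauAY S η) ω} =
          AzemaYor.maxBound μ n)) ∧
    -- the bound is the tail of the Hardy–Littlewood transform
    (∀ n : ℕ, 1 ≤ n → AzemaYor.maxBound μ n = AzemaYor.hardyLittlewoodTail μ n) := by
  refine ⟨fun i => AzemaYor.rho_mem_Icc hint hcent i.2, ?_, fun n hn => ?_⟩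
  · intro Ω mΩ P hP 𝔽 S η hS hη
    refine ⟨AzemaYor.isSimpleRandomWalk_coinFiltration hS hη,
      AzemaYor.tauAY_mem_SEP hint hcent hS hη, fun σ hσ n hn => ?_, fun n hn => ?_⟩
    · rw [AzemaYor.measureReal_runMax_tauAY hint hcent hS hη]
      exact AzemaYor.measureReal_runMax_le_reach hint hcent hS hσ hn
    · rw [AzemaYor.measureReal_runMax_tauAY hint hcent hS hη,
        AzemaYor.maxBound_eq_reach hint hcent hn]
  · rw [AzemaYor.maxBound_eq_reach hint hcent hn,
      AzemaYor.hardyLittlewoodTail_eq_reach hint hcent hn]
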